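/- **Theorem (deterministic sinkless orientation with small node-averaged complexity).** Consider the LOCAL model: the network is a finite simple undirected graph $G=(V,E)$ with $n=|V|$ nodes; every node $v$ has a unique identifier $\mathrm{id}(v)\in\{0,\dots,n^c-1\}$ for a constant $c$ and initially knows $n$ and $\mathrm{id}(v)$; in every synchronous round every node may send an arbitrary message to each neighbor, receives the messages of its neighbors, and performs arbitrary local computation. A node may at some point irrevocably commit to its output, and may later stop (send no further messages). A *sinkless orientation* of $G$ is an orientation of all edges of $G$ such that every node has at least one outgoing edge; here the output of a node is the set of its out-neighbors, i.e. the orientation of all its incident edges, and the outputs of the two endpoints of an edge must agree. Let $T_v$ be the number of rounds after which $v$ has committed to its output. For every constant $c$ there are a deterministic LOCAL algorithm $\mathcal A$ and a constant $C$ such that for every $n$, every $n$-node graph $G$ with minimum degree at least $3$ and every assignment of unique identifiers from $\{0,\dots,n^c-1\}$, the algorithm $\mathcal A$ computes a sinkless orientation of $G$, its node-averaged complexity satisfies $$\frac1n\sum_{v\in V}T_v\;\le\; C\cdot\log^* n ,$$ and all nodes have committed to their outputs and stopped after at most $C\cdot\log n$ rounds. Here $\log^* n$ is the least number of times that $\log_2$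 has to be applied to $n$ until the value is at most $1$. -/

import Mathlib

/-- The iterated logarithm `log* n`: the least number of times that the binary logarithm has to be
applied to `n` until the value is at most `1`. -/
noncomputable def logStar (n : ℕ) : ℕ :=
  sInf {k : ℕ | (Real.logb 2)^[k] (n : ℝ) ≤ 1}

/-- A deterministic algorithm in the LOCAL model, with node outputs in `Out`.
All nodes run the same code; local computation and message size are unrestricted. -/
structure LocalAlgorithm (Out : Type) where
  /-- internal states of a node -/
  State : Type
  /-- messages -/
  Msg : Type
  /-- `start n i`: the initial state of a node with identifier `i` in an `n`-node graph -/
  start : ℕ → ℕ → State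
  /-- `send s j`: the message that a node in state `s` sends to its neighbor with identifier `j` -/
  send : State → ℕ → Msg
  /-- `receive s M`: the next state of a node in state `s` that receives the messages in `M`,
  each of them paired with the identifier of its sender -/
  receive : State → Set (ℕ × Msg) → State
  /-- the output, once the node has committed to one -/
  output : State → Option Out
  /-- whether the node has stopped; such a node sends no messages and never changes its state -/
  halted : State → Bool

namespace LocalAlgorithm

variable {Out : Type} {V : Type*} [Fintype V]

/-- The state of each node after `t` synchronous rounds of `A` on the graph `G` with
identifiers `ident`. -/
noncomputable def stateAfter (A : LocalAlgorithm Out) (G : SimpleGraph V) (ident : V → ℕ) :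
    ℕ → V → A.State
  | 0 => fun v => A.start (Fintype.card V) (ident v)
  | t + 1 => fun v =>
      if A.halted (A.stateAfter G ident t v) = true then A.stateAfter G ident t v
      else A.receive (A.stateAfter G ident t v)
        {m | ∃ u, G.Adj u v ∧ A.halted (A.stateAfter G ident t u) = false ∧
          m = (ident u, A.send (A.stateAfter G ident t u) (ident v))}

/-- `v` has committed to an output after at most `t` rounds. -/
def CommittedBy (A : LocalAlgorithm Out) (G : SimpleGraph V) (ident : V → ℕ) (t : ℕ) (v : V) :
    Prop :=
  ∃ s ≤ t, (A.output (A.stateAfter G ident s v)).isSome = true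

/-- `v` has terminated after `t` rounds: it has committed to an output and has stopped. -/
def TerminatedBy (A : LocalAlgorithm Out) (G : SimpleGraph V) (ident : V → ℕ) (t : ℕ) (v : V) :
    Prop :=
  A.CommittedBy G ident t v ∧ A.halted (A.stateAfter G ident t v) = true

/-- Every node eventually commits to an output and stops. -/
def Terminates (A : LocalAlgorithm Out) (G : SimpleGraph V) (ident : V → ℕ) : Prop :=
  ∀ v, ∃ t, A.TerminatedBy G ident t v

/-- The computation time of `v`: the number of rounds after which `v` commits to its output
(meaningful if `A` terminates). -/
noncomputable def computationTime (A : LocalAlgorithm Out) (G : SimpleGraph V) (ident : V → ℕ)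
    (v : V) : ℕ :=
  sInf {t | A.CommittedBy G ident t v}

/-- The number of rounds after which `v` terminates (meaningful if `A` terminates). -/
noncomputable def terminationTime (A : LocalAlgorithm Out) (G : SimpleGraph V) (ident : V → ℕ)
    (v : V) : ℕ :=
  sInf {t | A.TerminatedBy G ident t v}

/-- The output to which `v` commits; commitments are irrevocable, so only the first one counts. -/
noncomputable def result (A : LocalAlgorithm Out) (G : SimpleGraph V) (ident : V → ℕ) (v : V) :
    Option Out :=
  A.output (A.stateAfter G ident (A.computationTime G ident v) v)

/-- The average of the computation times of the nodes. -/
noncomputable def nodeAverage (A : LocalAlgorithm Out) (G : SimpleGraph V) (ident : V → ℕ) : ℝ :=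
  (∑ v, (A.computationTime G ident v : ℝ)) / Fintype.card V

/-- The number of rounds until all nodes have terminated. -/
noncomputable def worstCase (A : LocalAlgorithm Out) (G : SimpleGraph V) (ident : V → ℕ) : ℕ :=
  Finset.univ.sup (A.terminationTime G ident)

end LocalAlgorithm

/-- `D` is a sinkless orientation of `G`: it directs every edge of `G` in exactly one of the two
ways, relates no other pairs, and gives every node an outgoing edge. -/
structure IsSinklessOrientation {V : Type*} (G : SimpleGraph V) (D : V → V → Prop) : Prop where
  adj_of_dir : ∀ u v, D u v → G.Adj u v
  dir_of_adj : ∀ u v, G.Adj u v → (D u v ∨ D v u)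
  not_both : ∀ u v, D u v → ¬ D v u
  exists_out : ∀ u, ∃ v, D u v

namespace LocalAlgorithm

/-- `A` computes a sinkless orientation of `G`: it terminates, the output of each node is the set of
identifiers of its out-neighbors, and these outputs fit together to a sinkless orientation. In
particular, a node that has committed knows the direction of all its incident edges. -/
def ComputesSinklessOrientation {V : Type*} [Fintype V] (A : LocalAlgorithm (Finset ℕ))
    (G : SimpleGraph V) (ident : V → ℕ) : Prop :=
  A.Terminates G ident ∧
    IsSinklessOrientation G (fun u v => ∃ S, A.result G ident u = some S ∧ ident v ∈ S)

end LocalAlgorithm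

/-!
Every node repeatedly passes through *stages*, each of which orients a part of the remaining edges,
gives an outgoing edge to most of the nodes that need one, and hands over a much smaller *instance*:
a graph together with the *needy* nodes, those without an outgoing edge so far.

In the first stage (`Pick.stage`), every node picks three neighbors. A node with a pick that is not
mutual directs this edge outwards and needs nothing more. What remains is the graph of mutual picks,
which has maximum degree three and in which the needy nodes have degree exactly three.

The level with parameter `h` (`Level.plan`) decomposes the graph into clusters around centers with
pairwise distances greater than `32 * h`; each cluster has a spanning tree whose edges can be
directed towards the center. A center gets an outgoing edge if its cluster has an *end*: a node that
is not needy, or one with a suitable edge outside the forest. The path from the end to the center is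
then reversed, and the end uses the other edge. A cluster without an end induces a tree of needy
nodes, which have degree three with few exceptions. In such a tree one selects a node of degree
three and of depth at most `8 * h` that has the fewest descendants, directs everything else towards
this node, and keeps only its descendants for the next level. Since the tree branches almost
everywhere, it has `2 ^ (3 * h)` disjoint subtrees to choose from, so the number of nodes drops by
this factor (`Level.Centers.ncard_kept_le`). The kept nodes that remain needy keep their degrees,
with the exception of the selected nodes, which lose one edge and are far apart. Thus trees keep
branching exponentially (`Thin.pow_le_card_layer`), and the invariant `Thin` is maintained
(`Level.Centers.thin_next`).

After the levels, the graph is completed in `O(log n)` rounds (`Finish.plan`): a tree of needy nodes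
without an end would have more than `n` nodes at depth `O(log n)`.

The centers are computed from a coloring of the `32 * h`-th power of the graph, whose degree is
bounded in terms of `h`, with Linial's color reduction. After `log* n` steps the number of colors
depends only on `h` and the constant `c` (`palette_le`), so a level takes `exp(O(h)) * log* n`
rounds. With `h` quadratic in the index `k` of the level, the number of nodes before the level `k`
is at most `n / 2 ^ shrink k`, where `shrink k` is cubic in `k`, and the total time of all nodes is
`O(n log* n)` (`exists_total_weight`, `total_cost_le`). The levels are stopped when their total time
would exceed `log n`; at this point the time `O(log n)` of the completion is at most proportional to
the time of the levels, including the first one left out, so that it does not increase the order of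
the average.

All stages are local functions of the graph (`Loc`), and the algorithm in the LOCAL model (`gather`)
lets every node collect the graph around it and commit as soon as its output is determined by what
it has seen (`stageOutput_determined`).
-/

namespace SinklessOrientation

/-! ### Graphs on identifiers, balls and locality -/

/-- `Within U r v x`: the distance of `v` and `x` in `U` is at most `r`. -/
def Within (U : SimpleGraph ℕ) (r v x : ℕ) : Prop :=
  ∃ p : U.Walk v x, p.length ≤ r

section Within

variable {U U' : SimpleGraph ℕ} {r k v x y : ℕ}

theorem Within.refl (U : SimpleGraph ℕ) (r v : ℕ) : Within U r v v :=
  ⟨.nil, Nat.zero_le _⟩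

theorem Within.symm (h : Within U r v x) : Within U r x v := by
  obtain ⟨p, hp⟩ := h
  exact ⟨p.reverse, by simpa using hp⟩

theorem Within.trans (h : Within U r v x) (h' : Within U k x y) : Within U (r + k) v y := by
  obtain ⟨p, hp⟩ := h
  obtain ⟨q, hq⟩ := h'
  exact ⟨p.append q, by rw [SimpleGraph.Walk.length_append]; omega⟩

theorem Within.mono (h : Within U r v x) (hr : r ≤ k) : Within U k v x := by
  obtain ⟨p, hp⟩ := h
  exact ⟨p, hp.trans hr⟩

theorem Within.mono_graph (h : Within U r v x) (hU : U ≤ U') : Within U' r v x := by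
  obtain ⟨p, hp⟩ := h
  exact ⟨p.mapLe hU, by simpa using hp⟩

theorem Within.of_adj (h : U.Adj v x) : Within U 1 v x :=
  ⟨.cons h .nil, by simp⟩

theorem within_zero_iff : Within U 0 v x ↔ v = x := by
  constructor
  · rintro ⟨p, hp⟩
    exact SimpleGraph.Walk.eq_of_length_eq_zero (Nat.le_zero.mp hp)
  · rintro rfl
    exact Within.refl U 0 v

theorem within_succ_iff :
    Within U (k + 1) v x ↔ v = x ∨ ∃ y, U.Adj v y ∧ Within U k y x := by
  constructor
  · rintro ⟨p, hp⟩
    cases p with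
    | nil => exact Or.inl rfl
    | cons h q => exact Or.inr ⟨_, h, q, by simpa using hp⟩
  · rintro (rfl | ⟨y, hy, q, hq⟩)
    · exact Within.refl U _ _
    · exact ⟨.cons hy q, by simpa using hq⟩

theorem within_succ_iff' :
    Within U (k + 1) v x ↔ v = x ∨ ∃ y, Within U k v y ∧ U.Adj y x := by
  constructor
  · intro h
    rcases within_succ_iff.mp h.symm with h | ⟨y, hy, hw⟩
    · exact Or.inl h.symm
    · exact Or.inr ⟨y, hw.symm, hy.symm⟩
  · rintro (rfl | ⟨y, hy, hw⟩)
    · exact Within.refl U _ _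
    · exact hy.trans (Within.of_adj hw)

theorem Within.exists_adj (h : Within U r v x) (hne : v ≠ x) : ∃ y, U.Adj v y := by
  obtain ⟨p, -⟩ := h
  cases p with
  | nil => exact absurd rfl hne
  | cons h q => exact ⟨_, h⟩

/-- In a graph of maximum degree `3`, balls of radius `r` have at most `4 ^ r` nodes. -/
theorem encard_within_le (h : ∀ v, (U.neighborSet v).encard ≤ 3) (r v : ℕ) :
    {x | Within U r v x}.encard ≤ 4 ^ r := by
  induction r generalizing v with
  | zero =>
    have : {x | Within U 0 v x} = {v} := by
      ext x; simp [within_zero_iff, eq_comm]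
    rw [this]; simp
  | succ r ih =>
    have hsub : {x | Within U (r + 1) v x} ⊆ insert v
        (⋃ y ∈ (Set.finite_of_encard_le_coe (h v)).toFinset, {x | Within U r y x}) := by
      intro x hx
      rcases within_succ_iff.mp hx with rfl | ⟨y, hy, hyx⟩
      · exact Set.mem_insert _ _
      · right
        simp only [Set.mem_iUnion]
        exact ⟨y, by simpa using hy, hyx⟩
    have hfin : ∀ y, {x | Within U r y x}.Finite := fun y =>
      Set.finite_of_encard_le_coe (k := 4 ^ r) (by simpa using ih y)
    have hball : ∀ y, (hfin y).toFinset.card ≤ 4 ^ r := by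
      intro y
      have := ih y
      rw [(hfin y).encard_eq_coe_toFinset_card] at this
      exact_mod_cast this
    have hnb : (Set.finite_of_encard_le_coe (h v)).toFinset.card ≤ 3 := by
      have := h v
      rw [(Set.finite_of_encard_le_coe (h v)).encard_eq_coe_toFinset_card] at this
      exact_mod_cast this
    have heq : insert v
        (⋃ y ∈ (Set.finite_of_encard_le_coe (h v)).toFinset, {x | Within U r y x}) =
        ((insert v ((Set.finite_of_encard_le_coe (h v)).toFinset.biUnion
          fun y => (hfin y).toFinset) : Finset ℕ) : Set ℕ) := by
      ext x
      simp
    rw [heq] at hsub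
    refine (Set.encard_le_encard hsub).trans ?_
    rw [Set.encard_coe_eq_coe_finsetCard]
    have h1 := Finset.card_insert_le v ((Set.finite_of_encard_le_coe (h v)).toFinset.biUnion
          fun y => (hfin y).toFinset)
    have h2 := Finset.card_biUnion_le_card_mul (Set.finite_of_encard_le_coe (h v)).toFinset
      (fun y => (hfin y).toFinset) (4 ^ r) (fun y _ => hball y)
    have h3 := Nat.mul_le_mul_right (4 ^ r) hnb
    have h4 : 1 ≤ 4 ^ r := Nat.one_le_pow _ _ (by norm_num)
    have : (insert v ((Set.finite_of_encard_le_coe (h v)).toFinset.biUnion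
          fun y => (hfin y).toFinset)).card ≤ 4 ^ (r + 1) := by
      rw [pow_succ]; omega
    exact_mod_cast this

end Within

/-- An instance of the generalized problem: a graph on the identifiers, together with the set of
those nodes which have to get an outgoing edge. -/
structure Inst where
  /-- the graph -/
  gr : SimpleGraph ℕ
  /-- the nodes that need an outgoing edge -/
  needy : Set ℕ

/-- Two instances look the same from `v` up to distance `r`. -/
def Agree (I J : Inst) (v r : ℕ) : Prop :=
  ∀ x, Within I.gr r v x → I.gr.Adj x = J.gr.Adj x ∧ (x ∈ I.needy ↔ x ∈ J.needy)

section Agree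

variable {I J : Inst} {v x r k : ℕ}

theorem Agree.within (h : Agree I J v r) (hk : k ≤ r + 1) (hx : Within I.gr k v x) :
    Within J.gr k v x := by
  induction k generalizing x with
  | zero => rw [within_zero_iff] at hx ⊢; exact hx
  | succ k ih =>
    rcases within_succ_iff'.mp hx with rfl | ⟨y, hy, hyx⟩
    · exact Within.refl _ _ _
    · refine within_succ_iff'.mpr (Or.inr ⟨y, ih (by omega) hy, ?_⟩)
      rw [← (h y (hy.mono (by omega))).1]
      exact hyx

/-- Agreement is symmetric: a walk of length at most `r` in one of the instances is found step by
step in the other one. -/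
theorem Agree.symm (h : Agree I J v r) : Agree J I v r := by
  have key : ∀ k ≤ r, ∀ x, Within J.gr k v x → Within I.gr k v x := by
    intro k
    induction k with
    | zero => intro _ x hx; rw [within_zero_iff] at hx ⊢; exact hx
    | succ k ih =>
      intro hk x hx
      rcases within_succ_iff'.mp hx with rfl | ⟨y, hy, hyx⟩
      · exact Within.refl _ _ _
      · have hy' := ih (by omega) y hy
        refine within_succ_iff'.mpr (Or.inr ⟨y, hy', ?_⟩)
        rw [(h y (hy'.mono (by omega))).1]
        exact hyx
  intro x hx
  have := h x (key r le_rfl x hx)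
  exact ⟨this.1.symm, this.2.symm⟩

theorem Agree.within_iff (h : Agree I J v r) (hk : k ≤ r + 1) :
    Within I.gr k v x ↔ Within J.gr k v x :=
  ⟨h.within hk, h.symm.within hk⟩

theorem Agree.mono (h : Agree I J v r) (hk : k ≤ r) : Agree I J v k :=
  fun x hx => h x (hx.mono hk)

theorem Agree.shift (h : Agree I J v (r + k)) (hx : Within I.gr k v x) : Agree I J x r :=
  fun y hy => h y ((hx.trans hy).mono (by omega))

end Agree

/-- `f` is `r`-local: its value at `v` depends only on what is seen from `v` up to distance `r`. -/
def Loc {α : Type*} (r : ℕ) (f : Inst → ℕ → α) : Prop :=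
  ∀ I J v, Agree I J v r → f I v = f J v

section Loc

variable {α β : Type*} {r k : ℕ}

theorem Loc.mono {f : Inst → ℕ → α} (h : Loc r f) (hr : r ≤ k) : Loc k f :=
  fun I J v hv => h I J v (hv.mono hr)

theorem Loc.adj : Loc 0 (fun I v => I.gr.Adj v) :=
  fun _ _ v h => (h v (Within.refl _ _ _)).1

theorem Loc.needy : Loc 0 (fun I v => v ∈ I.needy) :=
  fun _ _ v h => propext (h v (Within.refl _ _ _)).2

theorem Loc.const (c : ℕ → α) : Loc r (fun _ v => c v) :=
  fun _ _ _ _ => rfl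

theorem Loc.map {f : Inst → ℕ → α} (h : Loc r f) (g : ℕ → α → β) :
    Loc r (fun I v => g v (f I v)) :=
  fun I J v hv => congrArg (g v) (h I J v hv)

theorem Loc.prod {f : Inst → ℕ → α} {g : Inst → ℕ → β} (hf : Loc r f) (hg : Loc r g) :
    Loc r (fun I v => (f I v, g I v)) :=
  fun I J v hv => Prod.ext (hf I J v hv) (hg I J v hv)

/-- A set of nodes near `v` that is cut out by a condition on local data is a local datum. Sets of
nodes are defined with an explicit bound on the distance below, even where it is implied by the
other conditions, so that their locality follows from this lemma. -/
theorem Loc.setOf {f : Inst → ℕ → α} (h : Loc r f) (k : ℕ) (Φ : ℕ → ℕ → α → α → Prop) :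
    Loc (r + k) (fun I v => {x | Within I.gr k v x ∧ Φ v x (f I v) (f I x)}) := by
  intro I J v hv
  ext x
  simp only [Set.mem_ofPred_eq]
  rw [← hv.within_iff (show k ≤ r + k + 1 by omega), h I J v (hv.mono (by omega))]
  refine and_congr_right fun hx => ?_
  rw [h I J x (hv.shift hx)]

/-- A set of values at nodes near `v` is a local datum. -/
theorem Loc.image {f : Inst → ℕ → α} (h : Loc r f) (k : ℕ) (Φ : ℕ → ℕ → α → β → Prop) :
    Loc (r + k) (fun I v => {y | ∃ x, Within I.gr k v x ∧ Φ v x (f I x) y}) := by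
  intro I J v hv
  ext y
  simp only [Set.mem_ofPred_eq]
  refine exists_congr fun x => ?_
  rw [← hv.within_iff (show k ≤ r + k + 1 by omega)]
  refine and_congr_right fun hx => ?_
  rw [h I J x (hv.shift hx)]

theorem Loc.exists {f : Inst → ℕ → α} (h : Loc r f) (k : ℕ) (Φ : ℕ → ℕ → α → α → Prop) :
    Loc (r + k) (fun I v => ∃ x, Within I.gr k v x ∧ Φ v x (f I v) (f I x)) :=
  (h.setOf k Φ).map fun _ S => S.Nonempty

theorem Loc.iterate {p : Inst → ℕ → ℕ} (h : Loc r p) (hw : ∀ I v, Within I.gr 1 v (p I v))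
    (j : ℕ) : Loc (r + j) (fun I v => (p I)^[j] v) := by
  induction j with
  | zero => exact fun _ _ _ _ => rfl
  | succ j ih =>
    intro I J v hv
    have h1 : p I v = p J v := h I J v (hv.mono (by omega))
    simp only [Function.iterate_succ_apply]
    rw [← h1]
    exact ih I J _ (Agree.shift (k := 1) hv (hw I v))

/-- Locality of a composition with a local transformation of instances. As the transformation only
removes edges, balls do not become larger. -/
theorem Loc.comp {S : Inst → Inst} {r₀ : ℕ} (hS : ∀ I, (S I).gr ≤ I.gr)
    (ha : Loc r₀ (fun I v => (S I).gr.Adj v)) (hn : Loc r₀ (fun I v => v ∈ (S I).needy))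
    {f : Inst → ℕ → α} (hf : Loc r f) : Loc (r₀ + r) (fun I v => f (S I) v) := by
  intro I J v hv
  refine hf _ _ v fun x hx => ?_
  have hx' := hv.shift (hx.mono_graph (hS I))
  exact ⟨ha I J x hx', iff_of_eq (hn I J x hx')⟩

end Loc

/-! ### From local functions to LOCAL algorithms -/

/-- The two graphs look the same from `v` up to distance `r`. -/
def GAgree (G H : SimpleGraph ℕ) (v r : ℕ) : Prop :=
  Agree ⟨G, Set.univ⟩ ⟨H, Set.univ⟩ v r

/-- The output of the node `v` prescribed by `Out` is determined by what is seen from `v` up to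
distance `r`. -/
def Determined (Out : SimpleGraph ℕ → ℕ → Finset ℕ) (G : SimpleGraph ℕ) (v r : ℕ) : Prop :=
  ∀ H, GAgree G H v r → Out H v = Out G v

/-- The state of a node that collects all edges in its surroundings. -/
structure Knowledge where
  /-- number of nodes of the network -/
  size : ℕ
  /-- identifier of the node -/
  name : ℕ
  /-- number of rounds that have passed -/
  time : ℕ
  /-- known edges, as pairs of identifiers -/
  edges : Set (ℕ × ℕ)

/-- The graph formed by the known edges. -/
def Knowledge.graph (s : Knowledge) : SimpleGraph ℕ :=
  SimpleGraph.fromRel fun x y => (x, y) ∈ s.edges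

open Classical in
/-- The algorithm in which every node collects all edges in its surroundings, commits to the output
prescribed by `Out` as soon as this output is determined by the known part of the graph, and stops
after `T n` rounds. -/
noncomputable def gather (Out : ℕ → SimpleGraph ℕ → ℕ → Finset ℕ) (T : ℕ → ℕ) :
    LocalAlgorithm (Finset ℕ) where
  State := Knowledge
  Msg := Set (ℕ × ℕ)
  start n i := ⟨n, i, 0, ∅⟩
  send s _ := s.edges
  receive s M :=
    ⟨s.size, s.name, s.time + 1, s.edges ∪ {e | ∃ m ∈ M, e ∈ m.2 ∨ e = (s.name, m.1)}⟩
  output s :=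
    if 0 < s.time ∧ Determined (Out s.size) s.graph s.name (s.time - 1) then
      some (Out s.size s.graph s.name)
    else none
  halted s := decide (T s.size ≤ s.time)

section Gather

variable {V : Type*} (G : SimpleGraph V) (ident : V → ℕ)

/-- The copy of the network on the identifiers. -/
def idGraph : SimpleGraph ℕ :=
  SimpleGraph.fromRel fun x y => ∃ u v, G.Adj u v ∧ x = ident u ∧ y = ident v

variable {G ident}

theorem idGraph_adj (hi : Function.Injective ident) {x y : ℕ} :
    (idGraph G ident).Adj x y ↔ ∃ u v, G.Adj u v ∧ x = ident u ∧ y = ident v := by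
  rw [idGraph, SimpleGraph.fromRel_adj]
  constructor
  · rintro ⟨-, h | ⟨u, v, h, hu, hv⟩⟩
    · exact h
    · exact ⟨v, u, h.symm, hv, hu⟩
  · rintro ⟨u, v, h, rfl, rfl⟩
    exact ⟨fun e => h.ne (hi e), Or.inl ⟨u, v, h, rfl, rfl⟩⟩

theorem idGraph_adj_ident (hi : Function.Injective ident) {u v : V} :
    (idGraph G ident).Adj (ident u) (ident v) ↔ G.Adj u v := by
  rw [idGraph_adj hi]
  constructor
  · rintro ⟨u', v', h, hu, hv⟩
    rwa [hi hu, hi hv]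
  · exact fun h => ⟨u, v, h, rfl, rfl⟩

variable [Fintype V]

/-- The edges of `H` that have an end at distance less than `t` from `v`. -/
def edgesNear (H : SimpleGraph ℕ) (t v : ℕ) : Set (ℕ × ℕ) :=
  {e | H.Adj e.1 e.2 ∧ ∃ k < t, Within H k v e.1}

variable {Out : ℕ → SimpleGraph ℕ → ℕ → Finset ℕ} {T : ℕ → ℕ}

theorem gather_stateAfter (hi : Function.Injective ident) {t : ℕ} (ht : t ≤ T (Fintype.card V))
    (v : V) : (gather Out T).stateAfter G ident t v =
      ⟨Fintype.card V, ident v, t, edgesNear (idGraph G ident) t (ident v)⟩ := by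
  induction t generalizing v with
  | zero =>
    have : edgesNear (idGraph G ident) 0 (ident v) = ∅ := by
      ext e; simp [edgesNear]
    rw [this]
    rfl
  | succ t ih =>
    have ih' : (gather Out T).stateAfter G ident t = fun v =>
        ⟨Fintype.card V, ident v, t, edgesNear (idGraph G ident) t (ident v)⟩ :=
      funext fun v => ih (by omega) v
    have hh : ∀ v, (gather Out T).halted
        ⟨Fintype.card V, ident v, t, edgesNear (idGraph G ident) t (ident v)⟩ = false := by
      intro v
      simp only [gather, decide_eq_false_iff_not, not_le]
      omega
    simp only [LocalAlgorithm.stateAfter, ih', hh, Bool.false_eq_true, true_and]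
    refine congrArg (Knowledge.mk _ _ _) ?_
    ext ⟨x, y⟩
    simp only [edgesNear, Set.mem_union, Set.mem_ofPred_eq, Prod.mk.injEq]
    constructor
    · rintro (⟨h, k, hk, hw⟩ | ⟨m, ⟨u, huv, rfl⟩, ⟨h, k, hk, hw⟩ | ⟨rfl, rfl⟩⟩)
      · exact ⟨h, k, by omega, hw⟩
      · exact ⟨h, k + 1, by omega,
          within_succ_iff.mpr (Or.inr ⟨_, (idGraph_adj_ident hi).mpr huv.symm, hw⟩)⟩
      · exact ⟨(idGraph_adj_ident hi).mpr huv.symm, 0, by omega, Within.refl _ _ _⟩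
    · rintro ⟨h, k, hk, hw⟩
      by_cases hkt : k < t
      · exact Or.inl ⟨h, k, hkt, hw⟩
      · right
        obtain rfl | hpos := Nat.eq_zero_or_pos k
        · obtain rfl := within_zero_iff.mp hw
          obtain ⟨u, w, huw, hu, rfl⟩ := (idGraph_adj hi).mp h
          obtain rfl := hi hu
          exact ⟨_, ⟨w, huw.symm, rfl⟩, Or.inr ⟨rfl, rfl⟩⟩
        · obtain ⟨k, rfl⟩ : ∃ j, k = j + 1 := ⟨k - 1, by omega⟩
          rcases within_succ_iff.mp hw with rfl | ⟨z, hz, hzx⟩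
          · obtain ⟨u, w, huw, hu, rfl⟩ := (idGraph_adj hi).mp h
            obtain rfl := hi hu
            exact ⟨_, ⟨w, huw.symm, rfl⟩, Or.inr ⟨rfl, rfl⟩⟩
          · obtain ⟨u, w, huw, hu, rfl⟩ := (idGraph_adj hi).mp hz
            obtain rfl := hi hu
            exact ⟨_, ⟨w, huw.symm, rfl⟩, Or.inl ⟨h, k, by omega, hzx⟩⟩

theorem gather_stateAfter_of_le (hi : Function.Injective ident) {t : ℕ}
    (ht : T (Fintype.card V) ≤ t) (v : V) : (gather Out T).stateAfter G ident t v =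
      (gather Out T).stateAfter G ident (T (Fintype.card V)) v := by
  induction t, ht using Nat.le_induction with
  | base => rfl
  | succ t ht ih =>
    have hh : (gather Out T).halted
        ((gather Out T).stateAfter G ident (T (Fintype.card V)) v) = true := by
      rw [gather_stateAfter hi le_rfl]
      simp [gather]
    simp only [LocalAlgorithm.stateAfter, ih, hh, if_true]

/-- After `t + 1` rounds a node knows all edges that have an end at distance at most `t`, so its
knowledge looks like the network up to distance `t`. -/
theorem graph_edgesNear_agree (H : SimpleGraph ℕ) (n i t v : ℕ) :
    GAgree H (Knowledge.graph ⟨n, i, t + 1, edgesNear H (t + 1) v⟩) v t := by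
  intro x hx
  refine ⟨?_, Iff.rfl⟩
  ext y
  simp only [Knowledge.graph, SimpleGraph.fromRel_adj, edgesNear, Set.mem_ofPred_eq]
  constructor
  · exact fun h => ⟨h.ne, Or.inl ⟨h, t, by omega, hx⟩⟩
  · rintro ⟨-, h | h⟩
    · exact h.1
    · exact h.1.symm

/-- All outputs are the ones prescribed on the whole network, because they are determined when the
node commits. -/
theorem gather_output_eq (hi : Function.Injective ident) {t : ℕ} {v : V} {S : Finset ℕ}
    (h : (gather Out T).output ((gather Out T).stateAfter G ident t v) = some S) :
    S = Out (Fintype.card V) (idGraph G ident) (ident v) := by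
  have key : ∀ t ≤ T (Fintype.card V),
      (gather Out T).output ((gather Out T).stateAfter G ident t v) = some S →
      S = Out (Fintype.card V) (idGraph G ident) (ident v) := by
    intro t ht h
    rw [gather_stateAfter hi ht] at h
    simp only [gather] at h
    split_ifs at h with hc
    obtain ⟨hpos, hdet⟩ := hc
    obtain ⟨t, rfl⟩ : ∃ j, t = j + 1 := ⟨t - 1, by omega⟩
    rw [hdet _ (Agree.symm (graph_edgesNear_agree _ _ _ _ _))]
    exact (Option.some.inj h).symm
  rcases le_total t (T (Fintype.card V)) with ht | ht
  · exact key t ht h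
  · rw [gather_stateAfter_of_le hi ht] at h
    exact key _ le_rfl h

/-- A node whose output is determined up to distance `r` has committed after `r + 1` rounds. -/
theorem gather_output_isSome (hi : Function.Injective ident) {r : ℕ} {v : V}
    (hr : r + 1 ≤ T (Fintype.card V))
    (h : Determined (Out (Fintype.card V)) (idGraph G ident) (ident v) r) :
    ((gather Out T).output ((gather Out T).stateAfter G ident (r + 1) v)).isSome = true := by
  rw [gather_stateAfter hi hr]
  simp only [gather]
  have hag := graph_edgesNear_agree (idGraph G ident) (Fintype.card V) (ident v) r (ident v)
  rw [if_pos]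
  · rfl
  · refine ⟨by omega, fun H hH => ?_⟩
    simp only [Nat.add_sub_cancel] at hH
    rw [h _ hag]
    refine h H fun x hx => ?_
    have h1 := hag x hx
    have h2 := hH x (hag.within (by omega) hx)
    exact ⟨h1.1.trans h2.1, h1.2.trans h2.2⟩

theorem gather_computationTime_le (hi : Function.Injective ident) {r : ℕ} {v : V}
    (hr : r + 1 ≤ T (Fintype.card V))
    (h : Determined (Out (Fintype.card V)) (idGraph G ident) (ident v) r) :
    (gather Out T).computationTime G ident v ≤ r + 1 :=
  Nat.sInf_le ⟨r + 1, le_rfl, gather_output_isSome hi hr h⟩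

theorem gather_result (hi : Function.Injective ident) {r : ℕ} {v : V}
    (hr : r + 1 ≤ T (Fintype.card V))
    (h : Determined (Out (Fintype.card V)) (idGraph G ident) (ident v) r) :
    (gather Out T).result G ident v = some (Out (Fintype.card V) (idGraph G ident) (ident v)) := by
  have hne : {t | (gather Out T).CommittedBy G ident t v}.Nonempty :=
    ⟨r + 1, r + 1, le_rfl, gather_output_isSome hi hr h⟩
  obtain ⟨s, hs, hsome⟩ := Nat.sInf_mem hne
  have hle : (gather Out T).computationTime G ident v ≤ s := Nat.sInf_le ⟨s, le_rfl, hsome⟩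
  obtain rfl : s = (gather Out T).computationTime G ident v := le_antisymm hs hle
  obtain ⟨S, hS⟩ := Option.isSome_iff_exists.mp hsome
  rw [LocalAlgorithm.result, hS, gather_output_eq hi hS]

theorem gather_terminatedBy (hi : Function.Injective ident) {r : ℕ} {v : V}
    (hr : r + 1 ≤ T (Fintype.card V))
    (h : Determined (Out (Fintype.card V)) (idGraph G ident) (ident v) r) :
    (gather Out T).TerminatedBy G ident (T (Fintype.card V)) v := by
  refine ⟨⟨r + 1, hr, gather_output_isSome hi hr h⟩, ?_⟩
  rw [gather_stateAfter hi le_rfl]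
  simp [gather]

theorem gather_worstCase_le (hi : Function.Injective ident)
    (h : ∀ v, ∃ r, r + 1 ≤ T (Fintype.card V) ∧
      Determined (Out (Fintype.card V)) (idGraph G ident) (ident v) r) :
    (gather Out T).worstCase G ident ≤ T (Fintype.card V) := by
  refine Finset.sup_le fun v _ => Nat.sInf_le ?_
  obtain ⟨r, hr, hd⟩ := h v
  exact gather_terminatedBy hi hr hd

end Gather

/-! ### Color reduction and ruling sets -/

open Polynomial in
/-- One step of Linial's color reduction: colors are read as polynomials of low degree over a
finite field, and a node picks a point of the field at which its polynomial differs from those of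
its neighbors, and keeps this point and the value there. -/
theorem exists_recoloring (Δ m : ℕ) : ∃ L : ℕ → Set ℕ → ℕ,
    (∀ c S, L c S < (2 * ((Δ + 1) * (Nat.log 2 m + 1))) ^ 2) ∧
    ∀ c c' S S', c < m → c' < m → c ≠ c' → c' ∈ S → S.encard ≤ (Δ : ℕ∞) → L c S ≠ L c' S' := by
  classical
  set d := Nat.log 2 m + 1 with hd
  obtain ⟨p, hp, hlt, hle⟩ := Nat.exists_prime_lt_and_le_two_mul ((Δ + 1) * d) (by positivity)
  have : Fact p.Prime := ⟨hp⟩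
  have hmd : m ≤ p ^ d :=
    (Nat.lt_pow_succ_log_self (by norm_num) m).le.trans (Nat.pow_le_pow_left hp.two_le _)
  have hcard : Fintype.card (Fin m) ≤ Fintype.card (Fin d → ZMod p) := by
    simpa [ZMod.card] using hmd
  obtain ⟨e⟩ := Function.Embedding.nonempty_of_card_le hcard
  -- the polynomial that encodes a color
  let f : ℕ → (ZMod p)[X] := fun c =>
    if h : c < m then ((degreeLTEquiv (ZMod p) d).symm (e ⟨c, h⟩) : (ZMod p)[X]) else 0
  have hdeg : ∀ c, (f c).degree < d := by
    intro c
    by_cases h : c < m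
    · simp only [f, dif_pos h]
      exact mem_degreeLT.mp (Subtype.coe_prop _)
    · simp only [f, dif_neg h, degree_zero]
      exact WithBot.bot_lt_coe _
  have hinj : ∀ c c', c < m → c' < m → f c = f c' → c = c' := by
    intro c c' h h' heq
    simp only [f, dif_pos h, dif_pos h'] at heq
    have := e.injective ((degreeLTEquiv (ZMod p) d).symm.injective (Subtype.ext heq))
    simpa using this
  -- two of the polynomials agree at fewer than `d` points, and the field has more than `Δ * d`
  -- points
  have hgood : ∀ (c : ℕ) (S : Set ℕ), c < m → S.encard ≤ (Δ : ℕ∞) →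
      ∃ x : ZMod p, ∀ c' ∈ S, c' < m → c' ≠ c → (f c).eval x ≠ (f c').eval x := by
    intro c S hc hS
    have hfin : S.Finite := Set.finite_of_encard_le_coe hS
    have hScard : hfin.toFinset.card ≤ Δ := by
      rw [hfin.encard_eq_coe_toFinset_card] at hS
      exact_mod_cast hS
    set B : Finset (ZMod p) := (hfin.toFinset.filter fun c' => c' < m ∧ c' ≠ c).biUnion
      fun c' => (f c - f c').roots.toFinset with hB
    have hBcard : B.card < Fintype.card (ZMod p) := by
      rw [ZMod.card]
      refine lt_of_le_of_lt ?_ hlt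
      refine (Finset.card_biUnion_le_card_mul _ _ d ?_).trans ?_
      · intro c' _
        refine (Multiset.toFinset_card_le _).trans ((card_roots' _).trans ?_)
        by_cases h0 : f c - f c' = 0
        · rw [h0]; simp
        · have := (natDegree_lt_iff_degree_lt h0).mpr
            ((degree_sub_le _ _).trans_lt (max_lt (hdeg c) (hdeg c')))
          exact this.le
      · refine Nat.mul_le_mul_right _ ((Finset.card_filter_le _ _).trans ?_)
        omega
    obtain ⟨x, hx⟩ : ∃ x, x ∉ B := by
      by_contra hall
      push Not at hall
      have : B = Finset.univ := Finset.eq_univ_iff_forall.mpr hall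
      rw [this, Finset.card_univ] at hBcard
      exact lt_irrefl _ hBcard
    refine ⟨x, fun c' hc' hm' hne heq => hx ?_⟩
    rw [hB, Finset.mem_biUnion]
    refine ⟨c', by simp [hc', hm', hne], ?_⟩
    rw [Multiset.mem_toFinset, mem_roots (sub_ne_zero.mpr fun h => hne (hinj _ _ hc hm' h).symm)]
    simp [IsRoot, heq]
  -- the point that separates a color from the colors in a set
  let pt : ℕ → Set ℕ → ZMod p := fun c S =>
    if h : ∃ x : ZMod p, ∀ c' ∈ S, c' < m → c' ≠ c → (f c).eval x ≠ (f c').eval x then h.choose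
    else 0
  refine ⟨fun c S => (pt c S).val * p + ((f c).eval (pt c S)).val, ?_, ?_⟩
  · intro c S
    have h1 := ZMod.val_lt (pt c S)
    have h2 := ZMod.val_lt ((f c).eval (pt c S))
    have h3 : p ^ 2 ≤ (2 * ((Δ + 1) * d)) ^ 2 := Nat.pow_le_pow_left hle 2
    nlinarith
  · intro c c' S S' hc hc' hne hS hcard heq
    simp only at heq
    have hpos := hp.pos
    have hdm : ∀ a b : ZMod p,
        (a.val * p + b.val) / p = a.val ∧ (a.val * p + b.val) % p = b.val := by
      intro a b
      have hb := ZMod.val_lt b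
      constructor
      · rw [mul_comm, Nat.mul_add_div hpos, Nat.div_eq_of_lt hb, add_zero]
      · rw [Nat.mul_add_mod', Nat.mod_eq_of_lt hb]
    have hx : pt c S = pt c' S' := by
      apply ZMod.val_injective
      rw [← (hdm (pt c S) ((f c).eval (pt c S))).1, heq, (hdm _ _).1]
    have hy : (f c).eval (pt c S) = (f c').eval (pt c S) := by
      apply ZMod.val_injective
      rw [← (hdm (pt c S) ((f c).eval (pt c S))).2, heq, (hdm _ _).2, hx]
    have hex := hgood c S hc hcard
    have hpt : pt c S = hex.choose := dif_pos hex
    refine hex.choose_spec c' hS hc' hne.symm ?_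
    rw [← hpt]
    exact hy

/-- The recoloring function of a step of Linial's color reduction. -/
noncomputable def recolor (Δ m : ℕ) : ℕ → Set ℕ → ℕ :=
  (exists_recoloring Δ m).choose

/-- The number of colors after `k` steps of color reduction with degree bound `Δ`, starting from
identifiers below `n ^ c`. -/
def palette (Δ n c : ℕ) : ℕ → ℕ
  | 0 => n ^ c
  | k + 1 => (2 * ((Δ + 1) * (Nat.log 2 (palette Δ n c k) + 1))) ^ 2

/-- The colors after `k` steps of color reduction in the graph in which nodes of distance at most
`ρ` are adjacent. -/
noncomputable def coloring (ρ n c : ℕ) (I : Inst) : ℕ → ℕ → ℕ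
  | 0 => fun v => v
  | k + 1 => fun v => recolor (4 ^ ρ) (palette (4 ^ ρ) n c k) (coloring ρ n c I k v)
      {y | ∃ x, Within I.gr ρ v x ∧ (x ≠ v ∧ coloring ρ n c I k x = y)}

theorem coloring_loc (ρ n c k : ℕ) : Loc (ρ * k) (fun I v => coloring ρ n c I k v) := by
  induction k with
  | zero => exact Loc.const _
  | succ k ih =>
    have h1 := ih.image ρ (fun v x a (y : ℕ) => x ≠ v ∧ a = y)
    have h2 := ((ih.mono (Nat.le_add_right _ ρ)).prod h1).map
      fun _ q => recolor (4 ^ ρ) (palette (4 ^ ρ) n c k) q.1 q.2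
    exact h2

theorem coloring_lt {ρ n c : ℕ} {I : Inst} {k v : ℕ} (hv : v < n ^ c ∨ 0 < k) :
    coloring ρ n c I k v < palette (4 ^ ρ) n c k := by
  cases k with
  | zero => exact hv.resolve_right (lt_irrefl 0)
  | succ k => exact (exists_recoloring _ _).choose_spec.1 _ _

theorem coloring_ne {ρ n c : ℕ} {I : Inst} (hdeg : ∀ v, (I.gr.neighborSet v).encard ≤ 3)
    {k u v : ℕ} (hu : u < n ^ c) (hv : v < n ^ c) (hne : u ≠ v) (h : Within I.gr ρ u v) :
    coloring ρ n c I k u ≠ coloring ρ n c I k v := by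
  induction k with
  | zero => exact hne
  | succ k ih =>
    refine (exists_recoloring _ _).choose_spec.2 _ _ _ _ (coloring_lt (Or.inl hu))
      (coloring_lt (Or.inl hv)) ih ⟨v, h, hne.symm, rfl⟩ ?_
    have hsub : {y | ∃ x, Within I.gr ρ u x ∧ (x ≠ u ∧ coloring ρ n c I k x = y)} ⊆
        (fun x => coloring ρ n c I k x) '' {x | Within I.gr ρ u x} := by
      rintro y ⟨x, hx, -, rfl⟩
      exact ⟨x, hx, rfl⟩
    refine (Set.encard_le_encard hsub).trans ((Set.encard_image_le _ _).trans ?_)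
    simpa using encard_within_le hdeg ρ u

/-- The nodes that are chosen when the colors below `j` are processed one after the other, and a
node is chosen unless a node at distance at most `ρ` has been chosen before. -/
noncomputable def greedy (ρ n c K : ℕ) (I : Inst) : ℕ → Set ℕ
  | 0 => ∅
  | j + 1 => {v | v ∈ greedy ρ n c K I j ∨
      (coloring ρ n c I K v = j ∧ ¬ ∃ x, Within I.gr ρ v x ∧ x ∈ greedy ρ n c K I j)}

theorem greedy_loc (ρ n c K j : ℕ) :
    Loc (ρ * K + ρ * j) (fun I v => v ∈ greedy ρ n c K I j) := by
  induction j with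
  | zero => exact Loc.const fun _ => False
  | succ j ih =>
    have h1 := ih.exists ρ (fun _ _ _ b => b)
    have h2 := (((coloring_loc ρ n c K).mono (show _ ≤ ρ * K + ρ * j + ρ by omega)).prod
      ((ih.mono (Nat.le_add_right _ ρ)).prod h1)).map fun _ q => q.2.1 ∨ q.1 = j ∧ ¬ q.2.2
    exact h2.mono (by rw [Nat.mul_succ]; omega)

theorem greedy_mono {ρ n c K : ℕ} {I : Inst} {i j : ℕ} (h : i ≤ j) :
    greedy ρ n c K I i ⊆ greedy ρ n c K I j := by
  induction j, h using Nat.le_induction with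
  | base => exact subset_rfl
  | succ j _ ih => exact fun v hv => Or.inl (ih hv)

/-- Distinct nodes of the greedy set are more than `ρ` apart. -/
theorem greedy_separated {ρ n c K : ℕ} {I : Inst} (hdeg : ∀ v, (I.gr.neighborSet v).encard ≤ 3)
    (hid : ∀ x y, I.gr.Adj x y → x < n ^ c) {j u v : ℕ} (hu : u ∈ greedy ρ n c K I j)
    (hv : v ∈ greedy ρ n c K I j) (h : Within I.gr ρ u v) : u = v := by
  by_contra hne
  have hlt : ∀ {x y}, Within I.gr ρ x y → x ≠ y → x < n ^ c := fun hw hxy => by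
    obtain ⟨z, hz⟩ := hw.exists_adj hxy
    exact hid _ _ hz
  have hcol := coloring_ne (k := K) hdeg (hlt h hne) (hlt h.symm (Ne.symm hne)) hne h
  induction j with
  | zero => exact absurd hu (Set.notMem_empty u)
  | succ j ih =>
    rcases hu with hu | ⟨hu, hu'⟩ <;> rcases hv with hv | ⟨hv, hv'⟩
    · exact ih hu hv
    · exact hv' ⟨u, h.symm, hu⟩
    · exact hu' ⟨v, h, hv⟩
    · exact hcol (hu.trans hv.symm)

/-- Every node has a node of the greedy set at distance at most `ρ`. -/
theorem exists_mem_greedy {ρ n c K : ℕ} {I : Inst} {j v : ℕ} (h : coloring ρ n c I K v < j) :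
    ∃ x, Within I.gr ρ v x ∧ x ∈ greedy ρ n c K I j := by
  by_cases hex : ∃ x, Within I.gr ρ v x ∧ x ∈ greedy ρ n c K I (coloring ρ n c I K v)
  · obtain ⟨x, hx, hm⟩ := hex
    exact ⟨x, hx, greedy_mono h.le hm⟩
  · exact ⟨v, Within.refl _ _ _, greedy_mono (Nat.succ_le_of_lt h) (Or.inr ⟨rfl, hex⟩)⟩

/-! ### Stages and reorientation of forests -/

/-- A stage of the construction orients some edges and passes on the remaining ones: `next I` is the
instance formed by the remaining edges and by the nodes that still need an outgoing edge, and `dir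
I` gives the orientation of the other edges. -/
structure Stage where
  /-- the remaining instance -/
  next : Inst → Inst
  /-- the orientation of the edges that do not belong to the remaining instance -/
  dir : Inst → ℕ → ℕ → Prop

/-- The stage is correct on `I`: each sinkless orientation of `S.next I` is extended by `S.dir I` to
a sinkless orientation of `I`. -/
structure Stage.Correct (S : Stage) (I : Inst) : Prop where
  le : (S.next I).gr ≤ I.gr
  dir_iff : ∀ v w, I.gr.Adj v w → ¬ (S.next I).gr.Adj v w → (S.dir I v w ↔ ¬ S.dir I w v)
  out : ∀ v ∈ I.needy, v ∈ (S.next I).needy ∨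
    ∃ w, I.gr.Adj v w ∧ ¬ (S.next I).gr.Adj v w ∧ S.dir I v w

/-- The stage can be carried out by every node after looking up to distance `r`. -/
structure Stage.IsLocal (S : Stage) (r : ℕ) : Prop where
  le : ∀ I, (S.next I).gr ≤ I.gr
  adj : Loc r fun I v => (S.next I).gr.Adj v
  needy : Loc r fun I v => v ∈ (S.next I).needy
  dir : Loc r fun I v => {w | I.gr.Adj v w ∧ S.dir I v w}

/-- Instructions for a stage. The pointers `par` form a forest, along which nodes orient their edges
to their parents, except on the paths from the nodes in `term` to the roots, which are reversed.
A node in `term` uses the edge to `esc` instead. The edges inside `kept` are not oriented. -/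
structure Plan where
  /-- the parent of a node in the forest; a root is its own parent -/
  par : ℕ → ℕ
  /-- the ends of the reversed paths -/
  term : Set ℕ
  /-- the escape of a node in `term` -/
  esc : ℕ → ℕ
  /-- the nodes whose common edges are left for later stages -/
  kept : Set ℕ

section Plan

variable (P : Plan) (I : Inst) (J : ℕ)

/-- `v` lies on a path of length at most `J` from a node in `term` towards its root. -/
def Plan.OnPath (v : ℕ) : Prop :=
  ∃ x, Within I.gr J v x ∧ (x ∈ P.term ∧ v ∈ {y | ∃ j ≤ J, P.par^[j] x = y})

open Classical in
/-- The out-neighbor that is assigned to `v`, if any. -/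
noncomputable def Plan.out (v : ℕ) : Option ℕ :=
  if v ∈ P.kept then none
  else if v ∈ P.term then (if v ∈ I.needy then some (P.esc v) else none)
  else if P.OnPath I J v then
    some (sInf {c | Within I.gr 1 v c ∧ (I.gr.Adj v c ∧ P.par c = v ∧ P.OnPath I J c)})
  else if P.par v = v then none
  else some (P.par v)

/-- The orientation of the edges that are not inside `kept`: edges that no end has been assigned are
directed out of `kept` if possible. -/
def Plan.Dir (v w : ℕ) : Prop :=
  P.out I J v = some w ∨ (P.out I J w ≠ some v ∧
    ((v ∈ P.kept ∧ w ∉ P.kept) ∨ (¬ (w ∈ P.kept ∧ v ∉ P.kept) ∧ v < w)))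

/-- The instance that remains: the edges inside `kept`, and the nodes in `kept` that have no edge
directed out of `kept`. -/
def Plan.next : Inst where
  gr :=
    { Adj := fun v w => I.gr.Adj v w ∧ v ∈ P.kept ∧ w ∈ P.kept
      symm := ⟨fun _ _ h => ⟨h.1.symm, h.2.2, h.2.1⟩⟩
      loopless := ⟨fun v h => I.gr.loopless.irrefl v h.1⟩ }
  needy := {v | v ∈ P.kept ∧
    ∀ w, Within I.gr 1 v w → I.gr.Adj v w → w ∉ P.kept → P.out I J w = some v}

/-- The plan can be carried out: the pointers form a forest, the escapes are edges outside the
forest, no two nodes in `term` escape over the same edge, and no root is left without an outgoing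
edge. -/
structure Plan.Valid : Prop where
  par : ∀ v, P.par v = v ∨ I.gr.Adj v (P.par v)
  rank : ∃ rk : ℕ → ℕ, ∀ v, P.par v ≠ v → rk (P.par v) < rk v
  esc : ∀ x ∈ P.term, x ∉ P.kept → x ∈ I.needy →
    I.gr.Adj x (P.esc x) ∧ P.par (P.esc x) ≠ x ∧ P.par x ≠ P.esc x
  conflict : ∀ x ∈ P.term, x ∉ P.kept → x ∈ I.needy → P.esc x ∈ P.term → P.esc x ∉ P.kept →
    P.esc x ∈ I.needy → P.esc (P.esc x) ≠ x
  root : ∀ v ∈ I.needy, v ∉ P.kept → P.par v = v → P.OnPath I J v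

variable {P I J}

theorem within_iterate {U : SimpleGraph ℕ} {p : ℕ → ℕ} (h : ∀ v, p v = v ∨ U.Adj v (p v))
    (j v : ℕ) : Within U j v (p^[j] v) := by
  induction j generalizing v with
  | zero => exact Within.refl _ _ _
  | succ j ih =>
    rw [Function.iterate_succ_apply]
    rcases h v with h' | h'
    · rw [h']; exact (ih v).mono (Nat.le_succ j)
    · exact within_succ_iff.mpr (Or.inr ⟨_, h', ih _⟩)

theorem Plan.Valid.onPath_of {P : Plan} {I : Inst} {J : ℕ}
    (hp : ∀ v, P.par v = v ∨ I.gr.Adj v (P.par v)) {x j : ℕ}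
    (hx : x ∈ P.term) (hj : j ≤ J) : P.OnPath I J (P.par^[j] x) :=
  ⟨x, (within_iterate hp j x).symm.mono hj, hx, j, hj, rfl⟩

/-- A node on a reversed path, other than its end, has a child on a reversed path. -/
theorem Plan.Valid.exists_child (h : P.Valid I J) {v : ℕ} (hv : P.OnPath I J v)
    (ht : v ∉ P.term) : ∃ c, Within I.gr 1 v c ∧ (I.gr.Adj v c ∧ P.par c = v ∧ P.OnPath I J c) := by
  classical
  obtain ⟨x, -, hx, hex⟩ := hv
  obtain ⟨hj, hjv⟩ := Nat.find_spec hex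
  have hmin : ∀ i < Nat.find hex, ¬ (i ≤ J ∧ P.par^[i] x = v) := fun i hi => Nat.find_min hex hi
  generalize Nat.find hex = j at hj hjv hmin
  cases j with
  | zero => exact absurd (by rw [← hjv]; exact hx) ht
  | succ j =>
    rw [Function.iterate_succ_apply'] at hjv
    have hne : P.par^[j] x ≠ v := fun e => hmin j (Nat.lt_succ_self j) ⟨by omega, e⟩
    have hadj : I.gr.Adj v (P.par^[j] x) := by
      rcases h.par (P.par^[j] x) with e | e
      · exact absurd (e.symm.trans hjv) hne
      · rw [hjv] at e; exact e.symm
    exact ⟨_, Within.of_adj hadj, hadj, hjv, onPath_of h.par hx (by omega)⟩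

theorem Plan.Valid.out_cases (h : P.Valid I J) {v w : ℕ} (ho : P.out I J v = some w) :
    v ∉ P.kept ∧ ((v ∈ P.term ∧ v ∈ I.needy ∧ w = P.esc v) ∨
      (v ∉ P.term ∧ P.OnPath I J v ∧ I.gr.Adj v w ∧ P.par w = v ∧ P.OnPath I J w) ∨
      (v ∉ P.term ∧ ¬ P.OnPath I J v ∧ P.par v ≠ v ∧ w = P.par v)) := by
  rw [Plan.out] at ho
  split_ifs at ho with hk ht hn hp hr
  · exact ⟨hk, Or.inl ⟨ht, hn, (Option.some.inj ho).symm⟩⟩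
  · have := Nat.sInf_mem (s := {c | Within I.gr 1 v c ∧ (I.gr.Adj v c ∧ P.par c = v ∧
      P.OnPath I J c)}) (h.exists_child hp ht)
    rw [Option.some.inj ho] at this
    exact ⟨hk, Or.inr (Or.inl ⟨ht, hp, this.2⟩)⟩
  · exact ⟨hk, Or.inr (Or.inr ⟨ht, hp, hr, (Option.some.inj ho).symm⟩)⟩

theorem Plan.Valid.adj_of_out (h : P.Valid I J) {v w : ℕ} (ho : P.out I J v = some w) :
    I.gr.Adj v w := by
  obtain ⟨hk, ⟨ht, hn, rfl⟩ | ⟨-, -, ha, -⟩ | ⟨-, -, hr, rfl⟩⟩ := h.out_cases ho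
  · exact (h.esc v ht hk hn).1
  · exact ha
  · exact (h.par v).resolve_left hr

theorem Plan.Valid.exists_out (h : P.Valid I J) {v : ℕ} (hn : v ∈ I.needy) (hk : v ∉ P.kept) :
    ∃ w, P.out I J v = some w := by
  rw [Plan.out, if_neg hk]
  split_ifs with ht hp hr
  · exact ⟨_, rfl⟩
  · exact ⟨_, rfl⟩
  · exact absurd (h.root v hn hk hr) hp
  · exact ⟨_, rfl⟩

/-- No edge is assigned to both of its ends. -/
theorem Plan.Valid.out_asymm (h : P.Valid I J) {v w : ℕ} (hv : P.out I J v = some w)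
    (hw : P.out I J w = some v) : False := by
  obtain ⟨rk, hrk⟩ := h.rank
  have hne : v ≠ w := (h.adj_of_out hv).ne
  have h2 : P.par v = w → P.par w = v → False := by
    intro e1 e2
    have a := hrk v (by rw [e1]; exact hne.symm)
    have b := hrk w (by rw [e2]; exact hne)
    rw [e1] at a; rw [e2] at b
    omega
  obtain ⟨hvk, cv⟩ := h.out_cases hv
  obtain ⟨hwk, cw⟩ := h.out_cases hw
  rcases cv with ⟨vt, vn, ev⟩ | ⟨vt, vp, -, ev, wp'⟩ | ⟨vt, vp, -, ev⟩ <;>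
  rcases cw with ⟨wt, wn, ew⟩ | ⟨wt, wp, -, ew, vp'⟩ | ⟨wt, wp, -, ew⟩
  · exact h.conflict v vt hvk vn (ev ▸ wt) (ev ▸ hwk) (ev ▸ wn) (by rw [← ev]; exact ew.symm)
  · exact (h.esc v vt hvk vn).2.2 (ew.trans ev)
  · exact (h.esc v vt hvk vn).2.1 (by rw [← ev]; exact ew.symm)
  · exact (h.esc w wt hwk wn).2.2 (ev.trans ew)
  · exact h2 ew ev
  · exact wp wp'
  · exact (h.esc w wt hwk wn).2.1 (by rw [← ew]; exact ev.symm)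
  · exact vp vp'
  · exact h2 ev.symm ew.symm

/-- The stage that carries out a plan depending on the instance. -/
noncomputable def Plan.stage (P : Inst → Plan) (J : ℕ) : Stage where
  next I := (P I).next I J
  dir I := (P I).Dir I J

theorem Plan.Valid.correct {P : Inst → Plan} {I : Inst} {J : ℕ} (h : (P I).Valid I J) :
    (Plan.stage P J).Correct I where
  le := fun _ _ h => h.1
  dir_iff := by
    intro v w hvw hnot
    have hk : ¬ (v ∈ (P I).kept ∧ w ∈ (P I).kept) := fun hk => hnot ⟨hvw, hk⟩
    have ha := h.out_asymm (v := v) (w := w)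
    have hne := hvw.ne
    simp only [Plan.stage, Plan.Dir]
    -- what remains after the case distinction is the comparison of the identifiers of `v` and `w`
    by_cases hv : (P I).out I J v = some w <;> by_cases hw : (P I).out I J w = some v <;>
      by_cases kv : v ∈ (P I).kept <;> by_cases kw : w ∈ (P I).kept <;>
      simp_all
    omega
  out := by
    intro v hv
    by_cases hk : v ∈ (P I).kept
    · by_cases hall : ∀ w, Within I.gr 1 v w → I.gr.Adj v w → w ∉ (P I).kept →
          (P I).out I J w = some v
      · exact Or.inl ⟨hk, hall⟩
      · push Not at hall
        obtain ⟨w, -, hvw, hw, ho⟩ := hall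
        exact Or.inr ⟨w, hvw, fun h => hw h.2.2, Or.inr ⟨ho, Or.inl ⟨hk, hw⟩⟩⟩
    · obtain ⟨w, hw⟩ := h.exists_out hv hk
      exact Or.inr ⟨w, h.adj_of_out hw, fun h => hk h.2.1, Or.inl hw⟩

theorem Loc.orbit {p : Inst → ℕ → ℕ} {r : ℕ} (h : Loc r p) (hw : ∀ I v, Within I.gr 1 v (p I v))
    (J : ℕ) : Loc (r + J) (fun I v => {y | ∃ j ≤ J, (p I)^[j] v = y}) := by
  intro I K v hv
  ext y
  simp only [Set.mem_ofPred_eq]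
  refine exists_congr fun j => and_congr_right fun hj => ?_
  have e : (p I)^[j] v = (p K)^[j] v :=
    (h.iterate hw j).mono (show r + j ≤ r + J by omega) I K v hv
  rw [e]

theorem Plan.onPath_loc {P : Inst → Plan} {r J : ℕ} (hpar : Loc r fun I v => (P I).par v)
    (hw : ∀ I v, Within I.gr 1 v ((P I).par v)) (hterm : Loc r fun I v => v ∈ (P I).term) :
    Loc (r + 2 * J) fun I v => (P I).OnPath I J v := by
  have h := (((hterm.mono (show r ≤ r + J by omega)).prod (hpar.orbit hw J)).exists J
    fun v _ _ q => q.1 ∧ v ∈ q.2)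
  exact h.mono (by omega)

/-- The radius: whether a node lies on a reversed path is seen after looking up to distance `J` for
the end of the path, and `J` further along the pointers from there. -/
theorem Plan.out_loc {P : Inst → Plan} {r J : ℕ} (hpar : Loc r fun I v => (P I).par v)
    (hw : ∀ I v, Within I.gr 1 v ((P I).par v)) (hterm : Loc r fun I v => v ∈ (P I).term)
    (hesc : Loc r fun I v => (P I).esc v) (hkept : Loc r fun I v => v ∈ (P I).kept) :
    Loc (r + 2 * J + 1) fun I v => (P I).out I J v := by
  classical
  have hp := Plan.onPath_loc (J := J) hpar hw hterm
  have ha : Loc (r + 2 * J) fun I v => I.gr.Adj v := Loc.adj.mono (by omega)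
  have hset := (ha.prod ((hpar.mono (show r ≤ r + 2 * J by omega)).prod hp)).setOf 1
    fun v c q q' => q.1 c ∧ q'.2.1 = v ∧ q'.2.2
  have hn : Loc (r + 2 * J + 1) fun I v => v ∈ I.needy := Loc.needy.mono (by omega)
  have m : r ≤ r + 2 * J + 1 := by omega
  have h := ((hkept.mono m).prod ((hterm.mono m).prod (hn.prod ((hesc.mono m).prod
    ((hp.mono (Nat.le_succ _)).prod (hset.prod (hpar.mono m))))))).map fun v q =>
      if q.1 then (none : Option ℕ) else if q.2.1 then (if q.2.2.1 then some q.2.2.2.1 else none)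
      else if q.2.2.2.2.1 then some (sInf q.2.2.2.2.2.1)
      else if q.2.2.2.2.2.2 = v then none else some q.2.2.2.2.2.2
  intro I K v hv
  have := h I K v hv
  simp only [Plan.out]
  convert this using 1

theorem Plan.stage_isLocal {P : Inst → Plan} {r J : ℕ} (hpar : Loc r fun I v => (P I).par v)
    (hw : ∀ I v, Within I.gr 1 v ((P I).par v)) (hterm : Loc r fun I v => v ∈ (P I).term)
    (hesc : Loc r fun I v => (P I).esc v) (hkept : Loc r fun I v => v ∈ (P I).kept) :
    (Plan.stage P J).IsLocal (r + 2 * J + 2) := by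
  have ho := Plan.out_loc (J := J) hpar hw hterm hesc hkept
  have m : r ≤ r + 2 * J + 1 := by omega
  have hk := hkept.mono m
  have ha : Loc (r + 2 * J + 1) fun I v => I.gr.Adj v := Loc.adj.mono (by omega)
  have hq := ha.prod (hk.prod ho)
  refine ⟨fun _ _ _ h => h.1, ?_, ?_, ?_⟩
  · have h := hq.setOf 1 fun _ w q q' => q.1 w ∧ q.2.1 ∧ q'.2.1
    intro I K v hv
    have := Set.ext_iff.mp (h I K v hv)
    ext w
    have hw := this w
    simp only [Set.mem_ofPred_eq] at hw
    constructor
    · intro hvw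
      exact (hw.mp ⟨Within.of_adj hvw.1, hvw⟩).2
    · intro hvw
      exact (hw.mpr ⟨Within.of_adj hvw.1, hvw⟩).2
  · have h' := (hq.setOf 1 fun v w q q' => ¬ (q.1 w → ¬ q'.2.1 → q'.2.2 = some v))
    have h2 := ((hk.mono (Nat.le_succ _)).prod h').map fun v q => q.1 ∧ q.2 = ∅
    intro I K v hv
    have := h2 I K v hv
    simp only [Set.eq_empty_iff_forall_notMem, Set.mem_ofPred_eq, not_and, not_not] at this
    exact this
  · have h := hq.setOf 1 fun v w q q' => q.1 w ∧ (q.2.2 = some w ∨ (q'.2.2 ≠ some v ∧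
      ((q.2.1 ∧ ¬ q'.2.1) ∨ (¬ (q'.2.1 ∧ ¬ q.2.1) ∧ v < w))))
    intro I K v hv
    have := Set.ext_iff.mp (h I K v hv)
    ext w
    have hw := this w
    simp only [Set.mem_ofPred_eq] at hw
    constructor
    · intro hvw
      exact (hw.mp ⟨Within.of_adj hvw.1, hvw⟩).2
    · intro hvw
      exact (hw.mpr ⟨Within.of_adj hvw.1, hvw⟩).2

end Plan

/-! ### Growth of trees with few nodes of degree two -/

section Growth

open Classical in
/-- The children of `w` in the forest given by the parent pointers `p`. -/
noncomputable def children (U : SimpleGraph ℕ) (p : ℕ → ℕ) (w : ℕ) : Finset ℕ :=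
  if h : (U.neighborSet w).Finite then h.toFinset.filter fun c => p c = w else ∅

/-- The nodes at depth `r` in the tree below `a`. -/
noncomputable def layer (U : SimpleGraph ℕ) (p : ℕ → ℕ) (a : ℕ) : ℕ → Finset ℕ
  | 0 => {a}
  | r + 1 => (layer U p a r).biUnion (children U p)

open Classical in
/-- The number of nodes in `B` among the first `r` proper ancestors of `w`. -/
noncomputable def countAbove (p : ℕ → ℕ) (B : Set ℕ) (r w : ℕ) : ℕ :=
  ∑ k ∈ Finset.range r, if p^[k + 1] w ∈ B then 1 else 0

variable {U : SimpleGraph ℕ} {p : ℕ → ℕ} {a r k w c : ℕ} {B : Set ℕ}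

theorem mem_children (h : (U.neighborSet w).Finite) :
    c ∈ children U p w ↔ U.Adj w c ∧ p c = w := by
  simp [children, h]

theorem par_of_mem_children (h : c ∈ children U p w) : U.Adj w c ∧ p c = w := by
  by_cases hf : (U.neighborSet w).Finite
  · exact (mem_children hf).mp h
  · simp [children, hf] at h

theorem iterate_mem_layer (hw : w ∈ layer U p a (r + k)) : p^[k] w ∈ layer U p a r := by
  induction k generalizing w with
  | zero => exact hw
  | succ k ih =>
    obtain ⟨z, hz, hwz⟩ := Finset.mem_biUnion.mp hw
    rw [Function.iterate_succ_apply, (par_of_mem_children hwz).2]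
    exact ih hz

theorem iterate_of_mem_layer (hw : w ∈ layer U p a r) : p^[r] w = a := by
  have := iterate_mem_layer (r := 0) (k := r) (by rwa [Nat.zero_add])
  simpa [layer] using this

theorem adj_iterate_of_mem_layer (hw : w ∈ layer U p a r) (hk : k < r) :
    U.Adj (p^[k] w) (p^[k + 1] w) := by
  obtain ⟨j, rfl⟩ : ∃ j, r = (j + 1) + k := ⟨r - k - 1, by omega⟩
  obtain ⟨z, -, hz⟩ := Finset.mem_biUnion.mp (iterate_mem_layer hw)
  have := par_of_mem_children hz
  rw [Function.iterate_succ_apply', this.2]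
  exact this.1.symm

open Classical in
theorem countAbove_succ :
    countAbove p B (r + 1) w = countAbove p B r (p w) + if p w ∈ B then 1 else 0 := by
  rw [countAbove, Finset.sum_range_succ']
  rfl

open Classical in
/-- The weighted count of the leaves of a tree: if every node has a child, and every node outside
`B` has two, then there are at least `2 ^ r` nodes at depth `r`, when each of them is counted with a
factor `2` for each of its ancestors in `B`. -/
theorem pow_le_sum_layer
    (h : ∀ k < r, ∀ w ∈ layer U p a k,
      1 ≤ (children U p w).card ∧ (w ∉ B → 2 ≤ (children U p w).card)) :
    2 ^ r ≤ ∑ w ∈ layer U p a r, 2 ^ countAbove p B r w := by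
  induction r with
  | zero => simp [layer, countAbove]
  | succ r ih =>
    have ih := ih fun k hk => h k (by omega)
    have hdisj : Set.PairwiseDisjoint (layer U p a r : Set ℕ) (children U p) := by
      intro w _ w' _ hne
      refine Finset.disjoint_left.mpr fun c hc hc' => hne ?_
      exact (par_of_mem_children hc).2.symm.trans (par_of_mem_children hc').2
    rw [layer, Finset.sum_biUnion hdisj, pow_succ]
    calc 2 ^ r * 2 ≤ (∑ w ∈ layer U p a r, 2 ^ countAbove p B r w) * 2 :=
          Nat.mul_le_mul_right _ ih
      _ = ∑ w ∈ layer U p a r, 2 ^ countAbove p B r w * 2 := by rw [Finset.sum_mul]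
      _ ≤ _ := Finset.sum_le_sum fun w hw => ?_
    obtain ⟨h1, h2⟩ := h r (Nat.lt_succ_self r) w hw
    have hc : ∀ c ∈ children U p w, 2 ^ countAbove p B (r + 1) c =
        2 ^ countAbove p B r w * (if w ∈ B then 2 else 1) := by
      intro c hc
      have hp := (par_of_mem_children hc).2
      rw [countAbove_succ, hp]
      split_ifs with hB
      · rw [pow_add, pow_one]
      · rw [add_zero, mul_one]
    rw [Finset.sum_congr rfl hc, Finset.sum_const, smul_eq_mul]
    have hpos : 0 < 2 ^ countAbove p B r w := by positivity
    split_ifs with hB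
    · nlinarith
    · have := h2 hB
      nlinarith

/-- A set of numbers below `r` with gaps of at least `l` has at most `r / l + 1` elements. -/
theorem card_le_of_gaps {l : ℕ} (hl : 0 < l) (S : Finset ℕ) (hS : ∀ k ∈ S, k < r)
    (hgap : ∀ k ∈ S, ∀ k' ∈ S, k < k' → l ≤ k' - k) : S.card ≤ r / l + 1 := by
  have hmaps : ∀ k ∈ S, k / l ∈ Finset.range (r / l + 1) := fun k hk =>
    Finset.mem_range.mpr (Nat.lt_succ_of_le (Nat.div_le_div_right (hS k hk).le))
  have hinj : Set.InjOn (fun k => k / l) (S : Set ℕ) := by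
    have key : ∀ k ∈ S, ∀ k' ∈ S, k < k' → k / l = k' / l → False := by
      intro k hk k' hk' hlt heq
      have h1 := hgap k hk k' hk' hlt
      have h2 : k / l + 1 ≤ k' / l := by
        rw [← Nat.add_div_right k hl]
        exact Nat.div_le_div_right (by omega)
      omega
    intro k hk k' hk' heq
    rcases lt_trichotomy k k' with hlt | rfl | hlt
    · exact (key k hk k' hk' hlt heq).elim
    · rfl
    · exact (key k' hk' k hk hlt heq.symm).elim
  simpa using Finset.card_le_card_of_injOn _ hmaps hinj

/-- On a path of the forest there are few nodes of a set `B` that is covered by few sets with large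
pairwise distances. -/
theorem countAbove_le {rk : ℕ → ℕ} (hrk : ∀ v, p v ≠ v → rk (p v) < rk v) {i : ℕ} {s : ℕ → ℕ}
    {Z : ℕ → Set ℕ} (hs : ∀ j < i, 0 < s j)
    (hZ : ∀ j < i, ∀ x ∈ Z j, ∀ y ∈ Z j, x ≠ y → ¬ Within U (s j) x y)
    (hB : ∀ x ∈ B, ∃ j < i, x ∈ Z j) (hw : w ∈ layer U p a r) :
    countAbove p B r w ≤ ∑ j ∈ Finset.range i, (r / s j + 1) := by
  classical
  have hstep : ∀ k < r, rk (p^[k + 1] w) < rk (p^[k] w) := by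
    intro k hk
    have := adj_iterate_of_mem_layer hw hk
    rw [Function.iterate_succ_apply'] at this ⊢
    exact hrk _ this.ne'
  have hmono : ∀ k k', k < k' → k' ≤ r → rk (p^[k'] w) < rk (p^[k] w) := by
    intro k k' hkk'
    induction k', hkk' using Nat.le_induction with
    | base => exact fun h => hstep k h
    | succ k' _ ih => exact fun h => (hstep k' h).trans (ih (by omega))
  have hwithin : ∀ k d, k + d ≤ r → Within U d (p^[k] w) (p^[k + d] w) := by
    intro k d
    induction d with
    | zero => exact fun _ => Within.refl _ _ _
    | succ d ih =>
      exact fun h => (ih (by omega)).trans (Within.of_adj (adj_iterate_of_mem_layer hw (by omega)))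
  have hone : ∀ j < i,
      (∑ k ∈ Finset.range r, if p^[k + 1] w ∈ Z j then 1 else 0) ≤ r / s j + 1 := by
    intro j hj
    rw [← Finset.card_filter]
    refine card_le_of_gaps (hs j hj) _ (fun k hk => ?_) fun k hk k' hk' hlt => ?_
    · exact Finset.mem_range.mp (Finset.mem_filter.mp hk).1
    · obtain ⟨hk1, hk2⟩ := Finset.mem_filter.mp hk
      obtain ⟨hk1', hk2'⟩ := Finset.mem_filter.mp hk'
      rw [Finset.mem_range] at hk1 hk1'
      by_contra hcon
      have hwit := hwithin (k + 1) (k' - k) (by omega)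
      rw [show k + 1 + (k' - k) = k' + 1 by omega] at hwit
      refine hZ j hj _ hk2 _ hk2' (fun e => ?_) (hwit.mono (by omega))
      have := hmono (k + 1) (k' + 1) (by omega) (by omega)
      rw [e] at this
      exact lt_irrefl _ this
  calc countAbove p B r w
      ≤ ∑ k ∈ Finset.range r, ∑ j ∈ Finset.range i, if p^[k + 1] w ∈ Z j then 1 else 0 := by
        refine Finset.sum_le_sum fun k _ => ?_
        split_ifs with h
        · obtain ⟨j, hj, hz⟩ := hB _ h
          refine le_trans ?_ (Finset.single_le_sum (fun _ _ => Nat.zero_le _)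
            (Finset.mem_range.mpr hj))
          rw [if_pos hz]
        · exact Nat.zero_le _
    _ = ∑ j ∈ Finset.range i, ∑ k ∈ Finset.range r, if p^[k + 1] w ∈ Z j then 1 else 0 :=
        Finset.sum_comm
    _ ≤ _ := Finset.sum_le_sum fun j hj => hone j (Finset.mem_range.mp hj)

/-- All nodes have degree at most three, and the needy ones have degree exactly three, except for
those in the sets `Z j` for `j < i`, which may have degree two. The nodes of `Z j` have pairwise
distances greater than `s j`. -/
structure Thin (s : ℕ → ℕ) (i : ℕ) (Z : ℕ → Set ℕ) (I : Inst) : Prop where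
  deg : ∀ v, (I.gr.neighborSet v).encard ≤ 3
  sep : ∀ j < i, ∀ x ∈ Z j, ∀ y ∈ Z j, x ≠ y → ¬ Within I.gr (s j) x y
  needy : ∀ v ∈ I.needy, (I.gr.neighborSet v).encard = 3 ∨
    ((I.gr.neighborSet v).encard = 2 ∧ ∃ j < i, v ∈ Z j)

variable {I : Inst} {s : ℕ → ℕ} {i : ℕ} {Z : ℕ → Set ℕ}

/-- A node all of whose edges belong to the forest has at most one neighbor that is not a child. -/
theorem encard_le_children (hdeg : ∀ v, (U.neighborSet v).encard ≤ 3)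
    (h : ∀ y, U.Adj w y → p y = w ∨ p w = y) :
    (U.neighborSet w).encard ≤ (children U p w).card + 1 := by
  have hf : (U.neighborSet w).Finite := Set.finite_of_encard_le_coe (hdeg w)
  have hsub : U.neighborSet w ⊆ insert (p w) (children U p w : Set ℕ) := by
    intro y hy
    rcases h y hy with h' | h'
    · exact Or.inr ((mem_children hf).mpr ⟨hy, h'⟩)
    · exact Or.inl h'.symm
  refine (Set.encard_le_encard hsub).trans ((Set.encard_insert_le _ _).trans ?_)
  rw [Set.encard_coe_eq_coe_finsetCard]

/-- The needy nodes whose degree is not three; in a thin instance their degree is two. -/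
def Inst.narrow (I : Inst) : Set ℕ :=
  {v | v ∈ I.needy ∧ (I.gr.neighborSet v).encard ≠ 3}

/-- In a thin instance, a needy node all of whose edges belong to the forest has a child, and it has
two children unless its degree is two. -/
theorem Thin.card_children (h : Thin s i Z I) (hw : w ∈ I.needy)
    (ht : ∀ y, I.gr.Adj w y → p y = w ∨ p w = y) :
    1 ≤ (children I.gr p w).card ∧ (w ∉ I.narrow → 2 ≤ (children I.gr p w).card) := by
  have hc := encard_le_children h.deg ht
  constructor
  · have h2 : (2 : ℕ∞) ≤ (I.gr.neighborSet w).encard := by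
      rcases h.needy w hw with e | ⟨e, -⟩ <;> rw [e]
      norm_num
    have := h2.trans hc
    have : 2 ≤ (children I.gr p w).card + 1 := by exact_mod_cast this
    omega
  · intro hn
    have h3 : (I.gr.neighborSet w).encard = 3 := by
      by_contra h3
      exact hn ⟨hw, h3⟩
    rw [h3] at hc
    have : 3 ≤ (children I.gr p w).card + 1 := by exact_mod_cast hc
    omega

theorem Thin.countAbove_narrow_le (h : Thin s i Z I) {rk : ℕ → ℕ}
    (hrk : ∀ v, p v ≠ v → rk (p v) < rk v) (hs : ∀ j < i, 0 < s j) (hw : w ∈ layer I.gr p a r) :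
    countAbove p I.narrow r w ≤ ∑ j ∈ Finset.range i, (r / s j + 1) :=
  countAbove_le hrk hs h.sep
    (fun x hx => ((h.needy x hx.1).resolve_left hx.2).2) hw

/-- A tree in a thin instance grows exponentially. -/
theorem Thin.pow_le_card_layer (h : Thin s i Z I) {rk : ℕ → ℕ}
    (hrk : ∀ v, p v ≠ v → rk (p v) < rk v) (hs : ∀ j < i, 0 < s j)
    (ht : ∀ k < r, ∀ w ∈ layer I.gr p a k,
      w ∈ I.needy ∧ ∀ y, I.gr.Adj w y → p y = w ∨ p w = y) :
    2 ^ r ≤ (layer I.gr p a r).card * 2 ^ ∑ j ∈ Finset.range i, (r / s j + 1) := by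
  refine (pow_le_sum_layer (B := I.narrow) fun k hk w hw =>
    h.card_children (ht k hk w hw).1 (ht k hk w hw).2).trans ?_
  rw [← smul_eq_mul, ← Finset.sum_const]
  exact Finset.sum_le_sum fun w hw =>
    Nat.pow_le_pow_right (by norm_num) (h.countAbove_narrow_le hrk hs hw)

end Growth

/-! ### The stage that thins out the undecided nodes -/

namespace Level

section Definitions

variable (M : Inst → Set ℕ) (h : ℕ)

/-- The distance to the set `M I` of centers, cut off at `32 * h + 1`. -/
noncomputable def depth (I : Inst) (v : ℕ) : ℕ :=
  sInf {k | k = 32 * h + 1 ∨ (k ≤ 32 * h ∧ ∃ x, Within I.gr k v x ∧ x ∈ M I)}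

/-- The neighbors of `v` that are closer to the centers. -/
def closer (I : Inst) (v : ℕ) : Set ℕ :=
  {w | Within I.gr 1 v w ∧ (I.gr.Adj v w ∧ depth M h I w + 1 = depth M h I v)}

open Classical in
/-- The parent of a node: a neighbor closer to the centers. -/
noncomputable def par (I : Inst) (v : ℕ) : ℕ :=
  if (closer M h I v).Nonempty then sInf (closer M h I v) else v

/-- The ancestors of `v`, including `v`. -/
def anc (I : Inst) (v : ℕ) : Set ℕ :=
  {y | ∃ j ≤ 32 * h, (par M h I)^[j] v = y}

/-- The center to whose cluster `v` belongs. No node is farther than `32 * h` from a center, and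
centers are their own parents, so `32 * h` steps lead to the center. -/
noncomputable def root (I : Inst) (v : ℕ) : ℕ :=
  (par M h I)^[32 * h] v

/-- The descendants of `u`, including `u`. -/
def below (I : Inst) (u : ℕ) : Set ℕ :=
  {v | Within I.gr (32 * h) u v ∧ u ∈ anc M h I v}

/-- The edges at `x` that are outside the forest, but inside a cluster. -/
def chords (I : Inst) (x : ℕ) : Set ℕ :=
  {y | Within I.gr 1 x y ∧ (I.gr.Adj x y ∧ par M h I y ≠ x ∧ par M h I x ≠ y ∧
    root M h I y = root M h I x)}

/-- All nodes of the cluster of `a` are needy, and the cluster induces a tree. -/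
def Pure (I : Inst) (a : ℕ) : Prop :=
  ¬ ∃ x, Within I.gr (32 * h) a x ∧
    (root M h I x = a ∧ (x ∉ I.needy ∨ (chords M h I x).Nonempty))

/-- The numbers of descendants of the nodes of degree three of small depth in the cluster of `a`. -/
def sizes (I : Inst) (a : ℕ) : Set ℕ :=
  {y | ∃ x, Within I.gr (32 * h) a x ∧ ((root M h I x = a ∧ 0 < depth M h I x ∧
    depth M h I x ≤ 8 * h ∧ (I.gr.neighborSet x).encard = 3) ∧ (below M h I x).ncard = y)}

/-- Those nodes of degree three of small depth in the cluster of `a` that have the fewest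
descendants. -/
def best (I : Inst) (a : ℕ) : Set ℕ :=
  {x | Within I.gr (32 * h) a x ∧ ((root M h I x = a ∧ 0 < depth M h I x ∧
    depth M h I x ≤ 8 * h ∧ (I.gr.neighborSet x).encard = 3) ∧
    (below M h I x).ncard = sInf (sizes M h I a))}

/-- The nodes of pure clusters that descend from the selected node of their cluster. -/
def pre (I : Inst) : Set ℕ :=
  {v | ∃ a, Within I.gr (32 * h) v a ∧ (root M h I v = a ∧ Pure M h I a ∧
    sInf (best M h I a) ∈ anc M h I v)}

/-- The edges outside the forest by which a cluster may escape: they lead to the same cluster, or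
from a node in `pre` to a node outside `pre`. The second condition is asymmetric, which keeps two
clusters from escaping over the same edge, and an escape to
another cluster never leads to a node in `pre`. -/
def exits (I : Inst) (x : ℕ) : Set ℕ :=
  {y | Within I.gr 1 x y ∧ (I.gr.Adj x y ∧ par M h I y ≠ x ∧ par M h I x ≠ y ∧
    (root M h I y = root M h I x ∨ (x ∈ pre M h I ∧ y ∉ pre M h I)))}

/-- The nodes of the cluster of `a` that need no outgoing edge or have an exit. -/
def ends (I : Inst) (a : ℕ) : Set ℕ :=
  {x | Within I.gr (32 * h) a x ∧
    (root M h I x = a ∧ (x ∉ I.needy ∨ (exits M h I x).Nonempty))}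

/-- The plan of the stage, carried out with paths of length at most `32 * h`. In a cluster with an
end, the path from an end to the center is reversed. In every other cluster, the nodes below the
selected node are kept, and all other nodes are directed towards the selected node. -/
noncomputable def plan (I : Inst) : Plan where
  par := par M h I
  term := {x | ∃ a, Within I.gr (32 * h) x a ∧ (root M h I x = a ∧
    (((ends M h I a).Nonempty ∧ x = sInf (ends M h I a)) ∨
      (¬ (ends M h I a).Nonempty ∧ x = sInf (best M h I a))))}
  esc x := sInf (exits M h I x)
  kept := {v | ∃ a, Within I.gr (32 * h) v a ∧ (root M h I v = a ∧ v ∈ pre M h I ∧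
    ¬ (ends M h I a).Nonempty)}

end Definitions

section Locality

variable {M : Inst → Set ℕ} {h r : ℕ}

theorem depth_loc (hM : Loc r fun I v => v ∈ M I) :
    Loc (r + 32 * h) fun I v => depth M h I v := by
  intro I J v hv
  simp only [depth]
  congr 1
  ext k
  refine or_congr_right (and_congr_right fun hk => ?_)
  exact iff_of_eq ((hM.exists k fun _ _ _ b => b).mono (show r + k ≤ r + 32 * h by omega) I J v hv)

theorem closer_loc (hM : Loc r fun I v => v ∈ M I) :
    Loc (r + 32 * h + 1) fun I v => closer M h I v :=
  ((Loc.adj.mono (Nat.zero_le _)).prod (depth_loc hM)).setOf 1 fun _ w q q' =>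
    q.1 w ∧ q'.2 + 1 = q.2

theorem par_loc (hM : Loc r fun I v => v ∈ M I) :
    Loc (r + 32 * h + 1) fun I v => par M h I v := by
  classical
  intro I J v hv
  have := (closer_loc (h := h) hM).map (fun v S => if S.Nonempty then sInf S else v) I J v hv
  simp only [par]
  convert this

theorem par_within (I : Inst) (v : ℕ) : Within I.gr 1 v (par M h I v) := by
  rw [par]
  split_ifs with hne
  · exact (Nat.sInf_mem hne).1
  · exact Within.refl _ _ _

theorem anc_loc (hM : Loc r fun I v => v ∈ M I) :
    Loc (r + 64 * h + 1) fun I v => anc M h I v :=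
  ((par_loc hM).orbit par_within (32 * h)).mono (by omega)

theorem root_loc (hM : Loc r fun I v => v ∈ M I) :
    Loc (r + 64 * h + 1) fun I v => root M h I v :=
  ((par_loc hM).iterate par_within (32 * h)).mono (by omega)

theorem below_loc (hM : Loc r fun I v => v ∈ M I) :
    Loc (r + 96 * h + 1) fun I v => below M h I v :=
  ((anc_loc hM).setOf (32 * h) fun u _ _ q' => u ∈ q').mono (by omega)

theorem chords_loc (hM : Loc r fun I v => v ∈ M I) :
    Loc (r + 64 * h + 2) fun I v => chords M h I v :=
  ((Loc.adj.mono (Nat.zero_le (r + 64 * h + 1))).prod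
    (((par_loc (h := h) hM).mono (by omega)).prod (root_loc hM))).setOf 1 fun x y q q' =>
      q.1 y ∧ q'.2.1 ≠ x ∧ q.2.1 ≠ y ∧ q'.2.2 = q.2.2

theorem pure_loc (hM : Loc r fun I v => v ∈ M I) :
    Loc (r + 96 * h + 2) fun I v => Pure M h I v :=
  (((((root_loc (h := h) hM).mono (Nat.le_succ _)).prod
    ((Loc.needy.mono (Nat.zero_le (r + 64 * h + 2))).prod (chords_loc hM))).exists (32 * h)
      fun a _ _ q' => q'.1 = a ∧ (¬ q'.2.1 ∨ q'.2.2.Nonempty)).map fun _ b => ¬ b).mono (by omega)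

/-- The data of a node that enter the selection of a node in each cluster. -/
theorem data_loc (hM : Loc r fun I v => v ∈ M I) :
    Loc (r + 96 * h + 1) fun I v => (root M h I v, depth M h I v, I.gr.Adj v, below M h I v) :=
  ((root_loc hM).mono (by omega)).prod (((depth_loc hM).mono (by omega)).prod
    ((Loc.adj.mono (Nat.zero_le _)).prod (below_loc hM)))

theorem sizes_loc (hM : Loc r fun I v => v ∈ M I) :
    Loc (r + 128 * h + 1) fun I v => sizes M h I v :=
  ((data_loc (h := h) hM).image (32 * h) fun a _ q (y : ℕ) =>
    (q.1 = a ∧ 0 < q.2.1 ∧ q.2.1 ≤ 8 * h ∧ {w | q.2.2.1 w}.encard = 3) ∧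
      q.2.2.2.ncard = y).mono (by omega)

theorem best_loc (hM : Loc r fun I v => v ∈ M I) :
    Loc (r + 160 * h + 1) fun I v => best M h I v :=
  (((sizes_loc (h := h) hM).prod ((data_loc (h := h) hM).mono (by omega))).setOf (32 * h)
    fun a _ p q => (q.2.1 = a ∧ 0 < q.2.2.1 ∧ q.2.2.1 ≤ 8 * h ∧ {w | q.2.2.2.1 w}.encard = 3) ∧
      q.2.2.2.2.ncard = sInf p.1).mono (by omega)

theorem pre_loc (hM : Loc r fun I v => v ∈ M I) :
    Loc (r + 192 * h + 2) fun I v => v ∈ pre M h I :=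
  ((((root_loc (h := h) hM).mono (show _ ≤ r + 160 * h + 2 by omega)).prod
    (((pure_loc (h := h) hM).mono (by omega)).prod
      (((best_loc (h := h) hM).mono (by omega)).prod
        ((anc_loc (h := h) hM).mono (by omega))))).exists (32 * h) fun _ a q q' =>
          q.1 = a ∧ q'.2.1 ∧ sInf q'.2.2.1 ∈ q.2.2.2).mono (by omega)

theorem exits_loc (hM : Loc r fun I v => v ∈ M I) :
    Loc (r + 192 * h + 3) fun I v => exits M h I v :=
  ((Loc.adj.mono (Nat.zero_le (r + 192 * h + 2))).prod
    (((par_loc (h := h) hM).mono (by omega)).prod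
      (((root_loc (h := h) hM).mono (by omega)).prod (pre_loc hM)))).setOf 1 fun x y q q' =>
        q.1 y ∧ q'.2.1 ≠ x ∧ q.2.1 ≠ y ∧ (q'.2.2.1 = q.2.2.1 ∨ (q.2.2.2 ∧ ¬ q'.2.2.2))

theorem ends_loc (hM : Loc r fun I v => v ∈ M I) :
    Loc (r + 224 * h + 3) fun I v => ends M h I v :=
  ((((root_loc (h := h) hM).mono (by omega)).prod
    ((Loc.needy.mono (Nat.zero_le (r + 192 * h + 3))).prod (exits_loc hM))).setOf (32 * h)
      fun a _ _ q' => q'.1 = a ∧ (¬ q'.2.1 ∨ q'.2.2.Nonempty)).mono (by omega)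

theorem isLocal (hM : Loc r fun I v => v ∈ M I) :
    (Plan.stage (plan M h) (32 * h)).IsLocal (r + 320 * h + 5) := by
  have hq := ((root_loc (h := h) hM).mono (show _ ≤ r + 224 * h + 3 by omega)).prod
    (((pre_loc (h := h) hM).mono (by omega)).prod ((ends_loc (h := h) hM).prod
      ((best_loc (h := h) hM).mono (by omega))))
  have h1 := hq.exists (32 * h) fun x a q q' => q.1 = a ∧
    ((q'.2.2.1.Nonempty ∧ x = sInf q'.2.2.1) ∨ (¬ q'.2.2.1.Nonempty ∧ x = sInf q'.2.2.2))
  have h2 := hq.exists (32 * h) fun _ a q q' => q.1 = a ∧ q.2.1 ∧ ¬ q'.2.2.1.Nonempty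
  have h3 := (exits_loc (h := h) hM).map fun _ S => sInf S
  have := Plan.stage_isLocal (P := plan M h) (J := 32 * h) (r := r + 256 * h + 3)
    ((par_loc hM).mono (by omega)) par_within (h1.mono (by omega)) (h3.mono (by omega))
    (h2.mono (by omega))
  have e : r + 256 * h + 3 + 2 * (32 * h) + 2 = r + 320 * h + 5 := by omega
  rwa [e] at this

end Locality

section Clusters

variable {M : Inst → Set ℕ} {h : ℕ} {I : Inst} {v w x y a : ℕ}

/-- The set of centers is a maximal set of nodes with pairwise distances greater than `32 * h`. -/
structure Centers (M : Inst → Set ℕ) (h : ℕ) (I : Inst) : Prop where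
  sep : ∀ x ∈ M I, ∀ y ∈ M I, Within I.gr (32 * h) x y → x = y
  cov : ∀ v, ∃ x, Within I.gr (32 * h) v x ∧ x ∈ M I

theorem depth_le_of_within {k : ℕ} (hw : Within I.gr k v x) (hx : x ∈ M I) :
    depth M h I v ≤ k := by
  rcases le_total k (32 * h) with hk | hk
  · exact Nat.sInf_le (Or.inr ⟨hk, x, hw, hx⟩)
  · rcases hk.eq_or_lt with rfl | hk
    · exact Nat.sInf_le (Or.inr ⟨le_rfl, x, hw, hx⟩)
    · exact le_trans (Nat.sInf_le (Or.inl rfl)) hk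

theorem par_cases (I : Inst) (v : ℕ) :
    (par M h I v = v ∧ ¬ (closer M h I v).Nonempty) ∨ par M h I v ∈ closer M h I v := by
  rw [par]
  split_ifs with hne
  · exact Or.inr (Nat.sInf_mem hne)
  · exact Or.inl ⟨rfl, hne⟩

theorem par_adj (I : Inst) (v : ℕ) : par M h I v = v ∨ I.gr.Adj v (par M h I v) := by
  rcases par_cases (M := M) (h := h) I v with hp | hp
  · exact Or.inl hp.1
  · exact Or.inr hp.2.1

theorem depth_par_lt (hne : par M h I v ≠ v) : depth M h I (par M h I v) < depth M h I v := by
  rcases par_cases (M := M) (h := h) I v with hp | hp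
  · exact absurd hp.1 hne
  · have := hp.2.2
    omega

theorem iterate_within (j : ℕ) : Within I.gr j v ((par M h I)^[j] v) :=
  within_iterate (par_adj I) j v

namespace Centers

variable (hC : Centers M h I)

include hC

theorem depth_spec (v : ℕ) :
    depth M h I v ≤ 32 * h ∧ ∃ x, Within I.gr (depth M h I v) v x ∧ x ∈ M I := by
  obtain ⟨x, hx, hm⟩ := hC.cov v
  have hle := depth_le_of_within (h := h) hx hm
  have := Nat.sInf_mem (s := {k | k = 32 * h + 1 ∨
    (k ≤ 32 * h ∧ ∃ x, Within I.gr k v x ∧ x ∈ M I)}) ⟨_, Or.inl rfl⟩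
  rcases this with h1 | h1
  · have : depth M h I v = 32 * h + 1 := h1
    omega
  · exact h1

theorem depth_eq_zero : depth M h I v = 0 ↔ v ∈ M I := by
  constructor
  · intro h0
    obtain ⟨-, x, hx, hm⟩ := hC.depth_spec v
    rw [h0, within_zero_iff] at hx
    rwa [hx]
  · exact fun hm => Nat.le_zero.mp (depth_le_of_within (Within.refl _ _ _) hm)

theorem depth_le_succ (hvw : I.gr.Adj v w) : depth M h I v ≤ depth M h I w + 1 := by
  obtain ⟨-, x, hx, hm⟩ := hC.depth_spec w
  exact depth_le_of_within (within_succ_iff.mpr (Or.inr ⟨w, hvw, hx⟩)) hm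

theorem depth_par : depth M h I (par M h I v) = depth M h I v - 1 := by
  rcases par_cases (M := M) (h := h) I v with hp | hp
  · rw [hp.1]
    cases hd : depth M h I v with
    | zero => rfl
    | succ k =>
      obtain ⟨-, x, hx, hm⟩ := hC.depth_spec v
      rw [hd] at hx
      rcases within_succ_iff.mp hx with rfl | ⟨w, hvw, hw⟩
      · rw [hC.depth_eq_zero.mpr hm] at hd
        exact absurd hd (Nat.succ_ne_zero k).symm
      · have h1 := depth_le_of_within (h := h) hw hm
        have h2 := hC.depth_le_succ hvw
        exact absurd ⟨w, Within.of_adj hvw, hvw, by omega⟩ hp.2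
  · have := hp.2.2
    omega

theorem par_eq_self_iff : par M h I v = v ↔ depth M h I v = 0 := by
  constructor
  · intro hp
    have := hC.depth_par (v := v)
    rw [hp] at this
    omega
  · intro h0
    by_contra hne
    have := depth_par_lt hne
    omega

theorem depth_iterate (j : ℕ) : depth M h I ((par M h I)^[j] v) = depth M h I v - j := by
  induction j with
  | zero => rfl
  | succ j ih =>
    rw [Function.iterate_succ_apply', hC.depth_par, ih]
    omega

theorem depth_root (v : ℕ) : depth M h I (root M h I v) = 0 := by
  have := (hC.depth_spec v).1
  rw [root, hC.depth_iterate]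
  omega

theorem root_mem (v : ℕ) : root M h I v ∈ M I :=
  hC.depth_eq_zero.mp (hC.depth_root v)

theorem par_root (v : ℕ) : par M h I (root M h I v) = root M h I v :=
  hC.par_eq_self_iff.mpr (hC.depth_root v)

theorem root_par (v : ℕ) : root M h I (par M h I v) = root M h I v := by
  rw [root, ← Function.iterate_succ_apply, Function.iterate_succ_apply']
  exact hC.par_root v

theorem root_iterate (j v : ℕ) : root M h I ((par M h I)^[j] v) = root M h I v := by
  induction j generalizing v with
  | zero => rfl
  | succ j ih => rw [Function.iterate_succ_apply, ih, hC.root_par]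

omit hC in
theorem root_of_par (hp : par M h I a = a) : root M h I a = a :=
  Function.iterate_fixed hp _

theorem iterate_depth (v : ℕ) : (par M h I)^[depth M h I v] v = root M h I v := by
  have hle := (hC.depth_spec v).1
  obtain ⟨k, hk⟩ : ∃ k, 32 * h = k + depth M h I v := ⟨32 * h - depth M h I v, by omega⟩
  have h0 : par M h I ((par M h I)^[depth M h I v] v) = (par M h I)^[depth M h I v] v := by
    rw [hC.par_eq_self_iff, hC.depth_iterate]
    omega
  rw [root, hk, Function.iterate_add_apply, Function.iterate_fixed h0]

theorem within_root (v : ℕ) : Within I.gr (depth M h I v) v (root M h I v) := by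
  rw [← hC.iterate_depth v]
  exact iterate_within _

theorem within_of_root (hr : root M h I v = a) : Within I.gr (32 * h) v a := by
  rw [← hr]
  exact (hC.within_root v).mono (hC.depth_spec v).1

/-- Only nodes far away from the center have neighbors in other clusters, because centers are more
than `32 * h` apart. -/
theorem le_depth_of_root_ne (hxy : I.gr.Adj x y) (hne : root M h I y ≠ root M h I x) :
    16 * h ≤ depth M h I x := by
  by_contra hlt
  have h1 := hC.depth_le_succ hxy.symm
  have hw := ((hC.within_root x).symm.trans (Within.of_adj hxy)).trans (hC.within_root y)
  exact hne (hC.sep _ (hC.root_mem x) _ (hC.root_mem y) (hw.mono (by omega))).symm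

theorem mem_anc_iff {u : ℕ} : u ∈ anc M h I v ↔ ∃ j, (par M h I)^[j] v = u := by
  constructor
  · rintro ⟨j, -, hj⟩
    exact ⟨j, hj⟩
  · rintro ⟨j, hj⟩
    by_cases hjd : j ≤ 32 * h
    · exact ⟨j, hjd, hj⟩
    · refine ⟨32 * h, le_rfl, ?_⟩
      obtain ⟨k, rfl⟩ : ∃ k, j = k + 32 * h := ⟨j - 32 * h, by omega⟩
      rw [Function.iterate_add_apply] at hj
      rw [← hj]
      exact (Function.iterate_fixed (hC.par_root v) k).symm

theorem mem_below_iff {u : ℕ} : v ∈ below M h I u ↔ ∃ j, (par M h I)^[j] v = u := by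
  rw [← hC.mem_anc_iff]
  refine ⟨fun hv => hv.2, fun hv => ⟨?_, hv⟩⟩
  obtain ⟨j, hj, rfl⟩ := hv
  exact (iterate_within j).symm.mono hj

theorem mem_pre_iff : v ∈ pre M h I ↔
    Pure M h I (root M h I v) ∧ sInf (best M h I (root M h I v)) ∈ anc M h I v := by
  constructor
  · rintro ⟨a, -, rfl, h1, h2⟩
    exact ⟨h1, h2⟩
  · rintro ⟨h1, h2⟩
    exact ⟨_, hC.within_of_root rfl, rfl, h1, h2⟩

theorem mem_kept_iff : v ∈ (plan M h I).kept ↔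
    v ∈ pre M h I ∧ ¬ (ends M h I (root M h I v)).Nonempty := by
  constructor
  · rintro ⟨a, -, rfl, h1, h2⟩
    exact ⟨h1, h2⟩
  · rintro ⟨h1, h2⟩
    exact ⟨_, hC.within_of_root rfl, rfl, h1, h2⟩

theorem mem_term_iff : x ∈ (plan M h I).term ↔
    ((ends M h I (root M h I x)).Nonempty ∧ x = sInf (ends M h I (root M h I x))) ∨
      (¬ (ends M h I (root M h I x)).Nonempty ∧ x = sInf (best M h I (root M h I x))) := by
  constructor
  · rintro ⟨a, -, rfl, h1⟩
    exact h1
  · intro h1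
    exact ⟨_, hC.within_of_root rfl, rfl, h1⟩

/-- The nodes of clusters without ends are needy, and have no exits. -/
theorem of_not_ends (he : ¬ (ends M h I (root M h I x)).Nonempty) :
    x ∈ I.needy ∧ ¬ (exits M h I x).Nonempty := by
  by_contra hcon
  refine he ⟨x, (hC.within_of_root rfl).symm, rfl, ?_⟩
  by_cases hx : x ∈ I.needy
  · right
    by_contra hex
    exact hcon ⟨hx, hex⟩
  · exact Or.inl hx

theorem pure_of_not_ends (he : ¬ (ends M h I a).Nonempty) : Pure M h I a := by
  rintro ⟨x, hx, rfl, hbad⟩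
  obtain ⟨h1, h2⟩ := hC.of_not_ends he
  rcases hbad with hb | ⟨y, hy⟩
  · exact hb h1
  · exact h2 ⟨y, hy.1, hy.2.1, hy.2.2.1, hy.2.2.2.1, Or.inl hy.2.2.2.2⟩

theorem of_pure (hp : Pure M h I (root M h I x)) : x ∈ I.needy ∧
    ∀ y, I.gr.Adj x y → root M h I y = root M h I x → par M h I y = x ∨ par M h I x = y := by
  constructor
  · by_contra hx
    exact hp ⟨x, (hC.within_of_root rfl).symm, rfl, Or.inl hx⟩
  · intro y hxy hr
    by_contra hcon
    push Not at hcon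
    exact hp ⟨x, (hC.within_of_root rfl).symm, rfl,
      Or.inr ⟨y, Within.of_adj hxy, hxy, hcon.1, hcon.2, hr⟩⟩

theorem of_mem_layer (ha : par M h I a = a) {k : ℕ}
    (hw : w ∈ layer I.gr (par M h I) a k) : root M h I w = a ∧ depth M h I w = k := by
  induction k generalizing w with
  | zero =>
    obtain rfl : w = a := by simpa [layer] using hw
    exact ⟨root_of_par ha, hC.par_eq_self_iff.mp ha⟩
  | succ k ih =>
    obtain ⟨z, hz, hwz⟩ := Finset.mem_biUnion.mp hw
    obtain ⟨hadj, hpar⟩ := par_of_mem_children hwz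
    obtain ⟨h1, h2⟩ := ih hz
    have hd := depth_par_lt (M := M) (h := h) (I := I) (v := w) (by rw [hpar]; exact hadj.ne)
    have hd' := hC.depth_par (v := w)
    rw [hpar] at hd hd'
    refine ⟨?_, by omega⟩
    rw [← hC.root_par, hpar, h1]

/-- Up to depth `16 * h`, a pure cluster looks like a tree of needy nodes. -/
theorem tree_of_mem_layer (hp : Pure M h I a) (ha : par M h I a = a) {k : ℕ} (hk : k < 16 * h)
    (hw : w ∈ layer I.gr (par M h I) a k) :
    w ∈ I.needy ∧ ∀ y, I.gr.Adj w y → par M h I y = w ∨ par M h I w = y := by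
  obtain ⟨h1, h2⟩ := hC.of_mem_layer ha hw
  obtain ⟨h3, h4⟩ := hC.of_pure (x := w) (by rwa [h1])
  refine ⟨h3, fun y hwy => h4 y hwy ?_⟩
  by_contra hne
  have := hC.le_depth_of_root_ne hwy hne
  omega

end Centers

end Clusters

section Selection

variable {M : Inst → Set ℕ} {h : ℕ} {I : Inst} {v w x y a : ℕ} {s : ℕ → ℕ} {i : ℕ} {Z : ℕ → Set ℕ}

namespace Centers

variable (hC : Centers M h I) (hT : Thin s i Z I) (hs : ∀ j < i, 0 < s j)
  (hb : ∑ j ∈ Finset.range i, (8 * h / s j + 1) ≤ h) (h0 : 0 < h)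

include hC hT

theorem exists_layer_above (hp : Pure M h I a) (ha : par M h I a = a) {r k : ℕ}
    (hk : r + k ≤ 16 * h) (hw : w ∈ layer I.gr (par M h I) a r) :
    ∃ z ∈ layer I.gr (par M h I) a (r + k), (par M h I)^[k] z = w := by
  induction k with
  | zero => exact ⟨w, hw, rfl⟩
  | succ k ih =>
    obtain ⟨z, hz, hzw⟩ := ih (by omega)
    obtain ⟨h1, h2⟩ := hC.tree_of_mem_layer hp ha (by omega) hz
    obtain ⟨c, hc⟩ := Finset.card_pos.mp (hT.card_children h1 h2).1
    refine ⟨c, Finset.mem_biUnion.mpr ⟨z, hz, hc⟩, ?_⟩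
    rw [Function.iterate_succ_apply, (par_of_mem_children hc).2, hzw]

include hs hb h0

/-- Below each node of depth `4 * h` there is a node of degree three whose depth is at most
`8 * h`, because there are only few nodes of degree two on a path. -/
theorem exists_branching (hp : Pure M h I a) (ha : par M h I a = a)
    (hw : w ∈ layer I.gr (par M h I) a (4 * h)) :
    ∃ u, (root M h I u = a ∧ 0 < depth M h I u ∧ depth M h I u ≤ 8 * h ∧
      (I.gr.neighborSet u).encard = 3) ∧ ∃ j, (par M h I)^[j] u = w := by
  classical
  obtain ⟨z, hz, hzw⟩ := hC.exists_layer_above hT hp ha (k := 4 * h) (by omega) hw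
  rw [show 4 * h + 4 * h = 8 * h by omega] at hz
  have hcount := hT.countAbove_narrow_le (p := par M h I) (rk := depth M h I)
    (fun _ => depth_par_lt) hs hz
  obtain ⟨k, hk, hkn⟩ : ∃ k < 4 * h, (par M h I)^[k + 1] z ∉ I.narrow := by
    by_contra hcon
    push Not at hcon
    have h1 : (4 * h) ≤ countAbove (par M h I) I.narrow (8 * h) z := by
      calc 4 * h = ∑ k ∈ Finset.range (4 * h), 1 := by simp
        _ ≤ ∑ k ∈ Finset.range (4 * h),
            (if (par M h I)^[k + 1] z ∈ I.narrow then 1 else 0) :=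
          Finset.sum_le_sum fun k hk => by rw [if_pos (hcon k (Finset.mem_range.mp hk))]
        _ ≤ _ := by
          rw [countAbove]
          exact Finset.sum_le_sum_of_subset (Finset.range_mono (show 4 * h ≤ 8 * h by omega))
    omega
  have hu : (par M h I)^[k + 1] z ∈ layer I.gr (par M h I) a (8 * h - (k + 1)) :=
    iterate_mem_layer (by rwa [show 8 * h - (k + 1) + (k + 1) = 8 * h by omega])
  obtain ⟨h1, h2⟩ := hC.of_mem_layer ha hu
  have h3 := (hC.tree_of_mem_layer hp ha (by omega) hu).1
  refine ⟨_, ⟨h1, by omega, by omega, ?_⟩, 4 * h - (k + 1), ?_⟩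
  · by_contra hne
    exact hkn ⟨h3, hne⟩
  · rw [← Function.iterate_add_apply, ← hzw]
    congr 1
    omega

theorem best_spec (hp : Pure M h I a) (ha : par M h I a = a) :
    sInf (best M h I a) ∈ best M h I a := by
  have hroot : a ∈ layer I.gr (par M h I) a 0 := by simp [layer]
  obtain ⟨w, hw, -⟩ := hC.exists_layer_above hT hp ha (k := 4 * h) (by omega) hroot
  rw [Nat.zero_add] at hw
  obtain ⟨u, hu, -⟩ := hC.exists_branching hT hs hb h0 hp ha hw
  have hne : (sizes M h I a).Nonempty :=
    ⟨_, u, (hC.within_of_root hu.1).symm, hu, rfl⟩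
  obtain ⟨x, hx1, hx2, hx3⟩ := Nat.sInf_mem hne
  exact Nat.sInf_mem ⟨x, hx1, hx2, hx3⟩

omit hT hs hb h0 in
theorem finite_cluster (hT : ∀ v, (I.gr.neighborSet v).encard ≤ 3) (a : ℕ) :
    {v | root M h I v = a}.Finite := by
  have hfin : {v | Within I.gr (32 * h) a v}.Finite :=
    Set.finite_of_encard_le_coe (k := 4 ^ (32 * h)) (by simpa using encard_within_le hT (32 * h) a)
  exact hfin.subset fun v hv => (hC.within_of_root hv).symm

/-- The selected node of a pure cluster has a small fraction of the cluster below it: there are many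
disjoint subtrees to choose from. -/
theorem ncard_below_best_le (hp : Pure M h I a) (ha : par M h I a = a) :
    2 ^ (3 * h) * (below M h I (sInf (best M h I a))).ncard ≤ {v | root M h I v = a}.ncard := by
  classical
  set L := layer I.gr (par M h I) a (4 * h) with hL
  have hcard : 2 ^ (3 * h) ≤ L.card := by
    have h1 := hT.pow_le_card_layer (p := par M h I) (a := a) (r := 4 * h) (rk := depth M h I)
      (fun v => depth_par_lt) hs fun k hk w hw => hC.tree_of_mem_layer hp ha (by omega) hw
    have h2 : ∑ j ∈ Finset.range i, (4 * h / s j + 1) ≤ h :=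
      le_trans (Finset.sum_le_sum fun j _ =>
        Nat.add_le_add_right (Nat.div_le_div_right (by omega)) 1) hb
    have h3 := Nat.mul_le_mul_left L.card (Nat.pow_le_pow_right (show 0 < 2 by norm_num) h2)
    have h4 : 2 ^ (4 * h) = 2 ^ (3 * h) * 2 ^ h := by rw [← pow_add]; congr 1; omega
    exact Nat.le_of_mul_le_mul_right (h4 ▸ h1.trans h3) (by positivity)
  choose! u hu hj using fun w (hw : w ∈ L) => hC.exists_branching hT hs hb h0 hp ha hw
  have hfin : ∀ w ∈ L, (below M h I (u w)).Finite := fun w hw =>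
    (hC.finite_cluster hT.deg a).subset fun v hv => by
      obtain ⟨j, hjv⟩ := hC.mem_below_iff.mp hv
      rw [← (hu w hw).1, ← hjv]
      exact (hC.root_iterate j v).symm
  let F : ℕ → Finset ℕ := fun w => if hw : w ∈ L then (hfin w hw).toFinset else ∅
  have hmem : ∀ w ∈ L, ∀ v, v ∈ F w ↔ ∃ j, (par M h I)^[j] v = u w := by
    intro w hw v
    simp only [F, dif_pos hw, Set.Finite.mem_toFinset, hC.mem_below_iff]
  have hdisj : Set.PairwiseDisjoint (L : Set ℕ) F := by
    -- the sets of descendants are disjoint, as `w` is the ancestor at depth `4 * h` of all nodes in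
    -- `F w`
    have hd : ∀ w ∈ L, ∀ v ∈ F w, ∃ j, (par M h I)^[j] v = w ∧ depth M h I v - j = 4 * h := by
      intro w hw v hv
      obtain ⟨j, hj'⟩ := (hmem w hw v).mp hv
      obtain ⟨k, hk⟩ := hj w hw
      refine ⟨k + j, by rw [Function.iterate_add_apply, hj', hk], ?_⟩
      rw [← hC.depth_iterate, Function.iterate_add_apply, hj', hk]
      exact (hC.of_mem_layer ha hw).2
    intro w hw w' hw' hne
    refine Finset.disjoint_left.mpr fun v hv hv' => hne ?_
    obtain ⟨j, hj1, hj2⟩ := hd w hw v hv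
    obtain ⟨j', hj1', hj2'⟩ := hd w' hw' v hv'
    obtain rfl : j = j' := by omega
    exact hj1.symm.trans hj1'
  have hmin : ∀ w ∈ L, (below M h I (sInf (best M h I a))).ncard ≤ (F w).card := by
    intro w hw
    have h1 := (hC.best_spec hT hs hb h0 hp ha).2.2
    have h2 : sInf (sizes M h I a) ≤ (below M h I (u w)).ncard :=
      Nat.sInf_le ⟨u w, (hC.within_of_root (hu w hw).1).symm, hu w hw, rfl⟩
    have h3 : (F w).card = (below M h I (u w)).ncard := by
      simp only [F, dif_pos hw]
      exact (Set.ncard_eq_toFinset_card _ (hfin w hw)).symm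
    omega
  calc 2 ^ (3 * h) * (below M h I (sInf (best M h I a))).ncard
      ≤ L.card * (below M h I (sInf (best M h I a))).ncard := Nat.mul_le_mul_right _ hcard
    _ = ∑ w ∈ L, (below M h I (sInf (best M h I a))).ncard := by
        rw [Finset.sum_const, smul_eq_mul]
    _ ≤ ∑ w ∈ L, (F w).card := Finset.sum_le_sum hmin
    _ = (L.biUnion F).card := (Finset.card_biUnion hdisj).symm
    _ = ((L.biUnion F : Finset ℕ) : Set ℕ).ncard := (Set.ncard_coe_finset _).symm
    _ ≤ _ := by
        refine Set.ncard_le_ncard (fun v hv => ?_) (hC.finite_cluster hT.deg a)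
        obtain ⟨w, hw, hvw⟩ := Finset.mem_biUnion.mp (Finset.mem_coe.mp hv)
        obtain ⟨j, hj'⟩ := (hmem w hw v).mp hvw
        show root M h I v = a
        rw [← hC.root_iterate j v, hj', (hu w hw).1]

/-- The plan is valid. Two ends never escape over the same edge: an edge within a cluster is used
only by the one end of this cluster, and an edge between clusters only by its end in `pre`. -/
theorem valid : (plan M h I).Valid I (32 * h) where
  par := par_adj I
  rank := ⟨depth M h I, fun _ => depth_par_lt⟩
  esc := by
    intro x hx hk hn
    have hne : (exits M h I x).Nonempty := by
      rcases hC.mem_term_iff.mp hx with ⟨he, hxe⟩ | ⟨he, hxe⟩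
      · have := Nat.sInf_mem he
        rw [← hxe] at this
        exact this.2.2.resolve_left (not_not_intro hn)
      · refine absurd (hC.mem_kept_iff.mpr ⟨hC.mem_pre_iff.mpr ⟨hC.pure_of_not_ends he, ?_⟩, he⟩) hk
        rw [← hxe]
        exact ⟨0, Nat.zero_le _, rfl⟩
    have := Nat.sInf_mem hne
    exact ⟨this.2.1, this.2.2.1, this.2.2.2.1⟩
  conflict := by
    intro x hx hxk hxn hy hyk hyn hyx
    have key : ∀ z ∈ (plan M h I).term, z ∉ (plan M h I).kept → z ∈ I.needy →
        z = sInf (ends M h I (root M h I z)) ∧ (plan M h I).esc z ∈ exits M h I z := by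
      intro z hz hk hn
      rcases hC.mem_term_iff.mp hz with ⟨he, hze⟩ | ⟨he, hze⟩
      · have := Nat.sInf_mem he
        rw [← hze] at this
        exact ⟨hze, Nat.sInf_mem (this.2.2.resolve_left (not_not_intro hn))⟩
      · refine absurd (hC.mem_kept_iff.mpr ⟨hC.mem_pre_iff.mpr ⟨hC.pure_of_not_ends he, ?_⟩, he⟩) hk
        rw [← hze]
        exact ⟨0, Nat.zero_le _, rfl⟩
    obtain ⟨hx1, hx2⟩ := key x hx hxk hxn
    obtain ⟨hy1, hy2⟩ := key _ hy hyk hyn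
    rw [hyx] at hy2
    have hne := hx2.2.1.ne
    have hr : root M h I ((plan M h I).esc x) = root M h I x → False := by
      intro hr
      rw [hr] at hy1
      exact hne (hx1.trans hy1.symm)
    rcases hx2.2.2.2.2 with h1 | h1
    · exact hr h1
    · rcases hy2.2.2.2.2 with h2 | h2
      · exact hr h2.symm
      · exact h1.2 h2.1
  root := by
    intro v _ _ hpar
    have hr : root M h I v = v := root_of_par hpar
    have key : ∀ x, root M h I x = v → x ∈ (plan M h I).term → (plan M h I).OnPath I (32 * h) v :=
      fun x hx ht => ⟨x, (hC.within_of_root hx).symm, ht, 32 * h, le_rfl, hx⟩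
    by_cases he : (ends M h I v).Nonempty
    · have hx := Nat.sInf_mem he
      refine key _ hx.2.1 (hC.mem_term_iff.mpr (Or.inl ?_))
      rw [hx.2.1]
      exact ⟨he, rfl⟩
    · have hx := hC.best_spec hT hs hb h0 (hC.pure_of_not_ends he) hpar
      refine key _ hx.2.1.1 (hC.mem_term_iff.mpr (Or.inr ?_))
      rw [hx.2.1.1]
      exact ⟨he, rfl⟩

omit hs hb h0 hT in
theorem kept_subset : (plan M h I).kept ⊆ I.needy :=
  fun _ hv => (hC.of_not_ends (hC.mem_kept_iff.mp hv).2).1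

/-- Few nodes are kept: in each cluster, only those below its selected node. -/
theorem ncard_kept_le (hfin : I.needy.Finite) :
    2 ^ (3 * h) * (plan M h I).kept.ncard ≤ I.needy.ncard := by
  classical
  have hkfin := hfin.subset hC.kept_subset
  rw [Set.ncard_eq_toFinset_card _ hfin, Set.ncard_eq_toFinset_card _ hkfin]
  set A := hkfin.toFinset.image (root M h I) with hA
  have h1 : hkfin.toFinset.card =
      ∑ a ∈ A, (hkfin.toFinset.filter fun v => root M h I v = a).card :=
    Finset.card_eq_sum_card_fiberwise fun v hv =>
      Finset.mem_coe.mpr (Finset.mem_image_of_mem _ hv)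
  have h2 : ∑ a ∈ A, (hfin.toFinset.filter fun v => root M h I v = a).card ≤
      hfin.toFinset.card := by
    rw [← Finset.card_biUnion]
    · exact Finset.card_le_card (Finset.biUnion_subset.mpr fun a _ => Finset.filter_subset _ _)
    · intro a _ b _ hab
      refine Finset.disjoint_left.mpr fun v hv hv' => hab ?_
      rw [← (Finset.mem_filter.mp hv).2, (Finset.mem_filter.mp hv').2]
  rw [h1, Finset.mul_sum]
  refine le_trans (Finset.sum_le_sum fun a ha => ?_) h2
  obtain ⟨v, hv, rfl⟩ := Finset.mem_image.mp ha
  have hvk := hC.mem_kept_iff.mp (hkfin.mem_toFinset.mp hv)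
  have hpure := hC.pure_of_not_ends hvk.2
  have h3 := hC.ncard_below_best_le hT hs hb h0 hpure (hC.par_root v)
  have h4 : (hkfin.toFinset.filter fun w => root M h I w = root M h I v).card ≤
      (below M h I (sInf (best M h I (root M h I v)))).ncard := by
    rw [← Set.ncard_coe_finset]
    refine Set.ncard_le_ncard (fun w hw => ?_) ?_
    · obtain ⟨hw1, hw2⟩ := Finset.mem_filter.mp (Finset.mem_coe.mp hw)
      have := (hC.mem_pre_iff.mp (hC.mem_kept_iff.mp (hkfin.mem_toFinset.mp hw1)).1).2
      rw [hw2] at this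
      exact hC.mem_below_iff.mpr (hC.mem_anc_iff.mp this)
    · refine (hC.finite_cluster hT.deg (root M h I v)).subset fun w hw => ?_
      obtain ⟨j, hj⟩ := hC.mem_below_iff.mp hw
      show root M h I w = _
      rw [← hC.root_iterate j w, hj]
      exact (hC.best_spec hT hs hb h0 hpure (hC.par_root v)).2.1.1
  have h5 : {w | root M h I w = root M h I v}.ncard ≤
      (hfin.toFinset.filter fun w => root M h I w = root M h I v).card := by
    rw [← Set.ncard_coe_finset]
    refine Set.ncard_le_ncard (fun w hw => ?_) (Finset.finite_toSet _)
    have hw' : root M h I w = root M h I v := hw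
    refine Finset.mem_coe.mpr (Finset.mem_filter.mpr ⟨hfin.mem_toFinset.mpr ?_, hw'⟩)
    exact (hC.of_not_ends (x := w) (by rw [hw']; exact hvk.2)).1
  calc _ ≤ _ := Nat.mul_le_mul_left _ h4
    _ ≤ _ := h3
    _ ≤ _ := h5

/-- The only edge that a kept node may lose without getting an outgoing edge is the one from the
selected node of its cluster to its parent. -/
theorem eq_of_out_eq (hv : v ∈ (plan M h I).kept) (hw : w ∉ (plan M h I).kept)
    (ho : (plan M h I).out I (32 * h) w = some v) :
    v = sInf (best M h I (root M h I v)) ∧ w = par M h I v := by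
  obtain ⟨hpre, hend⟩ := hC.mem_kept_iff.mp hv
  obtain ⟨hpure, hanc⟩ := hC.mem_pre_iff.mp hpre
  obtain ⟨-, ⟨wt, wn, rfl⟩ | ⟨-, -, -, hpar, -⟩ | ⟨-, -, hne, rfl⟩⟩ :=
    (hC.valid hT hs hb h0).out_cases ho
  · exfalso
    have hx : w ∈ ends M h I (root M h I w) ∧ (plan M h I).esc w ∈ exits M h I w := by
      rcases hC.mem_term_iff.mp wt with ⟨he, hze⟩ | ⟨he, hze⟩
      · have := Nat.sInf_mem he
        rw [← hze] at this
        exact ⟨this, Nat.sInf_mem (this.2.2.resolve_left (not_not_intro wn))⟩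
      · refine absurd (hC.mem_kept_iff.mpr ⟨hC.mem_pre_iff.mpr ⟨hC.pure_of_not_ends he, ?_⟩, he⟩) hw
        rw [← hze]
        exact ⟨0, Nat.zero_le _, rfl⟩
    rcases hx.2.2.2.2.2 with h1 | h1
    · rw [h1] at hend
      exact hend ⟨w, hx.1⟩
    · exact h1.2 hpre
  · have hpar' : par M h I v = w := hpar
    refine ⟨?_, hpar'.symm⟩
    obtain ⟨j, hj, hjv⟩ := hanc
    cases j with
    | zero => exact hjv
    | succ j =>
      refine absurd (hC.mem_kept_iff.mpr ⟨hC.mem_pre_iff.mpr ?_, ?_⟩) hw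
      · rw [← hpar', hC.root_par]
        exact ⟨hpure, j, by omega, hjv⟩
      · rw [← hpar', hC.root_par]
        exact hend
  · refine absurd (hC.mem_kept_iff.mpr ⟨hC.mem_pre_iff.mpr ?_, ?_⟩) hw
    · have hr : root M h I w = root M h I ((plan M h I).par w) := (hC.root_par w).symm
      rw [hr]
      obtain ⟨j, hj⟩ := hC.mem_anc_iff.mp hanc
      exact ⟨hpure, hC.mem_anc_iff.mpr ⟨j + 1, hj⟩⟩
    · have hr : root M h I w = root M h I ((plan M h I).par w) := (hC.root_par w).symm
      rw [hr]
      exact hend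

/-- The stage preserves thinness; the selected nodes lose an edge, and they are far apart. -/
theorem thin_next (hsi : s i ≤ 16 * h) : Thin s (i + 1)
    (fun j => if j < i then Z j else
      {u | u ∈ (plan M h I).kept ∧ u = sInf (best M h I (root M h I u))})
    ((plan M h I).next I (32 * h)) where
  deg v := (Set.encard_le_encard fun _ hw => hw.1).trans (hT.deg v)
  sep := by
    intro j hj x hx y hy hne hw
    have hle : ((plan M h I).next I (32 * h)).gr ≤ I.gr := fun _ _ h => h.1
    have hw' := hw.mono_graph hle
    by_cases hji : j < i
    · simp only [if_pos hji] at hx hy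
      exact hT.sep j hji x hx y hy hne hw'
    · simp only [if_neg hji] at hx hy
      obtain rfl : j = i := by omega
      have key : ∀ z, (z ∈ (plan M h I).kept ∧ z = sInf (best M h I (root M h I z))) →
          Within I.gr (8 * h) z (root M h I z) := by
        rintro z ⟨hz, hzb⟩
        have hp := hC.pure_of_not_ends (hC.mem_kept_iff.mp hz).2
        have := (hC.best_spec hT hs hb h0 hp (hC.par_root z)).2.1.2.2.1
        rw [← hzb] at this
        exact (hC.within_root z).mono this
      -- two selected nodes at distance at most `16 * h` would have centers at distance `32 * h`
      have hab := ((key x hx).symm.trans (hw'.mono hsi)).trans (key y hy)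
      have := hC.sep _ (hC.root_mem x) _ (hC.root_mem y) (hab.mono (by omega))
      exact hne (hx.2.trans ((congrArg (fun a => sInf (best M h I a)) this).trans hy.2.symm))
  needy := by
    rintro v ⟨hvk, hv⟩
    have hvn := hC.kept_subset hvk
    by_cases hall : ∀ w, I.gr.Adj v w → w ∈ (plan M h I).kept
    · have heq : ((plan M h I).next I (32 * h)).gr.neighborSet v = I.gr.neighborSet v := by
        ext w
        exact ⟨fun h => h.1, fun h => ⟨h, hvk, hall w h⟩⟩
      rw [heq]
      refine (hT.needy v hvn).imp id fun ⟨h1, j, hj, hz⟩ => ⟨h1, j, by omega, ?_⟩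
      simp only [if_pos hj]
      exact hz
    · -- a needy node that loses an edge is the selected node, and it loses only this edge
      push Not at hall
      obtain ⟨w, hvw, hwk⟩ := hall
      have key : ∀ w, I.gr.Adj v w → w ∉ (plan M h I).kept →
          v = sInf (best M h I (root M h I v)) ∧ w = par M h I v := fun w hvw hwk =>
        hC.eq_of_out_eq hT hs hb h0 hvk hwk (hv w (Within.of_adj hvw) hvw hwk)
      obtain ⟨hb', hw'⟩ := key w hvw hwk
      have heq : ((plan M h I).next I (32 * h)).gr.neighborSet v = I.gr.neighborSet v \ {w} := by
        ext x
        constructor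
        · exact fun h => ⟨h.1, fun hx => hwk (hx ▸ h.2.2)⟩
        · rintro ⟨hvx, hxw⟩
          refine ⟨hvx, hvk, ?_⟩
          by_contra hxk
          exact hxw ((key x hvx hxk).2.trans hw'.symm)
      have hp := hC.pure_of_not_ends (hC.mem_kept_iff.mp hvk).2
      have h3 := (hC.best_spec hT hs hb h0 hp (hC.par_root v)).2.1.2.2.2
      rw [← hb'] at h3
      right
      constructor
      · rw [heq, Set.encard_sdiff_singleton_of_mem (show w ∈ I.gr.neighborSet v from hvw), h3]
        rfl
      · refine ⟨i, Nat.lt_succ_self i, ?_⟩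
        simp only [lt_irrefl, if_false]
        exact ⟨hvk, hb'⟩

end Centers

end Selection

end Level

/-! ### The stage that completes the orientation -/

namespace Finish

/-- The smallest identifier at distance at most `R`. -/
noncomputable def low (R : ℕ) (I : Inst) (v : ℕ) : ℕ :=
  sInf {x | Within I.gr R v x}

/-- The distance to the smallest identifier at distance at most `R`. -/
noncomputable def gap (R : ℕ) (I : Inst) (v : ℕ) : ℕ :=
  sInf {k | k ≤ R ∧ Within I.gr k v (low R I v)}

/-- The neighbors that see a smaller identifier than `v`, or the same one at a smaller distance. -/
def lower (R : ℕ) (I : Inst) (v : ℕ) : Set ℕ :=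
  {w | Within I.gr 1 v w ∧ (I.gr.Adj v w ∧
    (low R I w < low R I v ∨ (low R I w = low R I v ∧ gap R I w < gap R I v)))}

open Classical in
/-- The parent of a node: a neighbor closer to the smallest identifier in sight. -/
noncomputable def par (R : ℕ) (I : Inst) (v : ℕ) : ℕ :=
  if (lower R I v).Nonempty then sInf (lower R I v) else v

/-- The edges at `x` that do not belong to the forest. -/
def loose (R : ℕ) (I : Inst) (x : ℕ) : Set ℕ :=
  {y | Within I.gr 1 x y ∧ (I.gr.Adj x y ∧ par R I y ≠ x ∧ par R I x ≠ y)}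

/-- The nodes at which a path from the root `a` may end: nodes that need no outgoing edge, or have
an edge outside the forest. -/
def ends (r R : ℕ) (I : Inst) (a : ℕ) : Set ℕ :=
  {x | Within I.gr r a x ∧
    ((x ∉ I.needy ∨ (loose R I x).Nonempty) ∧ a ∈ {y | ∃ j ≤ r, (par R I)^[j] x = y})}

/-- The plan of the stage: every root reverses the path to one of the ends in its tree. -/
noncomputable def plan (r : ℕ) (I : Inst) : Plan where
  par := par (2 * r + 1) I
  term := {x | ∃ a, Within I.gr r x a ∧ (par (2 * r + 1) I a = a ∧ x ∈ ends r (2 * r + 1) I a ∧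
    x = sInf (ends r (2 * r + 1) I a))}
  esc x := sInf (loose (2 * r + 1) I x)
  kept := ∅

section Locality

variable {r R : ℕ}

theorem low_loc : Loc R (fun I v => low R I v) := by
  intro I J v hv
  simp only [low]
  congr 1
  ext x
  exact hv.within_iff (Nat.le_succ R)

theorem gap_loc : Loc R (fun I v => gap R I v) := by
  intro I J v hv
  have e : low R I v = low R J v := low_loc I J v hv
  simp only [gap]
  rw [e]
  congr 1
  ext k
  exact and_congr_right fun hk => hv.within_iff (by omega)

theorem lower_loc : Loc (R + 1) (fun I v => lower R I v) :=
  ((Loc.adj.mono (Nat.zero_le R)).prod (low_loc.prod gap_loc)).setOf 1 fun _ w q q' =>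
    q.1 w ∧ (q'.2.1 < q.2.1 ∨ (q'.2.1 = q.2.1 ∧ q'.2.2 < q.2.2))

theorem par_loc : Loc (R + 1) (fun I v => par R I v) := by
  classical
  intro I J v hv
  have := (lower_loc (R := R)).map (fun v S => if S.Nonempty then sInf S else v) I J v hv
  simp only [par]
  convert this

theorem par_within (I : Inst) (v : ℕ) : Within I.gr 1 v (par R I v) := by
  rw [par]
  split_ifs with h
  · exact (Nat.sInf_mem h).1
  · exact Within.refl _ _ _

theorem loose_loc : Loc (R + 2) (fun I v => loose R I v) :=
  ((Loc.adj.mono (Nat.zero_le (R + 1))).prod par_loc).setOf 1 fun x y q q' =>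
    q.1 y ∧ q'.2 ≠ x ∧ q.2 ≠ y

theorem ends_loc : Loc (R + 2 * r + 2) (fun I v => ends r R I v) := by
  have h1 : Loc (R + r + 2) (fun I v => v ∈ I.needy) := Loc.needy.mono (by omega)
  have h2 : Loc (R + r + 2) (fun I v => loose R I v) := loose_loc.mono (by omega)
  have h3 : Loc (R + r + 2) (fun I v => {y | ∃ j ≤ r, (par R I)^[j] v = y}) :=
    (par_loc.orbit par_within r).mono (by omega)
  exact ((h1.prod (h2.prod h3)).setOf r fun a _ _ q' =>
    (¬ q'.1 ∨ q'.2.1.Nonempty) ∧ a ∈ q'.2.2).mono (by omega)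

theorem isLocal (r : ℕ) : (Plan.stage (plan r) r).IsLocal (7 * r + 5) := by
  have h1 : Loc (2 * r + 1 + 2 * r + 2) (fun I v => par (2 * r + 1) I v) :=
    par_loc.mono (by omega)
  have h2 := ((h1.prod (ends_loc (r := r) (R := 2 * r + 1))).exists r fun x a _ q' =>
    q'.1 = a ∧ x ∈ q'.2 ∧ x = sInf q'.2)
  have h3 := (loose_loc (R := 2 * r + 1)).map fun _ S => sInf S
  have := Plan.stage_isLocal (P := plan r) (J := r) (r := 5 * r + 3) (par_loc.mono (by omega))
    par_within (h2.mono (by omega)) (h3.mono (by omega)) (Loc.const fun _ => False)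
  have e : 5 * r + 3 + 2 * r + 2 = 7 * r + 5 := by omega
  rwa [e] at this

end Locality

section Correctness

variable {r R : ℕ} {I : Inst}

theorem within_low (R : ℕ) (I : Inst) (v : ℕ) : Within I.gr R v (low R I v) :=
  Nat.sInf_mem (s := {x | Within I.gr R v x}) ⟨v, Within.refl _ _ _⟩

theorem low_le {v x : ℕ} (h : Within I.gr R v x) : low R I v ≤ x :=
  Nat.sInf_le h

theorem gap_spec (R : ℕ) (I : Inst) (v : ℕ) :
    gap R I v ≤ R ∧ Within I.gr (gap R I v) v (low R I v) :=
  Nat.sInf_mem (s := {k | k ≤ R ∧ Within I.gr k v (low R I v)}) ⟨R, le_rfl, within_low R I v⟩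

theorem lower_nonempty {v : ℕ} (h : low R I v ≠ v) : (lower R I v).Nonempty := by
  obtain ⟨hle, hw⟩ := gap_spec R I v
  cases hg : gap R I v with
  | zero =>
    rw [hg, within_zero_iff] at hw
    exact absurd hw.symm h
  | succ k =>
    rw [hg] at hw
    rcases within_succ_iff.mp hw with e | ⟨w, hvw, hk⟩
    · exact absurd e.symm h
    · have hlow : low R I w ≤ low R I v := low_le (hk.mono (by omega))
      refine ⟨w, Within.of_adj hvw, hvw, ?_⟩
      rcases hlow.lt_or_eq with hlt | heq
      · exact Or.inl hlt
      · right
        refine ⟨heq, ?_⟩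
        have : gap R I w ≤ k := Nat.sInf_le ⟨by omega, by rw [heq]; exact hk⟩
        omega

theorem par_cases (R : ℕ) (I : Inst) (v : ℕ) :
    (par R I v = v ∧ low R I v = v) ∨ (par R I v ∈ lower R I v) := by
  rw [par]
  split_ifs with h
  · exact Or.inr (Nat.sInf_mem h)
  · left
    refine ⟨rfl, ?_⟩
    by_contra hne
    exact h (lower_nonempty hne)

theorem par_adj (R : ℕ) (I : Inst) (v : ℕ) : par R I v = v ∨ I.gr.Adj v (par R I v) := by
  rcases par_cases R I v with h | h
  · exact Or.inl h.1
  · exact Or.inr h.2.1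

theorem low_of_par_eq {v : ℕ} (h : par R I v = v) : low R I v = v := by
  rcases par_cases R I v with h' | h'
  · exact h'.2
  · rw [h] at h'
    exact absurd rfl h'.2.1.ne

/-- A rank that decreases towards the roots: the lexicographic order of `low` and `gap`. -/
noncomputable def rank (R : ℕ) (I : Inst) (v : ℕ) : ℕ :=
  low R I v * (R + 1) + gap R I v

theorem rank_par_lt {v : ℕ} (h : par R I v ≠ v) : rank R I (par R I v) < rank R I v := by
  rw [rank, rank]
  rcases par_cases R I v with h' | h'
  · exact absurd h'.1 h
  · have h1 := (gap_spec R I (par R I v)).1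
    rcases h'.2.2 with hlt | ⟨heq, hlt⟩
    · nlinarith
    · rw [heq]; omega

/-- In a thin instance that is too small for a deep tree, every root finds an end, and two roots
never choose the same edge, because they are too far apart. -/
theorem valid {s : ℕ → ℕ} {i : ℕ} {Z : ℕ → Set ℕ} (h : Thin s i Z I) (hs : ∀ j < i, 0 < s j)
    (hfin : I.needy.Finite)
    (hr : I.needy.ncard * 2 ^ ∑ j ∈ Finset.range i, (r / s j + 1) < 2 ^ r) :
    (plan r I).Valid I r where
  par := par_adj _ I
  rank := ⟨rank (2 * r + 1) I, fun _ => rank_par_lt⟩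
  esc := by
    rintro x ⟨a, -, -, hx, -⟩ - hn
    have := Nat.sInf_mem (hx.2.1.resolve_left (not_not_intro hn))
    exact this.2
  conflict := by
    rintro x ⟨a, hxa, ha, hx, hxe⟩ - hn ⟨b, hyb, hb, -, hye⟩ - - -
    have hxy := Nat.sInf_mem (hx.2.1.resolve_left (not_not_intro hn))
    -- two roots whose ends share an edge see each other, and each of them has the smallest
    -- identifier
    have hab : Within I.gr (2 * r + 1) a b :=
      ((hxa.symm.trans (Within.of_adj hxy.2.1)).trans hyb).mono (by omega)
    have h1 := low_le hab
    have h2 := low_le hab.symm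
    rw [low_of_par_eq ha] at h1
    rw [low_of_par_eq hb] at h2
    obtain rfl := le_antisymm h1 h2
    exact hxy.2.1.ne (hxe.trans hye.symm)
  root := by
    intro v hv _ hpar
    have hne : (ends r (2 * r + 1) I v).Nonempty := by
      by_contra hemp
      -- without an end, the tree of the root is complete down to depth `r`, and hence too large
      have hall : ∀ k ≤ r, ∀ w ∈ layer I.gr (par (2 * r + 1) I) v k, w ∈ I.needy ∧
          ∀ y, I.gr.Adj w y → par (2 * r + 1) I y = w ∨ par (2 * r + 1) I w = y := by
        intro k hk w hw
        have hit := iterate_of_mem_layer hw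
        have hwit := within_iterate (par_adj (2 * r + 1) I) k w
        rw [hit] at hwit
        by_contra hcon
        refine hemp ⟨w, (hwit.mono hk).symm, ?_, k, hk, hit⟩
        by_cases hwn : w ∈ I.needy
        · right
          by_contra hl
          refine hcon ⟨hwn, fun y hy => ?_⟩
          by_contra hy'
          push Not at hy'
          exact hl ⟨y, Within.of_adj hy, hy, hy'.1, hy'.2⟩
        · exact Or.inl hwn
      have hgrow := h.pow_le_card_layer (p := par (2 * r + 1) I) (a := v) (r := r)
        (rk := rank (2 * r + 1) I) (fun _ => rank_par_lt) hs
        fun k hk => hall k hk.le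
      have hcard : (layer I.gr (par (2 * r + 1) I) v r).card ≤ I.needy.ncard := by
        rw [← Set.ncard_coe_finset]
        exact Set.ncard_le_ncard (fun w hw => (hall r le_rfl w hw).1) hfin
      have := Nat.mul_le_mul_right (2 ^ ∑ j ∈ Finset.range i, (r / s j + 1)) hcard
      omega
    have hx := Nat.sInf_mem hne
    obtain ⟨-, -, j, hj, hjv⟩ := id hx
    exact ⟨_, hx.1, ⟨v, hx.1.symm, hpar, hx, rfl⟩, j, hj, hjv⟩

theorem next_needy (r : ℕ) (I : Inst) : ((Plan.stage (plan r) r).next I).needy = ∅ :=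
  Set.eq_empty_of_forall_notMem fun _ hv => hv.1

theorem next_not_adj (r : ℕ) (I : Inst) (v w : ℕ) :
    ¬ ((Plan.stage (plan r) r).next I).gr.Adj v w :=
  fun h => h.2.1

end Correctness

end Finish

/-! ### The stage that bounds the degrees -/

namespace Pick

open Classical in
/-- Three elements of a set with at least three elements; no elements of a smaller set. -/
noncomputable def three (S : Set ℕ) : Set ℕ :=
  if h : (3 : ℕ∞) ≤ S.encard then (Set.exists_subset_encard_eq h).choose else ∅

theorem three_subset (S : Set ℕ) : three S ⊆ S := by
  rw [three]
  split_ifs with h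
  · exact (Set.exists_subset_encard_eq h).choose_spec.1
  · exact Set.empty_subset S

theorem encard_three_le (S : Set ℕ) : (three S).encard ≤ 3 := by
  rw [three]
  split_ifs with h
  · exact (Set.exists_subset_encard_eq h).choose_spec.2.le
  · simp

theorem encard_three {S : Set ℕ} (h : 3 ≤ S.encard) : (three S).encard = 3 := by
  rw [three, dif_pos h]
  exact (Set.exists_subset_encard_eq h).choose_spec.2

/-- Every node picks three neighbors. An edge that is picked by only one of its ends is directed
away from this end, and the edges that are picked by both ends remain. -/
noncomputable def stage : Stage where
  next I :=
    { gr :=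
        { Adj := fun v w => w ∈ three (I.gr.neighborSet v) ∧ v ∈ three (I.gr.neighborSet w)
          symm := ⟨fun _ _ h => ⟨h.2, h.1⟩⟩
          loopless := ⟨fun v h => I.gr.loopless.irrefl v (three_subset _ h.1)⟩ }
      needy := {v | v ∈ I.needy ∧ ∀ w, Within I.gr 1 v w → w ∈ three (I.gr.neighborSet v) →
        v ∈ three (I.gr.neighborSet w)} }
  dir I v w := w ∈ three (I.gr.neighborSet v) ∨ (v ∉ three (I.gr.neighborSet w) ∧ v < w)

theorem correct (I : Inst) : stage.Correct I where
  le := fun _ _ h => three_subset _ h.1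
  dir_iff := by
    intro v w hvw hnot
    have hne := hvw.ne
    have hnot' : ¬ (w ∈ three (I.gr.neighborSet v) ∧ v ∈ three (I.gr.neighborSet w)) := hnot
    simp only [stage]
    by_cases hv : w ∈ three (I.gr.neighborSet v) <;>
      by_cases hw : v ∈ three (I.gr.neighborSet w) <;> simp_all
    omega
  out := by
    intro v hv
    by_cases hall : ∀ w, Within I.gr 1 v w → w ∈ three (I.gr.neighborSet v) →
        v ∈ three (I.gr.neighborSet w)
    · exact Or.inl ⟨hv, hall⟩
    · push Not at hall
      obtain ⟨w, -, hw, hvw⟩ := hall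
      exact Or.inr ⟨w, three_subset _ hw, fun h => hvw h.2, Or.inl hw⟩

theorem isLocal : stage.IsLocal 1 := by
  have ht : Loc 0 fun I v => three (I.gr.neighborSet v) :=
    Loc.adj.map fun _ A => three {w | A w}
  have h1 := ht.setOf 1 fun v w q q' => w ∈ q ∧ v ∈ q'
  refine ⟨fun I v w h => three_subset _ h.1, ?_, ?_, ?_⟩
  · intro I J v hv
    have := Set.ext_iff.mp (h1 I J v hv)
    ext w
    have hw := this w
    simp only [Set.mem_ofPred_eq] at hw
    constructor
    · intro hvw
      exact (hw.mp ⟨Within.of_adj (three_subset _ hvw.1), hvw⟩).2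
    · intro hvw
      exact (hw.mpr ⟨Within.of_adj (three_subset _ hvw.1), hvw⟩).2
  · have h2 := ((Loc.needy.mono (Nat.zero_le 1)).prod
      (ht.setOf 1 fun v w q q' => ¬ (w ∈ q → v ∈ q'))).map fun _ q => q.1 ∧ q.2 = ∅
    intro I J v hv
    have := h2 I J v hv
    simp only [Set.eq_empty_iff_forall_notMem, Set.mem_ofPred_eq, not_and, not_not] at this
    exact this
  · have h2 := (ht.prod (Loc.adj.mono (Nat.zero_le 0))).setOf 1 fun v w q q' =>
      q.2 w ∧ (w ∈ q.1 ∨ (v ∉ q'.1 ∧ v < w))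
    intro I J v hv
    have := Set.ext_iff.mp (h2 I J v hv)
    ext w
    have hw := this w
    simp only [Set.mem_ofPred_eq] at hw
    constructor
    · intro hvw
      exact (hw.mp ⟨Within.of_adj hvw.1, hvw⟩).2
    · intro hvw
      exact (hw.mpr ⟨Within.of_adj hvw.1, hvw⟩).2

theorem thin_next {I : Inst} (h : ∀ v ∈ I.needy, 3 ≤ (I.gr.neighborSet v).encard) (s : ℕ → ℕ)
    (Z : ℕ → Set ℕ) : Thin s 0 Z (stage.next I) where
  deg v := (Set.encard_le_encard fun _ hw => hw.1).trans (encard_three_le (I.gr.neighborSet v))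
  sep j hj := absurd hj (Nat.not_lt_zero j)
  needy := by
    rintro v ⟨hv, hall⟩
    left
    have : (stage.next I).gr.neighborSet v = three (I.gr.neighborSet v) := by
      ext w
      exact ⟨fun hw => hw.1, fun hw => ⟨hw, hall w (Within.of_adj (three_subset _ hw)) hw⟩⟩
    rw [this]
    exact encard_three (h v hv)

end Pick

/-! ### Sequences of stages -/

section Sequence

/-- The instance that remains after the first `k` stages. -/
def inst (St : ℕ → Stage) (I : Inst) : ℕ → Inst
  | 0 => I
  | k + 1 => (St k).next (inst St I k)

/-- The orientation that is put together from the orientations of the first `K` stages. -/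
def total (St : ℕ → Stage) (K : ℕ) (I : Inst) (v w : ℕ) : Prop :=
  ∃ k < K, (inst St I k).gr.Adj v w ∧ ¬ (inst St I (k + 1)).gr.Adj v w ∧
    (St k).dir (inst St I k) v w

variable {St : ℕ → Stage} {ρ : ℕ → ℕ} {I J : Inst} {K k v w : ℕ}

theorem inst_antitone (hle : ∀ k I, ((St k).next I).gr ≤ I.gr) {i j : ℕ} (hij : i ≤ j) :
    (inst St I j).gr ≤ (inst St I i).gr := by
  induction j, hij using Nat.le_induction with
  | base => exact le_rfl
  | succ j _ ih => exact (hle j _).trans ih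

theorem inst_loc (hloc : ∀ k, (St k).IsLocal (ρ k)) (k : ℕ) :
    Loc (∑ j ∈ Finset.range k, ρ j) (fun I v => (inst St I k).gr.Adj v) ∧
    Loc (∑ j ∈ Finset.range k, ρ j) (fun I v => v ∈ (inst St I k).needy) := by
  induction k with
  | zero => exact ⟨Loc.adj, Loc.needy⟩
  | succ k ih =>
    have hle : ∀ I, (inst St I k).gr ≤ I.gr := fun I =>
      inst_antitone (fun k I => (hloc k).le I) (Nat.zero_le k)
    rw [Finset.sum_range_succ]
    exact ⟨Loc.comp (S := fun I => inst St I k) hle ih.1 ih.2 (hloc k).adj,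
      Loc.comp (S := fun I => inst St I k) hle ih.1 ih.2 (hloc k).needy⟩

theorem dir_loc (hloc : ∀ k, (St k).IsLocal (ρ k)) (k : ℕ) :
    Loc (∑ j ∈ Finset.range (k + 1), ρ j) (fun I v =>
      {w | (inst St I k).gr.Adj v w ∧ (St k).dir (inst St I k) v w}) := by
  have hle : ∀ I, (inst St I k).gr ≤ I.gr := fun I =>
    inst_antitone (fun k I => (hloc k).le I) (Nat.zero_le k)
  rw [Finset.sum_range_succ]
  exact Loc.comp (S := fun I => inst St I k) hle (inst_loc hloc k).1 (inst_loc hloc k).2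
    (hloc k).dir

theorem total_of_agree (hloc : ∀ k, (St k).IsLocal (ρ k))
    (h : Agree I J v (∑ j ∈ Finset.range k, ρ j)) (hiso : ∀ w, ¬ (inst St I k).gr.Adj v w)
    (ht : total St K I v w) : total St K J v w := by
  obtain ⟨j, hj, h1, h2, h3⟩ := ht
  have hjk : j < k := by
    by_contra hkj
    exact hiso w (inst_antitone (fun k I => (hloc k).le I) (not_lt.mp hkj) h1)
  have hm : ∀ i ≤ k, ∑ j ∈ Finset.range i, ρ j ≤ ∑ j ∈ Finset.range k, ρ j := fun i hi =>
    Finset.sum_le_sum_of_subset (Finset.range_mono hi)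
  have e2 : (inst St I (j + 1)).gr.Adj v w = (inst St J (j + 1)).gr.Adj v w :=
    congrFun ((inst_loc hloc (j + 1)).1 I J v (h.mono (hm _ hjk))) w
  have e3 := Set.ext_iff.mp (dir_loc hloc j I J v (h.mono (hm _ hjk))) w
  have h4 := e3.mp ⟨h1, h3⟩
  refine ⟨j, hj, h4.1, fun hn => h2 ?_, h4.2⟩
  rw [e2]
  exact hn

/-- The orientation at a node is determined once all its edges have been oriented. -/
theorem total_iff_of_agree (hloc : ∀ k, (St k).IsLocal (ρ k))
    (h : Agree I J v (∑ j ∈ Finset.range k, ρ j)) (hiso : ∀ w, ¬ (inst St I k).gr.Adj v w) :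
    total St K I v w ↔ total St K J v w := by
  refine ⟨total_of_agree hloc h hiso, total_of_agree hloc h.symm fun w hw => hiso w ?_⟩
  have e : (inst St I k).gr.Adj v w = (inst St J k).gr.Adj v w :=
    congrFun ((inst_loc hloc k).1 I J v h) w
  rw [e]
  exact hw

section Correct

variable (hc : ∀ k < K, (St k).Correct (inst St I k))

include hc

theorem inst_le {i j : ℕ} (hij : i ≤ j) (hj : j ≤ K) : (inst St I j).gr ≤ (inst St I i).gr := by
  induction j, hij using Nat.le_induction with
  | base => exact le_rfl
  | succ j _ ih => exact ((hc j (by omega)).le).trans (ih (by omega))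

theorem adj_of_total (h : total St K I v w) : I.gr.Adj v w := by
  obtain ⟨k, hk, h1, -⟩ := h
  exact inst_le hc (Nat.zero_le k) hk.le h1

theorem total_asymm (h : total St K I v w) : ¬ total St K I w v := by
  rintro ⟨k', hk', h1', h2', h3'⟩
  obtain ⟨k, hk, h1, h2, h3⟩ := h
  obtain rfl : k = k' := by
    by_contra hne
    rcases lt_or_gt_of_ne hne with hlt | hlt
    · exact h2 (inst_le hc (Nat.succ_le_of_lt hlt) hk'.le h1').symm
    · exact h2' (inst_le hc (Nat.succ_le_of_lt hlt) hk.le h1).symm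
  exact ((hc k hk).dir_iff v w h1 h2).mp h3 h3'

omit hc in
theorem exists_last {p : ℕ → Prop} (h0 : p 0) (hK : ¬ p K) : ∃ k < K, p k ∧ ¬ p (k + 1) := by
  by_contra hcon
  push Not at hcon
  have : ∀ k ≤ K, p k := by
    intro k
    induction k with
    | zero => exact fun _ => h0
    | succ k ih => exact fun hk => hcon k (by omega) (ih (by omega))
  exact hK (this K le_rfl)

theorem total_or_total (hend : ∀ v w, ¬ (inst St I K).gr.Adj v w) (h : I.gr.Adj v w) :
    total St K I v w ∨ total St K I w v := by
  obtain ⟨k, hk, h1, h2⟩ := exists_last (p := fun k => (inst St I k).gr.Adj v w) h (hend v w)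
  by_cases hd : (St k).dir (inst St I k) v w
  · exact Or.inl ⟨k, hk, h1, h2, hd⟩
  · refine Or.inr ⟨k, hk, h1.symm, fun h => h2 h.symm, ?_⟩
    by_contra hd'
    exact hd (((hc k hk).dir_iff v w h1 h2).mpr hd')

theorem exists_total (hend : (inst St I K).needy = ∅) (h : v ∈ I.needy) :
    ∃ w, total St K I v w := by
  obtain ⟨k, hk, h1, h2⟩ := exists_last (p := fun k => v ∈ (inst St I k).needy) h
    (by rw [hend]; exact Set.notMem_empty v)
  obtain ⟨w, h3, h4, h5⟩ := ((hc k hk).out v h1).resolve_left h2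
  exact ⟨w, k, hk, h3, h4, h5⟩

end Correct

end Sequence

open Classical in
/-- The finite set with the same elements as `S`, or the empty set if `S` is infinite. -/
noncomputable def finsetOf (S : Set ℕ) : Finset ℕ :=
  if h : S.Finite then h.toFinset else ∅

theorem mem_finsetOf {S : Set ℕ} (h : S.Finite) {w : ℕ} : w ∈ finsetOf S ↔ w ∈ S := by
  rw [finsetOf, dif_pos h, Set.Finite.mem_toFinset]

/-- The out-neighbors of `v` in the orientation computed by the first `K` stages on the graph `G`.
-/
noncomputable def stageOutput (St : ℕ → Stage) (K : ℕ) (G : SimpleGraph ℕ) (v : ℕ) : Finset ℕ :=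
  finsetOf {w | total St K ⟨G, G.support⟩ v w}

theorem stageOutput_determined {St : ℕ → Stage} {ρ : ℕ → ℕ} {K k v : ℕ} {G : SimpleGraph ℕ}
    (hloc : ∀ k, (St k).IsLocal (ρ k))
    (hiso : ∀ w, ¬ (inst St ⟨G, G.support⟩ k).gr.Adj v w) :
    Determined (stageOutput St K) G v (∑ j ∈ Finset.range k, ρ j) := by
  intro H hH
  have hag : Agree ⟨G, G.support⟩ ⟨H, H.support⟩ v (∑ j ∈ Finset.range k, ρ j) := by
    intro x hx
    have h1 : G.Adj x = H.Adj x := (hH x hx).1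
    refine ⟨h1, ?_⟩
    simp only [SimpleGraph.mem_support, h1]
  have hset : {w | total St K ⟨H, H.support⟩ v w} = {w | total St K ⟨G, G.support⟩ v w} := by
    ext w
    exact (total_iff_of_agree hloc hag hiso).symm
  exact congrArg finsetOf hset

/-! ### The iterated logarithm and the number of colors -/

theorem exists_iterate_logb_le_one (m : ℕ) (x : ℝ) (hx : x ≤ m + 1) :
    ∃ k, (Real.logb 2)^[k] x ≤ 1 := by
  induction m generalizing x with
  | zero => exact ⟨0, by simpa using hx⟩
  | succ m ih =>
    by_cases h1 : x ≤ 1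
    · exact ⟨0, h1⟩
    · push Not at h1
      have h2 : Real.logb 2 x ≤ m + 1 := by
        rw [Real.logb_le_iff_le_rpow (by norm_num) (by linarith)]
        have h3 : m + 2 ≤ 2 ^ (m + 1) := Nat.lt_two_pow_self (n := m + 1)
        have h4 : ((m + 2 : ℕ) : ℝ) ≤ ((2 ^ (m + 1) : ℕ) : ℝ) := Nat.cast_le.mpr h3
        push_cast at h4 hx
        have h5 : (2 : ℝ) ^ ((m : ℝ) + 1) = 2 ^ (m + 1) := by
          exact_mod_cast Real.rpow_natCast 2 (m + 1)
        rw [h5]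
        linarith
      obtain ⟨k, hk⟩ := ih _ h2
      exact ⟨k + 1, hk⟩

theorem iterate_logStar_le (n : ℕ) : (Real.logb 2)^[logStar n] (n : ℝ) ≤ 1 :=
  Nat.sInf_mem (s := {k : ℕ | (Real.logb 2)^[k] (n : ℝ) ≤ 1})
    (exists_iterate_logb_le_one n n (by linarith))

theorem one_lt_iterate {n k : ℕ} (h : k < logStar n) : 1 < (Real.logb 2)^[k] (n : ℝ) :=
  not_le.mp (Nat.notMem_of_lt_sInf h)

theorem logStar_pos {n : ℕ} (h : 2 ≤ n) : 0 < logStar n := by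
  by_contra h0
  have h1 := iterate_logStar_le n
  rw [Nat.eq_zero_of_not_pos h0] at h1
  have h2 : (2 : ℝ) ≤ n := by exact_mod_cast h
  simp only [Function.iterate_zero, id] at h1
  linarith

theorem palette_pos {Δ n c : ℕ} (hn : 0 < n) (k : ℕ) : 0 < palette Δ n c k := by
  cases k with
  | zero => exact Nat.pow_pos hn
  | succ k => unfold palette; positivity

/-- The recursion for the logarithm of the number of colors. -/
theorem logb_palette_succ_le {Δ n c : ℕ} (hn : 0 < n) (k : ℕ) {B : ℝ}
    (hB : Real.logb 2 (palette Δ n c k) + 1 ≤ B) :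
    Real.logb 2 (palette Δ n c (k + 1)) ≤ 2 + 2 * Real.logb 2 (Δ + 1) + 2 * Real.logb 2 B := by
  have h0 : (0 : ℝ) ≤ Real.logb 2 (palette Δ n c k) :=
    Real.logb_nonneg (by norm_num) (by exact_mod_cast palette_pos hn k)
  have h1 : ((Nat.log 2 (palette Δ n c k) + 1 : ℕ) : ℝ) ≤ B := by
    have := Real.natLog_le_logb (palette Δ n c k) 2
    push_cast at this ⊢
    linarith
  have hBpos : 0 < B := by linarith
  have hd : (0 : ℝ) < Δ + 1 := by positivity
  have h2 : ((palette Δ n c (k + 1) : ℕ) : ℝ) ≤ (2 * ((Δ + 1) * B)) ^ 2 := by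
    simp only [palette]
    push_cast at h1 ⊢
    gcongr
  have h3 : Real.logb 2 ((2 * (((Δ : ℝ) + 1) * B)) ^ 2) =
      2 + 2 * Real.logb 2 (Δ + 1) + 2 * Real.logb 2 B := by
    rw [Real.logb_pow, Real.logb_mul (by norm_num) (by positivity),
      Real.logb_mul (by positivity) (by positivity), Real.logb_self_eq_one (by norm_num)]
    push_cast
    ring
  rw [← h3]
  exact Real.logb_le_logb_of_le (by norm_num) (by exact_mod_cast palette_pos hn (k + 1)) h2

/-- After `log* n` steps of color reduction, the number of colors is independent of `n`. -/
theorem palette_le {Δ n c : ℕ} (hn : 2 ≤ n) :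
    palette Δ n c (logStar n) ≤ 2 ^ 12 * (Δ + 1) ^ 4 * (c + 3) ^ 4 := by
  have hn0 : 0 < n := by omega
  set X : ℝ := 2 ^ 12 * ((Δ : ℝ) + 1) ^ 4 * ((c : ℝ) + 3) ^ 4 with hX
  set Y : ℝ := Real.logb 2 X with hY
  have hYe : Y = 12 + 4 * Real.logb 2 (Δ + 1) + 4 * Real.logb 2 (c + 3) := by
    rw [hY, hX, Real.logb_mul (by positivity) (by positivity),
      Real.logb_mul (by positivity) (by positivity), Real.logb_pow, Real.logb_pow, Real.logb_pow,
      Real.logb_self_eq_one (by norm_num)]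
    push_cast
    ring
  have hδ : 0 ≤ Real.logb 2 ((Δ : ℝ) + 1) :=
    Real.logb_nonneg (by norm_num) (by have : (0 : ℝ) ≤ Δ := Nat.cast_nonneg _; linarith)
  have hc0 : (0 : ℝ) ≤ c := Nat.cast_nonneg _
  have hγ : 0 ≤ Real.logb 2 ((c : ℝ) + 3) := Real.logb_nonneg (by norm_num) (by linarith)
  have hY12 : 12 ≤ Y := by linarith
  -- `Y` is large enough to be preserved by the recursion
  have hfix : 2 + 2 * Real.logb 2 (Δ + 1) + 2 * Real.logb 2 (c + 3 + Y) ≤ Y := by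
    have h1 : (c + 3 + Y : ℝ) ≤ (c + 3) * (1 + Y) := by nlinarith
    have h2 : (1 + Y : ℝ) ≤ 2 ^ (2 + Y / 4) := by
      have := one_add_mul_self_le_rpow_one_add (s := 1) (by norm_num) (p := Y / 4) (by linarith)
      rw [Real.rpow_add (by norm_num)]
      norm_num at this ⊢
      linarith
    have h3 : Real.logb 2 (1 + Y) ≤ 2 + Y / 4 := by
      rwa [Real.logb_le_iff_le_rpow (by norm_num) (by linarith)]
    have h4 : Real.logb 2 (c + 3 + Y) ≤ Real.logb 2 (c + 3) + Real.logb 2 (1 + Y) := by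
      rw [← Real.logb_mul (by positivity) (by positivity)]
      exact Real.logb_le_logb_of_le (by norm_num) (by positivity) h1
    linarith
  -- up to a constant factor and an additive constant, each step of the reduction takes a logarithm
  have key : ∀ k < logStar n, Real.logb 2 (palette Δ n c k) ≤
      (c + 2) * (Real.logb 2)^[k + 1] (n : ℝ) + Y := by
    intro k
    induction k with
    | zero =>
      intro hk
      have h1 := one_lt_iterate hk
      simp only [Function.iterate_zero, id] at h1
      have h2 : 0 < Real.logb 2 (n : ℝ) := Real.logb_pos (by norm_num) h1
      simp only [palette, zero_add, Function.iterate_one]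
      push_cast
      rw [Real.logb_pow]
      nlinarith
    | succ k ih =>
      intro hk
      have h1 := one_lt_iterate hk
      have h2 := ih (by omega)
      rw [Function.iterate_succ_apply' _ (k + 1)]
      set L := (Real.logb 2)^[k + 1] (n : ℝ)
      have h3 : Real.logb 2 (palette Δ n c k) + 1 ≤ (c + 3 + Y) * L := by nlinarith
      have h4 := logb_palette_succ_le hn0 k h3
      rw [Real.logb_mul (by positivity) (by positivity)] at h4
      have h5 : 0 < Real.logb 2 L := Real.logb_pos (by norm_num) h1
      nlinarith
  obtain ⟨k, hk⟩ : ∃ k, logStar n = k + 1 := ⟨logStar n - 1, by have := logStar_pos hn; omega⟩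
  have h1 := key k (by omega)
  have h2 := iterate_logStar_le n
  rw [hk] at h2 ⊢
  have h3 : Real.logb 2 (palette Δ n c k) + 1 ≤ c + 3 + Y := by nlinarith
  have h4 := (logb_palette_succ_le hn0 k h3).trans hfix
  have h5 : ((palette Δ n c (k + 1) : ℕ) : ℝ) ≤ X :=
    (Real.logb_le_logb (by norm_num) (by exact_mod_cast palette_pos hn0 _) (by positivity)).mp h4
  rw [hX] at h5
  exact_mod_cast h5

/-! ### Parameters -/

/-- The parameter of the level `k`, to which all distances on this level are proportional. The nodes
of degree two that the level creates are more than `16 * height k` apart. As the inverses of the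
squares are summable, paths on later levels contain few of them altogether. -/
def height (k : ℕ) : ℕ := 4 * (k + 1) ^ 2

theorem sum_div_sq_le (q i : ℕ) : ∑ j ∈ Finset.range i, q / (j + 1) ^ 2 ≤ 2 * q := by
  have key : (∑ j ∈ Finset.range i, (q : ℝ) / ((j : ℝ) + 1) ^ 2) ≤ (q : ℝ) * (2 - 1 / (i : ℝ)) := by
    induction i with
    | zero => simp
    | succ i ih =>
      rw [Finset.sum_range_succ]
      have hstep : 1 / ((i : ℝ) + 1) ^ 2 ≤ 1 / i - 1 / (i + 1) ∨ i = 0 := by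
        rcases Nat.eq_zero_or_pos i with h | h
        · exact Or.inr h
        · left
          have hi : (0 : ℝ) < i := by exact_mod_cast h
          rw [div_sub_div _ _ (by positivity) (by positivity),
            div_le_div_iff₀ (by positivity) (by positivity)]
          nlinarith
      rcases hstep with h | rfl
      · have hq : (0 : ℝ) ≤ q := Nat.cast_nonneg q
        have := mul_le_mul_of_nonneg_left h hq
        have e : (q : ℝ) / ((i : ℝ) + 1) ^ 2 = q * (1 / ((i : ℝ) + 1) ^ 2) := by ring
        push_cast
        rw [e]
        nlinarith
      · norm_num
  have h1 : ((∑ j ∈ Finset.range i, q / (j + 1) ^ 2 : ℕ) : ℝ) ≤ ((2 * q : ℕ) : ℝ) := by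
    push_cast
    calc (∑ j ∈ Finset.range i, ((q / (j + 1) ^ 2 : ℕ) : ℝ))
        ≤ ∑ j ∈ Finset.range i, (q : ℝ) / ((j : ℝ) + 1) ^ 2 :=
          Finset.sum_le_sum fun j _ => by
            have := Nat.cast_div_le (α := ℝ) (m := q) (n := (j + 1) ^ 2)
            push_cast at this
            exact this
      _ ≤ q * (2 - 1 / i) := key
      _ ≤ 2 * q := by
          have hq : (0 : ℝ) ≤ q := Nat.cast_nonneg q
          have : (0 : ℝ) ≤ 1 / i := by positivity
          nlinarith
  exact_mod_cast h1

/-- The bound on the number of nodes of degree two on a path of length `a` before the level `i`. -/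
theorem sum_div_height_le (a i : ℕ) :
    ∑ j ∈ Finset.range i, (a / (16 * height j) + 1) ≤ 2 * (a / 64) + i := by
  rw [Finset.sum_add_distrib]
  simp only [Finset.sum_const, Finset.card_range, smul_eq_mul, mul_one]
  refine Nat.add_le_add_right ?_ i
  have : ∀ j, a / (16 * height j) = a / 64 / (j + 1) ^ 2 := fun j => by
    rw [Nat.div_div_eq_div_mul, height]
    congr 1
    ring
  simp only [this]
  exact sum_div_sq_le _ _

theorem level_gaps (i : ℕ) :
    ∑ j ∈ Finset.range i, (8 * height i / (16 * height j) + 1) ≤ height i := by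
  refine (sum_div_height_le _ _).trans ?_
  have h1 : 8 * height i / 64 ≤ height i / 8 := by omega
  have h2 : i + 1 ≤ (i + 1) ^ 2 := Nat.le_self_pow (by norm_num) _
  unfold height at *
  omega

/-- In trees of depth `4 * (log n + 1)`, the nodes of degree two do not prevent the growth beyond
`n` nodes. -/
theorem finish_gaps {n N i : ℕ} (hN : N ≤ n) (hi : i ≤ Nat.log 2 n) :
    N * 2 ^ ∑ j ∈ Finset.range i, (4 * (Nat.log 2 n + 1) / (16 * height j) + 1) <
      2 ^ (4 * (Nat.log 2 n + 1)) := by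
  set Λ := Nat.log 2 n
  have h1 : ∑ j ∈ Finset.range i, (4 * (Λ + 1) / (16 * height j) + 1) ≤ 2 * (Λ + 1) :=
    (sum_div_height_le _ _).trans (by omega)
  have h2 : n < 2 ^ (Λ + 1) := Nat.lt_pow_succ_log_self (by norm_num) n
  calc N * 2 ^ ∑ j ∈ Finset.range i, (4 * (Λ + 1) / (16 * height j) + 1)
      ≤ n * 2 ^ (2 * (Λ + 1)) := Nat.mul_le_mul hN (Nat.pow_le_pow_right (by norm_num) h1)
    _ < 2 ^ (Λ + 1) * 2 ^ (2 * (Λ + 1)) := Nat.mul_lt_mul_of_pos_right h2 (by positivity)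
    _ ≤ 2 ^ (4 * (Λ + 1)) := by
        rw [← pow_add]
        exact Nat.pow_le_pow_right (by norm_num) (by omega)

/-- The nodes that survive the levels below `k` are fewer by a factor `2 ^ shrink k`. -/
def shrink (k : ℕ) : ℕ := 3 * ∑ j ∈ Finset.range k, height j

/-- The number of nodes decreases so quickly that it outweighs the growing cost of the levels. -/
theorem exists_total_weight : ∃ A : ℝ, ∀ I,
    ∑ i ∈ Finset.range I, ((i : ℝ) + 1) * 2 ^ (257 * height i) / 2 ^ shrink i ≤ A := by
  have hs : Summable fun i : ℕ => ((i : ℝ) + 1) * 2 ^ (257 * height i) / 2 ^ shrink i := by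
    refine summable_of_ratio_norm_eventually_le (r := 1 / 2) (by norm_num) ?_
    -- the exponent loses `3 * height i`, which is quadratic, and gains a multiple of the difference
    -- of consecutive heights, which is linear
    filter_upwards [Filter.eventually_ge_atTop 200] with i hi
    rw [Real.norm_of_nonneg (by positivity), Real.norm_of_nonneg (by positivity)]
    have h1 : 257 * height (i + 1) + 2 ≤ 257 * height i + 3 * height i := by
      unfold height
      nlinarith
    have h2 : shrink (i + 1) = shrink i + 3 * height i := by
      rw [shrink, Finset.sum_range_succ, mul_add, ← shrink]
    have h3 : (2 : ℝ) ^ (257 * height (i + 1) + 2) ≤ 2 ^ (257 * height i + 3 * height i) :=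
      pow_le_pow_right₀ (by norm_num) h1
    rw [pow_add, pow_add] at h3
    rw [h2, pow_add, ← mul_div_assoc, div_le_div_iff₀ (by positivity) (by positivity)]
    push_cast
    have h4 : (i : ℝ) + 1 + 1 ≤ 2 * (i + 1) := by
      have : (0 : ℝ) ≤ i := Nat.cast_nonneg i
      linarith
    have h5 : 0 ≤ (2 : ℝ) ^ shrink i := by positivity
    calc ((i : ℝ) + 1 + 1) * 2 ^ (257 * height (i + 1)) * 2 ^ shrink i
        ≤ (2 * (i + 1)) * 2 ^ (257 * height (i + 1)) * 2 ^ shrink i := by gcongr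
      _ = (1 / 2 * (i + 1)) * (2 ^ (257 * height (i + 1)) * 2 ^ 2) * 2 ^ shrink i := by ring
      _ ≤ (1 / 2 * (i + 1)) * (2 ^ (257 * height i) * 2 ^ (3 * height i)) * 2 ^ shrink i := by
          gcongr
      _ = _ := by ring
  exact ⟨_, fun I => hs.sum_le_tsum _ fun i _ => by positivity⟩

/-- The centers of the clusters of the level `k`. -/
noncomputable def centers (c n k : ℕ) (I : Inst) : Set ℕ :=
  greedy (32 * height k) n c (logStar n) I (palette (4 ^ (32 * height k)) n c (logStar n))

/-- The number of rounds that the level `k` takes: the computation of the centers, and the stage. -/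
noncomputable def cost (c n k : ℕ) : ℕ :=
  32 * height k * logStar n + 32 * height k * palette (4 ^ (32 * height k)) n c (logStar n) +
    320 * height k + 5

theorem level_isLocal (c n k : ℕ) : (Plan.stage (Level.plan (centers c n k) (height k))
    (32 * height k)).IsLocal (cost c n k) :=
  Level.isLocal (greedy_loc _ _ _ _ _)

/-- The cost of the level `k` is `O(log* n)` with a factor that is exponential in `height k`. -/
theorem cost_le {c n : ℕ} (hn : 2 ≤ n) (k : ℕ) :
    cost c n k ≤ 2 ^ 23 * (c + 3) ^ 4 * 2 ^ (257 * height k) * logStar n := by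
  set h := height k with hh
  have hX := palette_le (Δ := 4 ^ (32 * h)) (c := c) hn
  have hL := logStar_pos hn
  have h4 : 4 ≤ h := by
    have : 1 ≤ (k + 1) ^ 2 := Nat.one_le_pow _ _ (by omega)
    rw [hh, height]; omega
  have h2h : h ≤ 2 ^ h := Nat.lt_two_pow_self.le
  have e1 : (4 ^ (32 * h) + 1) ^ 4 ≤ 2 ^ 4 * 2 ^ (256 * h) := by
    have : 4 ^ (32 * h) + 1 ≤ 2 * 4 ^ (32 * h) := by
      have : 1 ≤ 4 ^ (32 * h) := Nat.one_le_pow _ _ (by norm_num)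
      omega
    refine (Nat.pow_le_pow_left this 4).trans (le_of_eq ?_)
    rw [mul_pow, ← pow_mul, show (4 : ℕ) = 2 ^ 2 by norm_num, ← pow_mul]
    congr 2
    ring
  set X := palette (4 ^ (32 * h)) n c (logStar n) with hXdef
  set E := 2 ^ (256 * h) with hE
  have hE1 : 1 ≤ E := Nat.one_le_pow _ _ (by norm_num)
  set q := (c + 3) ^ 4 with hq
  have hq1 : 1 ≤ q := Nat.one_le_pow _ _ (by omega)
  have hX' : X ≤ 65536 * (E * q) := by
    have h1 := Nat.mul_le_mul_right q (Nat.mul_le_mul_left (2 ^ 12) e1)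
    have h2 : 4096 * (16 * E) * q = 65536 * (E * q) := by ring
    push_cast at h1 hX
    rw [h2] at h1
    exact hX.trans h1
  have hcost : cost c n k = 32 * h * logStar n + 32 * h * X + 320 * h + 5 := rfl
  have e2 : 2 ^ (257 * h) = E * 2 ^ h := by
    rw [hE, ← pow_add, show 256 * h + h = 257 * h by ring]
  rw [hcost, e2]
  have hEq : 1 ≤ E * q := Nat.mul_pos hE1 hq1
  set L := logStar n
  have a1 : h * 1 ≤ h * L := Nat.mul_le_mul_left h hL
  have a2 : h * L * 1 ≤ h * L * (E * q) := Nat.mul_le_mul_left _ hEq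
  have a3 : 32 * h * X ≤ 32 * h * (65536 * (E * q)) := Nat.mul_le_mul_left _ hX'
  have a4 : h * 1 * (E * q) ≤ h * L * (E * q) := Nat.mul_le_mul_right _ a1
  have a5 : h * (L * (E * q)) ≤ 2 ^ h * (L * (E * q)) := Nat.mul_le_mul_right _ h2h
  have a6 : 2 ^ 23 * q * (E * 2 ^ h) * L = 8388608 * (2 ^ h * (L * (E * q))) := by ring
  have a7 : 32 * h * (65536 * (E * q)) = 2097152 * (h * 1 * (E * q)) := by ring
  have a8 : h * L * (E * q) = h * (L * (E * q)) := by ring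
  have a9 : 32 * h * L = 32 * (h * L) := by ring
  rw [a6, a9]
  rw [a7] at a3
  omega

theorem exists_levels (c n : ℕ) :
    Nat.log 2 n < ∑ j ∈ Finset.range (Nat.log 2 n + 1), cost c n j := by
  have h : ∀ j ∈ Finset.range (Nat.log 2 n + 1), 1 ≤ cost c n j := fun j _ => by
    unfold cost; omega
  have := Finset.card_nsmul_le_sum _ _ _ h
  simp at this
  omega

/-- The number of levels: as many as fit into `log n` rounds altogether. -/
noncomputable def levels (c n : ℕ) : ℕ :=
  sInf {i | Nat.log 2 n < ∑ j ∈ Finset.range (i + 1), cost c n j}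

theorem log_lt_sum_cost (c n : ℕ) :
    Nat.log 2 n < ∑ j ∈ Finset.range (levels c n + 1), cost c n j :=
  Nat.sInf_mem (s := {i | Nat.log 2 n < ∑ j ∈ Finset.range (i + 1), cost c n j})
    ⟨_, exists_levels c n⟩

theorem levels_le (c n : ℕ) : levels c n ≤ Nat.log 2 n :=
  Nat.sInf_le (exists_levels c n)

theorem sum_cost_le (c n : ℕ) : ∑ j ∈ Finset.range (levels c n), cost c n j ≤ Nat.log 2 n := by
  rcases Nat.eq_zero_or_pos (levels c n) with h | h
  · rw [h]; simp
  · have h1 : levels c n - 1 < levels c n := by omega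
    have h2 := Nat.notMem_of_lt_sInf h1
    rw [show levels c n = levels c n - 1 + 1 by omega]
    exact not_lt.mp h2

/-- If the level `k` is reached by at most `n / 2 ^ shrink k` nodes, then the total time spent by
all nodes is `O(n log* n)`: the stage after the last level takes `O(log n)` rounds, which by the
choice of the number of levels is at most the time of the levels so far. -/
theorem total_cost_le {c n : ℕ} (hn : 2 ≤ n) {A : ℝ} (hA : ∀ I,
    ∑ i ∈ Finset.range I, ((i : ℝ) + 1) * 2 ^ (257 * height i) / 2 ^ shrink i ≤ A)
    {w : ℕ → ℕ} (hw : ∀ k ≤ levels c n, w k * 2 ^ shrink k ≤ n) :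
    ((∑ k ∈ Finset.range (levels c n), cost c n k * w k +
      (7 * (4 * (Nat.log 2 n + 1)) + 5) * w (levels c n) : ℕ) : ℝ) ≤
      62 * (2 ^ 23 * (c + 3) ^ 4) * A * logStar n * n := by
  set D : ℝ := 2 ^ 23 * ((c : ℝ) + 3) ^ 4 with hD
  set L : ℝ := (logStar n : ℝ) with hL
  have hL0 : 0 ≤ L := Nat.cast_nonneg _
  have hD0 : 0 ≤ D := by positivity
  have hcost : ∀ k, (cost c n k : ℝ) ≤ D * 2 ^ (257 * height k) * L := fun k => by
    have := cost_le (c := c) hn k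
    rw [hD, hL]
    exact_mod_cast this
  have hw' : ∀ k ≤ levels c n, (w k : ℝ) ≤ n / 2 ^ shrink k := fun k hk => by
    rw [le_div_iff₀ (by positivity)]
    exact_mod_cast hw k hk
  set a : ℕ → ℝ := fun i => ((i : ℝ) + 1) * 2 ^ (257 * height i) / 2 ^ shrink i with ha
  have ha0 : ∀ i, 0 ≤ a i := fun i => by rw [ha]; positivity
  have h1 : ∀ k ≤ levels c n,
      ((k : ℝ) + 1) * (D * 2 ^ (257 * height k) * L) * w k ≤ D * L * n * a k := by
    intro k hk
    calc ((k : ℝ) + 1) * (D * 2 ^ (257 * height k) * L) * w k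
        ≤ ((k : ℝ) + 1) * (D * 2 ^ (257 * height k) * L) * (n / 2 ^ shrink k) :=
          mul_le_mul_of_nonneg_left (hw' k hk) (by positivity)
      _ = D * L * n * a k := by rw [ha]; ring
  have h2 : ∀ k ≤ levels c n, (cost c n k : ℝ) * w k ≤ D * L * n * a k := by
    intro k hk
    refine le_trans ?_ (h1 k hk)
    refine mul_le_mul_of_nonneg_right ((hcost k).trans ?_) (Nat.cast_nonneg _)
    have : (0 : ℝ) ≤ k := Nat.cast_nonneg k
    exact le_mul_of_one_le_left (by positivity) (by linarith)
  have h3 : (∑ k ∈ Finset.range (levels c n), (cost c n k : ℝ) * w k) ≤ D * L * n * A := by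
    refine (Finset.sum_le_sum fun k hk => h2 k (Finset.mem_range.mp hk).le).trans ?_
    rw [← Finset.mul_sum]
    exact mul_le_mul_of_nonneg_left (hA _) (by positivity)
  set q := levels c n with hq
  -- the levels up to the first one that was left out take more than `log n` rounds
  have h4 : (Nat.log 2 n : ℝ) ≤ ((q : ℝ) + 1) * (D * 2 ^ (257 * height q) * L) := by
    have e : (Nat.log 2 n : ℝ) ≤ ∑ j ∈ Finset.range (q + 1), (cost c n j : ℝ) := by
      exact_mod_cast (log_lt_sum_cost c n).le
    refine e.trans ((Finset.sum_le_card_nsmul _ _ (D * 2 ^ (257 * height q) * L)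
      fun j hj => (hcost j).trans ?_).trans (le_of_eq ?_))
    · have hj' : j ≤ q := Nat.lt_succ_iff.mp (Finset.mem_range.mp hj)
      have : height j ≤ height q :=
        Nat.mul_le_mul_left 4 (Nat.pow_le_pow_left (Nat.succ_le_succ hj') 2)
      gcongr
      norm_num
    · rw [Finset.card_range, nsmul_eq_mul]
      push_cast
      ring
  have h5 : a q ≤ A := by
    refine le_trans ?_ (hA (q + 1))
    rw [Finset.sum_range_succ]
    exact le_add_of_nonneg_left (Finset.sum_nonneg fun i _ => ha0 i)
  have h6 : (Nat.log 2 n : ℝ) * w q ≤ D * L * n * A :=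
    ((mul_le_mul_of_nonneg_right h4 (Nat.cast_nonneg _)).trans (h1 q le_rfl)).trans
      (mul_le_mul_of_nonneg_left h5 (by positivity))
  have h7 : 1 ≤ Nat.log 2 n := Nat.log_pos (by norm_num) hn
  have h8 : ((7 * (4 * (Nat.log 2 n + 1)) + 5 : ℕ) : ℝ) ≤ 61 * (Nat.log 2 n : ℝ) := by
    have : 7 * (4 * (Nat.log 2 n + 1)) + 5 ≤ 61 * Nat.log 2 n := by omega
    exact_mod_cast this
  have h9 := mul_le_mul_of_nonneg_right h8 (Nat.cast_nonneg (α := ℝ) (w q))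
  rw [Nat.cast_add, Nat.cast_sum, Nat.cast_mul]
  simp only [Nat.cast_mul] at h3 h9 ⊢
  linarith

/-! ### The algorithm -/

/-- The stages of the algorithm: the selection of three edges per node, the levels, and the
completion. -/
noncomputable def stages (c n : ℕ) : ℕ → Stage
  | 0 => Pick.stage
  | k + 1 => if k < levels c n then
      Plan.stage (Level.plan (centers c n k) (height k)) (32 * height k)
    else Plan.stage (Finish.plan (4 * (Nat.log 2 n + 1))) (4 * (Nat.log 2 n + 1))

/-- The numbers of rounds that the stages take. -/
noncomputable def radius (c n : ℕ) : ℕ → ℕ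
  | 0 => 1
  | k + 1 => if k < levels c n then cost c n k else 7 * (4 * (Nat.log 2 n + 1)) + 5

theorem stages_isLocal (c n k : ℕ) : (stages c n k).IsLocal (radius c n k) := by
  cases k with
  | zero => exact Pick.isLocal
  | succ k =>
    by_cases h : k < levels c n
    · simp only [stages, radius, if_pos h]
      exact level_isLocal c n k
    · simp only [stages, radius, if_neg h]
      exact Finish.isLocal _

theorem sum_radius (c n : ℕ) (w : ℕ → ℕ) :
    ∑ k ∈ Finset.range (levels c n + 2), radius c n k * w k =
      w 0 + (∑ k ∈ Finset.range (levels c n), cost c n k * w (k + 1) +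
        (7 * (4 * (Nat.log 2 n + 1)) + 5) * w (levels c n + 1)) := by
  rw [Finset.sum_range_succ', Finset.sum_range_succ, add_comm]
  congr 1
  · simp [radius]
  · congr 1
    · refine Finset.sum_congr rfl fun k hk => ?_
      rw [radius, if_pos (Finset.mem_range.mp hk)]
    · rw [radius, if_neg (lt_irrefl _)]

theorem sum_radius_le {c n : ℕ} (hn : 2 ≤ n) :
    1 + ∑ k ∈ Finset.range (levels c n + 2), radius c n k ≤ 64 * Nat.log 2 n := by
  have h := sum_radius c n fun _ => 1
  simp only [mul_one] at h
  have h1 := sum_cost_le c n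
  have h2 : 1 ≤ Nat.log 2 n := Nat.log_pos (by norm_num) hn
  omega

/-- The instance consists of at most `n` nodes of degree at least three, all of them needy, with
identifiers below `n ^ c`. -/
structure Initial (c n : ℕ) (I : Inst) : Prop where
  finite : I.needy.Finite
  card : I.needy.ncard ≤ n
  lt : ∀ x y, I.gr.Adj x y → x < n ^ c
  needy : I.gr.support ⊆ I.needy
  deg : ∀ v ∈ I.needy, 3 ≤ (I.gr.neighborSet v).encard

section Run

variable {c n : ℕ} {I : Inst}

theorem inst_stages_le (c n k : ℕ) (I : Inst) : (inst (stages c n) I k).gr ≤ I.gr :=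
  inst_antitone (fun k I => (stages_isLocal c n k).le I) (Nat.zero_le k)

/-- The invariant before the level `k`: the instance is thin, and it lives on few nodes. -/
structure Reached (c n : ℕ) (I : Inst) (k : ℕ) : Prop where
  thin : ∃ Z, Thin (fun j => 16 * height j) k Z (inst (stages c n) I (k + 1))
  small : ∃ S : Set ℕ, S.Finite ∧ S.ncard * 2 ^ shrink k ≤ n ∧
    (inst (stages c n) I (k + 1)).needy ⊆ S ∧ (inst (stages c n) I (k + 1)).gr.support ⊆ S

theorem height_pos (k : ℕ) : 0 < height k := by
  unfold height; positivity

theorem Reached.needy_finite {k : ℕ} (h : Reached c n I k) :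
    (inst (stages c n) I (k + 1)).needy.Finite := by
  obtain ⟨S, hS, -, h1, -⟩ := h.small
  exact hS.subset h1

theorem Reached.needy_card {k : ℕ} (h : Reached c n I k) :
    (inst (stages c n) I (k + 1)).needy.ncard * 2 ^ shrink k ≤ n := by
  obtain ⟨S, hS, h1, h2, -⟩ := h.small
  exact (Nat.mul_le_mul_right _ (Set.ncard_le_ncard h2 hS)).trans h1

theorem Initial.centers_spec (hI : Initial c n I) (hn : 2 ≤ n) {k : ℕ} (h : Reached c n I k) :
    Level.Centers (centers c n k) (height k) (inst (stages c n) I (k + 1)) where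
  sep x hx y hy hxy := by
    obtain ⟨Z, hZ⟩ := h.thin
    exact greedy_separated hZ.deg (fun x y hxy => hI.lt x y (inst_stages_le c n _ I hxy)) hx hy hxy
  cov v := exists_mem_greedy (coloring_lt (Or.inr (logStar_pos hn)))

theorem Initial.reached (hI : Initial c n I) (hn : 2 ≤ n) {k : ℕ} (hk : k ≤ levels c n) :
    Reached c n I k := by
  induction k with
  | zero =>
    refine ⟨⟨fun _ => ∅, Pick.thin_next hI.deg _ _⟩, I.needy, hI.finite, ?_, fun v hv => hv.1, ?_⟩
    · simpa [shrink] using hI.card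
    · rintro v ⟨w, hvw⟩
      exact hI.needy ⟨w, inst_stages_le c n 1 I hvw⟩
  | succ k ih =>
    have hr := ih (by omega)
    have hC := hI.centers_spec hn hr
    obtain ⟨Z, hZ⟩ := hr.thin
    have hnext : inst (stages c n) I (k + 1 + 1) =
        (Level.plan (centers c n k) (height k) (inst (stages c n) I (k + 1))).next
          (inst (stages c n) I (k + 1)) (32 * height k) := by
      show (stages c n (k + 1)).next _ = _
      rw [stages, if_pos (by omega)]
      rfl
    have hs : ∀ j < k, 0 < 16 * height j := fun j _ => by have := height_pos j; omega
    refine ⟨⟨_, hnext ▸ hC.thin_next hZ hs (level_gaps k) (height_pos k) le_rfl⟩,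
      (Level.plan (centers c n k) (height k) (inst (stages c n) I (k + 1))).kept,
      hr.needy_finite.subset hC.kept_subset, ?_, ?_, ?_⟩
    · have h1 := hC.ncard_kept_le hZ hs (level_gaps k) (height_pos k) hr.needy_finite
      have h2 : shrink (k + 1) = 3 * height k + shrink k := by
        rw [shrink, Finset.sum_range_succ, mul_add, ← shrink, add_comm]
      rw [h2, pow_add, ← mul_assoc, mul_comm _ (2 ^ (3 * height k))]
      exact (Nat.mul_le_mul_right _ h1).trans hr.needy_card
    · rw [hnext]
      exact fun v hv => hv.1
    · rw [hnext]
      rintro v ⟨w, hvw⟩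
      exact hvw.2.1

/-- All stages are correct. At the completion, the invariant holds with at most `log n` levels. -/
theorem Initial.correct (hI : Initial c n I) (hn : 2 ≤ n) {k : ℕ} (hk : k < levels c n + 2) :
    (stages c n k).Correct (inst (stages c n) I k) := by
  cases k with
  | zero => exact Pick.correct _
  | succ k =>
    have hr := hI.reached hn (show k ≤ levels c n by omega)
    obtain ⟨Z, hZ⟩ := hr.thin
    have hs : ∀ j < k, 0 < 16 * height j := fun j _ => by have := height_pos j; omega
    by_cases h : k < levels c n
    · rw [stages, if_pos h]
      exact ((hI.centers_spec hn hr).valid hZ hs (level_gaps k) (height_pos k)).correct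
    · rw [stages, if_neg h]
      refine (Finish.valid hZ hs hr.needy_finite (finish_gaps ?_ ?_)).correct
      · exact (Nat.le_mul_of_pos_right _ (by positivity)).trans hr.needy_card
      · exact (show k ≤ levels c n by omega).trans (levels_le c n)

theorem end_needy (c n : ℕ) (I : Inst) : (inst (stages c n) I (levels c n + 2)).needy = ∅ := by
  show ((stages c n (levels c n + 1)).next _).needy = ∅
  rw [stages, if_neg (lt_irrefl _)]
  exact Finish.next_needy _ _

theorem end_not_adj (c n : ℕ) (I : Inst) (v w : ℕ) :
    ¬ (inst (stages c n) I (levels c n + 2)).gr.Adj v w := by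
  show ¬ ((stages c n (levels c n + 1)).next _).gr.Adj v w
  rw [stages, if_neg (lt_irrefl _)]
  exact Finish.next_not_adj _ _ v w

/-- The first stage before which all edges at `v` have been oriented. -/
theorem exists_first_isolated (c n : ℕ) (I : Inst) (v : ℕ) : ∃ k ≤ levels c n + 2,
    (∀ w, ¬ (inst (stages c n) I k).gr.Adj v w) ∧
      ∀ j < k, v ∈ (inst (stages c n) I j).gr.support := by
  classical
  have hex : ∃ k, ∀ w, ¬ (inst (stages c n) I k).gr.Adj v w := ⟨_, end_not_adj c n I v⟩
  refine ⟨Nat.find hex, Nat.find_le (end_not_adj c n I v), Nat.find_spec hex, fun j hj => ?_⟩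
  have := Nat.find_min hex hj
  push Not at this
  exact this

end Run

/-- The algorithm: every node evaluates the orientation computed by the stages on what it has seen
of the graph. -/
noncomputable def algorithm (c : ℕ) : LocalAlgorithm (Finset ℕ) :=
  gather (fun n => stageOutput (stages c n) (levels c n + 2))
    fun n => 1 + ∑ k ∈ Finset.range (levels c n + 2), radius c n k

section Network

variable {V : Type*} {G : SimpleGraph V} {ident : V → ℕ} {c : ℕ}

/-- The initial instance on the network. -/
def start (G : SimpleGraph V) (ident : V → ℕ) : Inst :=
  ⟨idGraph G ident, (idGraph G ident).support⟩

theorem neighborSet_idGraph (hi : Function.Injective ident) (v : V) :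
    (idGraph G ident).neighborSet (ident v) = ident '' G.neighborSet v := by
  ext y
  simp only [SimpleGraph.mem_neighborSet, idGraph_adj hi, Set.mem_image]
  constructor
  · rintro ⟨u, w, h, hu, rfl⟩
    obtain rfl := hi hu
    exact ⟨w, h, rfl⟩
  · rintro ⟨w, h, rfl⟩
    exact ⟨v, w, h, rfl, rfl⟩

theorem support_idGraph_subset (hi : Function.Injective ident) :
    (idGraph G ident).support ⊆ Set.range ident := by
  rintro x ⟨y, h⟩
  obtain ⟨u, w, -, rfl, -⟩ := (idGraph_adj hi).mp h
  exact ⟨u, rfl⟩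

variable [Fintype V]

theorem initial_start [DecidableRel G.Adj] (hi : Function.Injective ident)
    (hid : ∀ v, ident v < Fintype.card V ^ c) (hdeg : ∀ v, 3 ≤ G.degree v) :
    Initial c (Fintype.card V) (start G ident) where
  finite := (Set.finite_range ident).subset (support_idGraph_subset hi)
  card := by
    refine (Set.ncard_le_ncard (support_idGraph_subset hi) (Set.finite_range ident)).trans ?_
    rw [← Set.image_univ]
    refine (Set.ncard_image_le Set.finite_univ).trans ?_
    rw [Set.ncard_univ, Nat.card_eq_fintype_card]
  lt x y h := by
    obtain ⟨u, w, -, rfl, -⟩ := (idGraph_adj hi).mp h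
    exact hid u
  needy := subset_rfl
  deg v hv := by
    obtain ⟨u, rfl⟩ := support_idGraph_subset hi hv
    show 3 ≤ ((idGraph G ident).neighborSet (ident u)).encard
    rw [neighborSet_idGraph hi, hi.encard_image, Set.encard_eq_coe_toFinset_card]
    have := hdeg u
    rw [← SimpleGraph.card_neighborFinset_eq_degree] at this
    exact_mod_cast this

theorem determined_of_isolated {k : ℕ} (v : V)
    (h : ∀ w, ¬ (inst (stages c (Fintype.card V)) (start G ident) k).gr.Adj (ident v) w) :
    Determined (stageOutput (stages c (Fintype.card V)) (levels c (Fintype.card V) + 2))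
      (idGraph G ident) (ident v) (∑ j ∈ Finset.range k, radius c (Fintype.card V) j) :=
  stageOutput_determined (stages_isLocal c _) h

theorem determined_end (c : ℕ) (G : SimpleGraph V) (ident : V → ℕ) (v : V) :
    Determined (stageOutput (stages c (Fintype.card V)) (levels c (Fintype.card V) + 2))
      (idGraph G ident) (ident v)
      (∑ j ∈ Finset.range (levels c (Fintype.card V) + 2), radius c (Fintype.card V) j) :=
  determined_of_isolated v (end_not_adj c _ _ _)

theorem computesSinklessOrientation [DecidableRel G.Adj] (hi : Function.Injective ident)
    (hid : ∀ v, ident v < Fintype.card V ^ c) (hdeg : ∀ v, 3 ≤ G.degree v)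
    (hn : 2 ≤ Fintype.card V) : (algorithm c).ComputesSinklessOrientation G ident := by
  set n := Fintype.card V with hn'
  have hI := initial_start hi hid hdeg
  have hc : ∀ k < levels c n + 2, (stages c n k).Correct (inst (stages c n) (start G ident) k) :=
    fun k hk => hI.correct hn hk
  have hT : (∑ j ∈ Finset.range (levels c n + 2), radius c n j) + 1 ≤
      1 + ∑ j ∈ Finset.range (levels c n + 2), radius c n j := by omega
  have hdir : ∀ u v, (∃ S, (algorithm c).result G ident u = some S ∧ ident v ∈ S) ↔
      total (stages c n) (levels c n + 2) (start G ident) (ident u) (ident v) := by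
    intro u v
    have hfin : {w | total (stages c n) (levels c n + 2) (start G ident) (ident u) w}.Finite :=
      (Set.finite_range ident).subset fun w hw =>
        support_idGraph_subset hi ⟨_, (adj_of_total hc hw).symm⟩
    have hres : (algorithm c).result G ident u = _ :=
      gather_result hi hT (determined_end c G ident u)
    rw [hres]
    constructor
    · rintro ⟨S, hS, hv⟩
      obtain rfl := Option.some.inj hS
      exact (mem_finsetOf hfin).mp hv
    · exact fun h => ⟨_, rfl, (mem_finsetOf hfin).mpr h⟩
  refine ⟨fun v => ⟨_, gather_terminatedBy hi hT (determined_end c G ident v)⟩, ?_⟩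
  simp only [hdir]
  exact
    { adj_of_dir := fun u v h => (idGraph_adj_ident hi).mp (adj_of_total hc h)
      dir_of_adj := fun u v h =>
        total_or_total hc (end_not_adj c n _) ((idGraph_adj_ident hi).mpr h)
      not_both := fun u v h => total_asymm hc h
      exists_out := fun u => by
        have hu : ident u ∈ (start G ident).needy := by
          have : 0 < G.degree u := by have := hdeg u; omega
          obtain ⟨w, hw⟩ := (G.degree_pos_iff_exists_adj u).mp this
          exact ⟨ident w, (idGraph_adj_ident hi).mpr hw⟩
        obtain ⟨w, hw⟩ := exists_total hc (end_needy c n _) hu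
        obtain ⟨x, rfl⟩ := support_idGraph_subset hi ⟨_, (adj_of_total hc hw).symm⟩
        exact ⟨x, hw⟩ }

theorem worstCase_le (hi : Function.Injective ident) (hn : 2 ≤ Fintype.card V) :
    (algorithm c).worstCase G ident ≤ 64 * Nat.log 2 (Fintype.card V) :=
  (gather_worstCase_le hi fun v => ⟨_, by omega, determined_end c G ident v⟩).trans
    (sum_radius_le hn)

open Classical in
/-- A node commits as soon as all its edges have been oriented, so its computation time is at most
the total time of the stages in which it takes part. -/
theorem computationTime_le (hi : Function.Injective ident) (v : V) :
    (algorithm c).computationTime G ident v ≤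
      1 + ∑ k ∈ Finset.range (levels c (Fintype.card V) + 2), radius c (Fintype.card V) k *
        if ident v ∈ (inst (stages c (Fintype.card V)) (start G ident) k).gr.support
          then 1 else 0 := by
  obtain ⟨k, hk, h1, h2⟩ := exists_first_isolated c (Fintype.card V) (start G ident) (ident v)
  have hsub : Finset.range k ⊆ Finset.range (levels c (Fintype.card V) + 2) :=
    Finset.range_mono hk
  refine (gather_computationTime_le hi (r := ∑ j ∈ Finset.range k, radius c (Fintype.card V) j) ?_
    (determined_of_isolated v h1)).trans ?_
  · have := Finset.sum_le_sum_of_subset (f := fun j => radius c (Fintype.card V) j) hsub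
    omega
  · rw [add_comm]
    refine Nat.add_le_add_left ?_ 1
    refine le_trans (Finset.sum_le_sum fun j hj => ?_) (Finset.sum_le_sum_of_subset hsub)
    rw [if_pos (h2 j (Finset.mem_range.mp hj)), mul_one]

theorem sum_computationTime_le [DecidableRel G.Adj] (hi : Function.Injective ident)
    (hid : ∀ v, ident v < Fintype.card V ^ c) (hdeg : ∀ v, 3 ≤ G.degree v)
    (hn : 2 ≤ Fintype.card V) {A : ℝ} (hA : ∀ I,
      ∑ i ∈ Finset.range I, ((i : ℝ) + 1) * 2 ^ (257 * height i) / 2 ^ shrink i ≤ A) :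
    (∑ v, ((algorithm c).computationTime G ident v : ℝ)) ≤
      2 * Fintype.card V +
        62 * (2 ^ 23 * (c + 3) ^ 4) * A * logStar (Fintype.card V) * Fintype.card V := by
  classical
  set n := Fintype.card V with hn'
  have hI := initial_start hi hid hdeg
  -- the number of nodes that take part in the stage `k`
  let w : ℕ → ℕ := fun k =>
    (Finset.univ.filter fun v => ident v ∈ (inst (stages c n) (start G ident) k).gr.support).card
  have h1 : ∑ v, (algorithm c).computationTime G ident v ≤
      n + ∑ k ∈ Finset.range (levels c n + 2), radius c n k * w k := by
    refine (Finset.sum_le_sum fun v _ => computationTime_le hi v).trans (le_of_eq ?_)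
    rw [Finset.sum_add_distrib, Finset.sum_comm]
    congr 1
    · simp [hn']
    · refine Finset.sum_congr rfl fun k _ => ?_
      rw [← Finset.mul_sum, Finset.sum_boole]
      rfl
  have h2 : w 0 ≤ n := Finset.card_le_univ _
  have h3 : ∀ k ≤ levels c n, w (k + 1) * 2 ^ shrink k ≤ n := by
    intro k hk
    obtain ⟨S, hS, hcard, -, hsub⟩ := (hI.reached hn hk).small
    refine (Nat.mul_le_mul_right _ ?_).trans hcard
    rw [Set.ncard_eq_toFinset_card _ hS]
    refine Finset.card_le_card_of_injOn ident (fun v hv => ?_) hi.injOn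
    simpa using hsub (by simpa using hv)
  have h4 := total_cost_le hn hA (w := fun k => w (k + 1)) h3
  rw [sum_radius] at h1
  have h5 : (∑ v, ((algorithm c).computationTime G ident v : ℝ)) ≤
      ((n + (w 0 + (∑ k ∈ Finset.range (levels c n), cost c n k * w (k + 1) +
        (7 * (4 * (Nat.log 2 n + 1)) + 5) * w (levels c n + 1))) : ℕ) : ℝ) := by
    exact_mod_cast h1
  rw [Nat.cast_add, Nat.cast_add (w 0)] at h5
  have h6 : (w 0 : ℝ) ≤ n := by exact_mod_cast h2
  linarith

end Network

end SinklessOrientation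

open SinklessOrientation in
theorem mainTheorem6 (c : ℕ) :
    ∃ (A : LocalAlgorithm (Finset ℕ)) (C : ℝ),
      ∀ (V : Type*) [Fintype V] (G : SimpleGraph V) [DecidableRel G.Adj] (ident : V → ℕ),
        Function.Injective ident →
        (∀ v, ident v < Fintype.card V ^ c) →
        (∀ v, 3 ≤ G.degree v) →
          A.ComputesSinklessOrientation G ident ∧
          A.nodeAverage G ident ≤ C * logStar (Fintype.card V) ∧
          (A.worstCase G ident : ℝ) ≤ C * Real.log (Fintype.card V) := by
  obtain ⟨A, hA⟩ := exists_total_weight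
  have hA0 : 0 ≤ A := by simpa using hA 0
  have hD : (0 : ℝ) ≤ 62 * (2 ^ 23 * (c + 3) ^ 4) * A := by positivity
  refine ⟨algorithm c, 128 + 62 * (2 ^ 23 * (c + 3) ^ 4) * A, ?_⟩
  intro V _ G _ ident hi hid hdeg
  rcases isEmpty_or_nonempty V with hV | ⟨⟨v⟩⟩
  · refine ⟨⟨fun v => hV.elim v, ⟨fun v => hV.elim v, fun v => hV.elim v, fun v => hV.elim v,
      fun v => hV.elim v⟩⟩, ?_, ?_⟩
    · simp only [LocalAlgorithm.nodeAverage, Finset.univ_eq_empty, Finset.sum_empty, zero_div]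
      positivity
    · simp [LocalAlgorithm.worstCase]
  · have hn : 2 ≤ Fintype.card V := by
      have := hdeg v
      have := G.degree_lt_card_verts v
      omega
    refine ⟨computesSinklessOrientation hi hid hdeg hn, ?_, ?_⟩
    · have hpos : (0 : ℝ) < Fintype.card V := by
        have : 0 < Fintype.card V := by omega
        exact_mod_cast this
      have hL : (1 : ℝ) ≤ logStar (Fintype.card V) := by exact_mod_cast logStar_pos hn
      rw [LocalAlgorithm.nodeAverage, div_le_iff₀ hpos]
      refine (sum_computationTime_le hi hid hdeg hn hA).trans ?_
      nlinarith
    · have h1 : ((algorithm c).worstCase G ident : ℝ) ≤ 64 * (Nat.log 2 (Fintype.card V) : ℝ) := by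
        exact_mod_cast worstCase_le hi hn
      have h2 := Real.natLog_le_logb (Fintype.card V) 2
      have h3 : 0 ≤ Real.log (Fintype.card V) := Real.log_natCast_nonneg _
      have h4 : Real.logb 2 (Fintype.card V) ≤ 2 * Real.log (Fintype.card V) := by
        rw [Real.logb, div_le_iff₀ (Real.log_pos (by norm_num))]
        have := Real.log_two_gt_d9
        nlinarith
      push_cast at h2
      nlinarith
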